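/- Let $(U_k)_{k\ge 0}$ be i.i.d. random variables, uniform on $[-1,1]$, on a probability space $(\Omega,P)$. Let $Y_t=\sum_{k\ge0}\mathbf 1_{[2k+1+U_k,\infty)}(t)$, $\mathcal F_t=\sigma(Y_s:0\le s\le t)$, and $\tilde{\mathcal F}_t=\mathcal F_{2k}$ for $2k\le t<2k+2$, $k\in\mathbb N$. For $X=f(U_0,\dots,U_n)$ with $f\in\mathcal C^1_b([-1,1]^{n+1})$ put $$D_tX=\sum_{k=0}^n\partial_kf(U_0,\dots,U_n)\big((1-U_k)\mathbf 1_{(2k,2k+1+U_k]}(t)-(1+U_k)\mathbf 1_{(2k+1+U_k,2k+2]}(t)\big),$$ and let $D:\mathrm{Dom}(D)\subset L^2(\Omega)\to L^2(\Omega\times\mathbb R_+)$ also denote the closure of this operator. For $X\in\mathrm{Dom}(D)$ the process $t\mapsto E[D_tX\mid\tilde{\mathcal F}_t]$ has a jointly measurable version, and the random variable $$G_X=\langle D_\cdot X,E[D_\cdot X\mid\tilde{\mathcal F}_\cdot]\rangle_{L^2(\mathbb R_+)}=\int_0^\infty D_tX\,E[D_tX\mid\tilde{\mathcal F}_t]\,dt$$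 is well defined a.s. and integrable. Let $d_W(X,Y)=\sup_h|E[h(X)]-E[h(Y)]|$ over the $1$-Lipschitz functions $h:\mathbb R\to\mathbb R$, let $d_{TV}(X,Y)=\sup_A|P(X\in A)-P(Y\in A)|$ over the Borel sets $A\subset\mathbb R$, and let $d_{\mathcal H}(X,Y)=\sup_h|E[h(X)]-E[h(Y)]|$ over the $h\in\mathcal C^2_b(\mathbb R)$ with $\max(\|h\|_\infty,\|h'\|_\infty,\|h''\|_\infty)\le1$. Let $\mathcal N$ be a standard normal random variable and, for $\nu>0$, let $\Gamma_\nu=2\Gamma(\nu/2)-\nu$, where $\Gamma(\nu/2)$ has the gamma law with shape $\nu/2$ and rate $1$. Norms may take the value $+\infty$. **Proposition.** For every $X\in\mathrm{Dom}(D)$ with $E[X]=0$, $$d_W(X,\mathcal N)\le\tfrac12\|2-G_X\|_{L^2(\Omega)}\le|1-E[X^2]|+\tfrac12\|G_X-E[G_X]\|_{L^2(\Omega)},$$ $$d_{TV}(X,\mathcal N)\le\|2-G_X\|_{L^2(\Omega)}\le2|1-E[X^2]|+\|G_X-E[G_X]\|_{L^2(\Omega)}.$$ If moreover $\nu>0$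 and $X>-\nu$ a.s., then $$d_{\mathcal H}(X,\Gamma_\nu)\le\big\|2(X+\nu)-\tfrac12G_X\big\|_{L^2(\Omega)}\le\big\|2(X+\nu)-E[X^2]\big\|_{L^2(\Omega)}+\tfrac12\|G_X-E[G_X]\|_{L^2(\Omega)}.$$ -/

import Mathlib

open MeasureTheory ProbabilityTheory Filter Topology
open scoped ENNReal

noncomputable section

namespace UniformMalliavin

/-! ### Distances between laws on the real line (with values in `[0, ∞]`) -/

/-- Total variation distance: supremum over Borel sets of the difference of probabilities. -/
def dTV (μ ν : Measure ℝ) : ℝ≥0∞ :=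
  ⨆ (A : Set ℝ) (_ : MeasurableSet A), ENNReal.ofReal |μ.real A - ν.real A|

/-- Wasserstein distance: supremum over test functions with Lipschitz constant at most `1`. -/
def dW (μ ν : Measure ℝ) : ℝ≥0∞ :=
  ⨆ (h : ℝ → ℝ) (_ : LipschitzWith 1 h), ENNReal.ofReal |(∫ x, h x ∂μ) - ∫ x, h x ∂ν|

/-- The class of `C²` functions that are bounded by `1` together with their first two
derivatives. -/
def classH : Set (ℝ → ℝ) :=
  {h | ContDiff ℝ 2 h ∧ ∀ x, |h x| ≤ 1 ∧ |deriv h x| ≤ 1 ∧ |iteratedDeriv 2 h x| ≤ 1}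

/-- The distance given by the test functions in `classH`. -/
def dH (μ ν : Measure ℝ) : ℝ≥0∞ :=
  ⨆ (h : ℝ → ℝ) (_ : h ∈ classH), ENNReal.ofReal |(∫ x, h x ∂μ) - ∫ x, h x ∂ν|

/-- The centered gamma law: the law of `2 Γ(ν/2) - ν`, where `Γ(ν/2)` has the gamma law with
shape `ν/2` and rate `1`. -/
def centeredGamma (ν : ℝ) : Measure ℝ :=
  (gammaMeasure (ν / 2) 1).map (fun x => 2 * x - ν)

/-- Lebesgue measure on the half line `[0, ∞)`. -/
def halfLine : Measure ℝ := volume.restrict (Set.Ici 0)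

variable {Ω : Type*} [MeasurableSpace Ω]

/-! ### The jump process and its filtration -/

/-- `Y_t = ∑ₖ 1_{[2k+1+Uₖ, ∞)}(t)`. -/
def jumpProcess (U : ℕ → Ω → ℝ) (t : ℝ) (ω : Ω) : ℝ≥0∞ :=
  ∑' k : ℕ, (Set.Ici (2 * (k : ℝ) + 1 + U k ω)).indicator (fun _ => (1 : ℝ≥0∞)) t

/-- `ℱ_t = σ(Y_s : 0 ≤ s ≤ t)`. -/
abbrev jumpSigma (U : ℕ → Ω → ℝ) (t : ℝ) : MeasurableSpace Ω :=
  ⨆ s ∈ Set.Icc (0 : ℝ) t, MeasurableSpace.comap (jumpProcess U s) inferInstance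

/-- `ℱ̃_t = ℱ_{2k}` for `2k ≤ t < 2k + 2`. -/
abbrev blockSigma (U : ℕ → Ω → ℝ) (t : ℝ) : MeasurableSpace Ω :=
  jumpSigma U (2 * (⌊t / 2⌋₊ : ℝ))

/-! ### The gradient -/

/-- A cylindrical functional `f(U₀, …, Uₙ)` with `f` of class `C¹`. Only the values of `f` on the
cube `[-1,1]^{n+1}` matter; there a `C¹` function and its derivatives are bounded, and the `C¹`
functions on the closed cube are the restrictions of the `C¹` functions on `ℝ^{n+1}`. -/
structure SmoothFunctional where
  n : ℕ
  f : (Fin (n + 1) → ℝ) → ℝ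
  smooth : ContDiff ℝ 1 f

/-- The random variable `f(U₀, …, Uₙ)`. -/
def SmoothFunctional.eval (F : SmoothFunctional) (U : ℕ → Ω → ℝ) (ω : Ω) : ℝ :=
  F.f (fun i => U i ω)

/-- The gradient
`D_t f(U₀, …, Uₙ) = ∑ₖ ∂ₖf(U₀, …, Uₙ) ((1 - Uₖ) 1_{(2k, 2k+1+Uₖ]}(t) - (1 + Uₖ) 1_{(2k+1+Uₖ, 2k+2]}(t))`
of a cylindrical functional, as a function of `(ω, t)`. -/
def SmoothFunctional.grad (F : SmoothFunctional) (U : ℕ → Ω → ℝ) (p : Ω × ℝ) : ℝ :=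
  ∑ k : Fin (F.n + 1),
    fderiv ℝ F.f (fun i => U i p.1) (Pi.single k 1) *
      ((Set.Ioc (2 * (k : ℝ)) (2 * (k : ℝ) + 1 + U k p.1)).indicator
          (fun _ => 1 - U k p.1) p.2
        - (Set.Ioc (2 * (k : ℝ) + 1 + U k p.1) (2 * (k : ℝ) + 2)).indicator
          (fun _ => 1 + U k p.1) p.2)

/-- `X` lies in the domain of the closed gradient `D : Dom(D) ⊆ L²(Ω) → L²(Ω × ℝ₊)`, and `Z` is
(a version of) `DX`: the pair `(X, Z)` is in the closure of the graph of the gradient on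
cylindrical functionals. -/
structure HasGradient (U : ℕ → Ω → ℝ) (P : Measure Ω) (X : Ω → ℝ) (Z : Ω × ℝ → ℝ) : Prop where
  memLp : MemLp X 2 P
  memLp_grad : MemLp Z 2 (P.prod halfLine)
  exists_approx : ∃ F : ℕ → SmoothFunctional,
    Tendsto (fun n => eLpNorm (fun ω => (F n).eval U ω - X ω) 2 P) atTop (𝓝 0) ∧
    Tendsto (fun n => eLpNorm (fun p => (F n).grad U p - Z p) 2 (P.prod halfLine)) atTop (𝓝 0)

/-- `V` is a jointly measurable version of the process `t ↦ E[Z_t | ℱ̃_t]`. -/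
structure IsCondExpProcess (U : ℕ → Ω → ℝ) (P : Measure Ω) (Z V : Ω × ℝ → ℝ) : Prop where
  aestronglyMeasurable : AEStronglyMeasurable V (P.prod halfLine)
  ae_eq_condExp : ∀ᵐ t ∂halfLine,
    (fun ω => V (ω, t)) =ᵐ[P] P[fun ω => Z (ω, t) | blockSigma U t]

/-- The inner product `⟨Z, V⟩_{L²(ℝ₊)}` of two processes, as a random variable. -/
def pairing (Z V : Ω × ℝ → ℝ) (ω : Ω) : ℝ :=
  ∫ t, Z (ω, t) * V (ω, t) ∂halfLine

end UniformMalliavin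

end

/-!
Write `t = 2k + 1 + s` with `|s| ≤ 1`. Integrating by parts in `U_k`, the projection
`E[D_t X | ℱ̃_t]` of a cylindrical `X` is minus the martingale difference
`E[X | U_0, …, U_k] - E[X | U_0, …, U_{k-1}]` with `U_k` replaced by `s`. By the chain rule
`D φ(X) = φ'(X) DX`, the expectation of `φ'(X) G_X` is therefore twice the sum of the covariances
of the martingale differences of `φ(X)` and `X`, that is `2 Cov(φ(X), X)`. This passes to the
closure of `D`, because the projection contracts `L²`, and makes `τ = G_X / 2` a Stein kernel of
the centred variable `X`: `E[φ'(X) τ] = E[φ(X) X]` whenever `φ'` is bounded.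

It remains to insert a solution `φ` of Stein's equation for the target law. In the normal case
`|φ'| ≤ 1` for `1`-Lipschitz test functions and `|φ'| ≤ 2` for those with values in `[0, 1]`; in
the gamma case `|φ'| ≤ 1/2` for those in `classH`. The equation then turns the difference of
expectations into `E[φ'(X) (1 - τ)]`, respectively `E[φ'(X) (2 (X + ν) - τ)]`.
-/

noncomputable section

namespace UniformMalliavin

/-! ### Stein's equation for the standard normal law -/

lemma contDiff_one_of_hasDerivAt {f f' : ℝ → ℝ} (hf : ∀ x, HasDerivAt f (f' x) x)
    (hf' : Continuous f') : ContDiff ℝ 1 f :=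
  contDiff_one_iff_deriv.2
    ⟨fun x => (hf x).differentiableAt, (funext fun x => (hf x).deriv : deriv f = f') ▸ hf'⟩

lemma integrable_gaussianReal_iff {k : ℝ → ℝ} :
    Integrable k (gaussianReal 0 1) ↔ Integrable fun t => k t * gaussianPDFReal 0 1 t := by
  rw [gaussianReal_of_var_ne_zero _ one_ne_zero, integrable_withDensity_iff_integrable_smul'
    (measurable_gaussianPDF 0 1) (Eventually.of_forall fun _ => gaussianPDF_lt_top)]
  simp only [toReal_gaussianPDF, smul_eq_mul, mul_comm]

lemma integral_gaussianReal_eq (k : ℝ → ℝ) :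
    ∫ x, k x ∂(gaussianReal 0 1) = ∫ x, k x * gaussianPDFReal 0 1 x := by
  simp only [integral_gaussianReal_eq_integral_smul one_ne_zero, smul_eq_mul, mul_comm]

lemma integrable_id_gaussianReal : Integrable (fun z : ℝ => z) (gaussianReal 0 1) :=
  (memLp_id_gaussianReal' 1 (by simp)).integrable le_rfl

lemma integrable_id_mul_gaussianPDFReal : Integrable fun t : ℝ => t * gaussianPDFReal 0 1 t :=
  integrable_gaussianReal_iff.1 integrable_id_gaussianReal

lemma hasDerivAt_gaussianPDFReal (x : ℝ) :
    HasDerivAt (gaussianPDFReal 0 1) (-(x * gaussianPDFReal 0 1 x)) x := by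
  have hexponent : HasDerivAt (fun x : ℝ => -(x - 0) ^ 2 / (2 * ((1 : NNReal) : ℝ))) (-x) x :=
    ((((hasDerivAt_id x).sub_const 0).pow 2).neg.div_const _).congr_deriv (by simp; ring)
  rw [gaussianPDFReal_def]
  exact (hexponent.exp.const_mul _).congr_deriv (by ring)

lemma continuous_gaussianPDFReal : Continuous (gaussianPDFReal 0 1) :=
  continuous_iff_continuousAt.2 fun x => (hasDerivAt_gaussianPDFReal x).continuousAt

lemma tendsto_gaussianPDFReal_cocompact :
    Tendsto (gaussianPDFReal 0 1) (cocompact ℝ) (𝓝 0) := by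
  have hsq : Tendsto (fun t : ℝ => ‖t‖ ^ 2 / 2) (cocompact ℝ) atTop :=
    ((tendsto_pow_atTop two_ne_zero).comp
      (tendsto_norm_cocompact_atTop (E := ℝ))).atTop_div_const two_pos
  have hexp := (Real.tendsto_exp_atBot.comp (tendsto_neg_atTop_atBot.comp hsq)).const_mul
    (√(2 * Real.pi))⁻¹
  rw [mul_zero] at hexp
  refine hexp.congr fun t => ?_
  simp [gaussianPDFReal, neg_div]

lemma integral_Ioi_id_mul_gaussianPDFReal (x : ℝ) :
    ∫ t in Set.Ioi x, t * gaussianPDFReal 0 1 t = gaussianPDFReal 0 1 x := by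
  simpa using integral_Ioi_of_hasDerivAt_of_tendsto' (a := x)
    (fun t _ => (hasDerivAt_gaussianPDFReal t).neg.congr_deriv (neg_neg _))
    integrable_id_mul_gaussianPDFReal.integrableOn
    (tendsto_gaussianPDFReal_cocompact.mono_left atTop_le_cocompact).neg

lemma integral_Iic_id_mul_gaussianPDFReal (x : ℝ) :
    ∫ t in Set.Iic x, t * gaussianPDFReal 0 1 t = -gaussianPDFReal 0 1 x := by
  simpa using integral_Iic_of_hasDerivAt_of_tendsto' (a := x)
    (fun t _ => (hasDerivAt_gaussianPDFReal t).neg.congr_deriv (neg_neg _))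
    integrable_id_mul_gaussianPDFReal.integrableOn
    (tendsto_gaussianPDFReal_cocompact.mono_left atBot_le_cocompact).neg

lemma mul_integral_Ioi_gaussianPDFReal_le (x : ℝ) :
    x * ∫ t in Set.Ioi x, gaussianPDFReal 0 1 t ≤ gaussianPDFReal 0 1 x := by
  rw [← integral_const_mul]
  refine (setIntegral_mono_on ((integrable_gaussianPDFReal 0 1).integrableOn.const_mul x)
    integrable_id_mul_gaussianPDFReal.integrableOn measurableSet_Ioi fun t ht =>
      mul_le_mul_of_nonneg_right (Set.mem_Ioi.1 ht).le (gaussianPDFReal_nonneg 0 1 t)).trans_eq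
    (integral_Ioi_id_mul_gaussianPDFReal x)

lemma neg_mul_integral_Iic_gaussianPDFReal_le (x : ℝ) :
    -x * ∫ t in Set.Iic x, gaussianPDFReal 0 1 t ≤ gaussianPDFReal 0 1 x := by
  rw [neg_mul, neg_le, ← integral_const_mul, ← integral_Iic_id_mul_gaussianPDFReal x]
  exact setIntegral_mono_on integrable_id_mul_gaussianPDFReal.integrableOn
    ((integrable_gaussianPDFReal 0 1).integrableOn.const_mul x) measurableSet_Iic fun t ht =>
      mul_le_mul_of_nonneg_right (Set.mem_Iic.1 ht) (gaussianPDFReal_nonneg 0 1 t)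

lemma hasDerivAt_integral_Iic {k : ℝ → ℝ} (hk : Integrable k) (hc : Continuous k) (x : ℝ) :
    HasDerivAt (fun y => ∫ t in Set.Iic y, k t) (k x) x := by
  have hsplit : (fun y => ∫ t in Set.Iic y, k t)
      = fun y => (∫ t in Set.Iic (0 : ℝ), k t) + ∫ t in (0 : ℝ)..y, k t := by
    funext y
    rw [← intervalIntegral.integral_Iic_sub_Iic hk.integrableOn hk.integrableOn,
      add_sub_cancel]
  rw [hsplit]
  exact (intervalIntegral.integral_hasDerivAt_right (hc.intervalIntegrable _ _)
    (hc.stronglyMeasurableAtFilter _ _) hc.continuousAt).const_add _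

/-- The solution `x ↦ p(x)⁻¹ ∫_{-∞}^x k p`, with `p` the standard normal density, of Stein's
equation `f' - x f = k`. -/
def normalStein (k : ℝ → ℝ) (x : ℝ) : ℝ :=
  (∫ t in Set.Iic x, k t * gaussianPDFReal 0 1 t) / gaussianPDFReal 0 1 x

lemma hasDerivAt_normalStein {k : ℝ → ℝ} (hc : Continuous k)
    (hk : Integrable k (gaussianReal 0 1)) (x : ℝ) :
    HasDerivAt (normalStein k) (x * normalStein k x + k x) x := by
  have hp : gaussianPDFReal 0 1 x ≠ 0 := (gaussianPDFReal_pos 0 1 x one_ne_zero).ne'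
  refine ((hasDerivAt_integral_Iic (integrable_gaussianReal_iff.1 hk)
    (hc.mul continuous_gaussianPDFReal) x).fun_div (hasDerivAt_gaussianPDFReal x) hp).congr_deriv ?_
  simp only [normalStein]
  field_simp
  ring

lemma abs_mul_normalStein_le {k : ℝ → ℝ} {C : ℝ} (hk : Integrable k (gaussianReal 0 1))
    (hC : ∀ x, |k x| ≤ C) (h0 : ∫ x, k x ∂(gaussianReal 0 1) = 0) (x : ℝ) :
    |x * normalStein k x| ≤ C := by
  have hC0 : 0 ≤ C := (abs_nonneg _).trans (hC 0)
  have hp := gaussianPDFReal_pos 0 1 x one_ne_zero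
  have hki := integrable_gaussianReal_iff.1 hk
  have hbound (s : Set ℝ) :
      |∫ t in s, k t * gaussianPDFReal 0 1 t| ≤ C * ∫ t in s, gaussianPDFReal 0 1 t := by
    rw [← integral_const_mul, ← Real.norm_eq_abs]
    refine norm_integral_le_of_norm_le ((integrable_gaussianPDFReal 0 1).const_mul C).integrableOn
      (Eventually.of_forall fun t => ?_)
    rw [Real.norm_eq_abs, abs_mul, abs_of_nonneg (gaussianPDFReal_nonneg 0 1 t)]
    exact mul_le_mul_of_nonneg_right (hC t) (gaussianPDFReal_nonneg 0 1 t)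
  rw [normalStein, ← mul_div_assoc, abs_div, abs_of_pos hp, div_le_iff₀ hp, abs_mul]
  rcases le_total 0 x with hx | hx
  · -- `k` is centred, so the integral over the left tail is minus the one over the right tail
    have htail := intervalIntegral.integral_Iic_add_Ioi (b := x) hki.integrableOn hki.integrableOn
    rw [← integral_gaussianReal_eq, h0] at htail
    rw [eq_neg_of_add_eq_zero_left htail, abs_neg, abs_of_nonneg hx]
    calc x * |∫ t in Set.Ioi x, k t * gaussianPDFReal 0 1 t|
        ≤ x * (C * ∫ t in Set.Ioi x, gaussianPDFReal 0 1 t) := by gcongr; exact hbound _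
      _ = C * (x * ∫ t in Set.Ioi x, gaussianPDFReal 0 1 t) := by ring
      _ ≤ C * gaussianPDFReal 0 1 x := by gcongr; exact mul_integral_Ioi_gaussianPDFReal_le x
  · rw [abs_of_nonpos hx]
    have hx' : 0 ≤ -x := neg_nonneg.2 hx
    calc -x * |∫ t in Set.Iic x, k t * gaussianPDFReal 0 1 t|
        ≤ -x * (C * ∫ t in Set.Iic x, gaussianPDFReal 0 1 t) := by gcongr; exact hbound _
      _ = C * (-x * ∫ t in Set.Iic x, gaussianPDFReal 0 1 t) := by ring
      _ ≤ C * gaussianPDFReal 0 1 x := by gcongr; exact neg_mul_integral_Iic_gaussianPDFReal_le x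

theorem exists_normal_stein_of_mem_Icc {h : ℝ → ℝ} (hc : Continuous h)
    (hh : ∀ x, h x ∈ Set.Icc 0 1) :
    ∃ f : ℝ → ℝ, ContDiff ℝ 1 f ∧ (∀ x, |deriv f x| ≤ 2) ∧
      ∀ x, deriv f x - x * f x = h x - ∫ y, h y ∂(gaussianReal 0 1) := by
  set m := ∫ y, h y ∂(gaussianReal 0 1) with hm
  have hint : Integrable h (gaussianReal 0 1) :=
    Integrable.of_mem_Icc 0 1 hc.aemeasurable (Eventually.of_forall hh)
  have hm_mem : m ∈ Set.Icc 0 1 :=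
    ⟨integral_nonneg fun x => (hh x).1,
      (integral_mono hint (integrable_const 1) fun x => (hh x).2).trans (by simp)⟩
  have hk_le (x : ℝ) : |h x - m| ≤ 1 := by
    rw [abs_le]
    constructor <;> linarith [(hh x).1, (hh x).2, hm_mem.1, hm_mem.2]
  have hki : Integrable (fun x => h x - m) (gaussianReal 0 1) := hint.sub (integrable_const m)
  have hk0 : ∫ x, (h x - m) ∂(gaussianReal 0 1) = 0 := by
    rw [integral_sub hint (integrable_const m)]
    simp [hm]
  set f := normalStein fun x => h x - m
  have hf : ∀ x, HasDerivAt f (x * f x + (h x - m)) x :=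
    hasDerivAt_normalStein (hc.sub continuous_const) hki
  have hfc : Continuous f := continuous_iff_continuousAt.2 fun x => (hf x).continuousAt
  refine ⟨f, contDiff_one_of_hasDerivAt hf (by fun_prop), fun x => ?_, fun x => ?_⟩
  · rw [(hf x).deriv]
    linarith [abs_add_le (x * f x) (h x - m), abs_mul_normalStein_le hki hk_le hk0 x, hk_le x]
  · rw [(hf x).deriv]
    ring

/-! ### Approximation of the test functions -/

lemma abs_measureReal_sub_le_of_isClosed {α : Type*} [PseudoEMetricSpace α] [MeasurableSpace α]
    [OpensMeasurableSpace α] {μ ν : Measure α} [IsFiniteMeasure μ] [IsFiniteMeasure ν]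
    {C : ℝ} (hC : ∀ h : α → ℝ, Continuous h → (∀ x, h x ∈ Set.Icc 0 1) →
      |(∫ x, h x ∂μ) - ∫ x, h x ∂ν| ≤ C) {K : Set α} (hK : IsClosed K) :
    |μ.real K - ν.real K| ≤ C := by
  obtain ⟨δ, -, hδ, hlim⟩ := exists_seq_strictAnti_tendsto (0 : ℝ)
  refine le_of_tendsto ((tendsto_integral_thickenedIndicator_of_isClosed μ hK hδ hlim).sub
    (tendsto_integral_thickenedIndicator_of_isClosed ν hK hδ hlim)).abs
    (Eventually.of_forall fun n => hC _ (by fun_prop) fun x => ⟨NNReal.coe_nonneg _, ?_⟩)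
  exact_mod_cast thickenedIndicator_le_one (hδ n) K x

theorem dTV_le_of_continuous {μ ν : Measure ℝ} [IsFiniteMeasure μ] [IsFiniteMeasure ν]
    {C : ℝ} (hC : ∀ h : ℝ → ℝ, Continuous h → (∀ x, h x ∈ Set.Icc 0 1) →
      |(∫ x, h x ∂μ) - ∫ x, h x ∂ν| ≤ C) :
    dTV μ ν ≤ ENNReal.ofReal C := by
  refine iSup₂_le fun A hA => ENNReal.ofReal_le_ofReal (le_of_forall_pos_le_add fun ε hε => ?_)
  obtain ⟨K, hKA, hK, hlt⟩ := hA.exists_isClosed_sdiff_lt (μ := μ + ν) (ε := ENNReal.ofReal ε)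
    (measure_ne_top _ _) (by simpa using hε)
  have hrest : μ.real (A \ K) + ν.real (A \ K) ≤ ε := by
    rw [← measureReal_add_apply]
    exact ENNReal.toReal_le_of_le_ofReal hε.le hlt.le
  have hμ := measureReal_sdiff_add_inter (μ := μ) (s := A) hK.measurableSet
  have hν := measureReal_sdiff_add_inter (μ := ν) (s := A) hK.measurableSet
  rw [Set.inter_eq_right.mpr hKA] at hμ hν
  have hclosed := abs_le.1 (abs_measureReal_sub_le_of_isClosed hC hK)
  have hμ0 : 0 ≤ μ.real (A \ K) := measureReal_nonneg
  have hν0 : 0 ≤ ν.real (A \ K) := measureReal_nonneg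
  rw [abs_le]
  constructor <;> linarith [hclosed.1, hclosed.2]

lemma lipschitzWith_of_abs_deriv_le {f : ℝ → ℝ} {L : ℝ} (hf : Differentiable ℝ f)
    (hL : ∀ x, |deriv f x| ≤ L) : LipschitzWith L.toNNReal f :=
  lipschitzWith_of_nnnorm_deriv_le hf fun x =>
    NNReal.coe_le_coe.1 ((hL x).trans (Real.le_coe_toNNReal L))

lemma memLp_comp_of_lipschitzWith {α E F : Type*} [MeasurableSpace α] {μ : Measure α}
    [IsFiniteMeasure μ] [NormedAddCommGroup E] [NormedAddCommGroup F] {p : ℝ≥0∞} {K : NNReal}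
    {φ : E → F} (hφ : LipschitzWith K φ) {X : α → E} (hX : MemLp X p μ) :
    MemLp (fun a => φ (X a)) p μ := by
  have hsub : LipschitzWith K fun x => φ x - φ 0 := by
    simpa using hφ.sub (LipschitzWith.const (φ 0))
  refine ((hsub.comp_memLp (sub_self _) hX).add (memLp_const (φ 0))).congr_norm
    (hφ.continuous.comp_aestronglyMeasurable hX.1) (Eventually.of_forall fun a => ?_)
  simp

lemma integrable_gaussianReal_of_lipschitzWith {h : ℝ → ℝ} {K : NNReal} (hh : LipschitzWith K h) :
    Integrable h (gaussianReal 0 1) :=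
  (memLp_comp_of_lipschitzWith hh (memLp_id_gaussianReal' 1 (by simp))).integrable le_rfl

lemma integral_abs_gaussianReal_le_one : ∫ z, |z| ∂(gaussianReal 0 1) ≤ 1 := by
  have hsq : Integrable (fun z : ℝ => z ^ 2) (gaussianReal 0 1) :=
    (memLp_id_gaussianReal' 2 (by simp)).integrable_sq
  have hvar : ∫ z, z ^ 2 ∂(gaussianReal 0 1) = 1 := by
    rw [← variance_of_integral_eq_zero (by fun_prop) (by simp), variance_fun_id_gaussianReal,
      NNReal.coe_one]
  calc ∫ z, |z| ∂(gaussianReal 0 1)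
      ≤ ∫ z, (z ^ 2 + 1) / 2 ∂(gaussianReal 0 1) :=
        integral_mono integrable_id_gaussianReal.abs
          ((hsq.add (integrable_const _)).div_const _) fun z => by
            nlinarith [sq_nonneg (|z| - 1), sq_abs z]
    _ = 1 := by
        rw [integral_div, integral_add hsq (integrable_const _), hvar]
        simp

lemma integral_deriv_gaussianReal {k k' : ℝ → ℝ} (hk : ∀ x, HasDerivAt k (k' x) x)
    (hki : Integrable k (gaussianReal 0 1)) (hk'i : Integrable k' (gaussianReal 0 1))
    (hzk : Integrable (fun z => z * k z) (gaussianReal 0 1)) :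
    ∫ z, k' z ∂(gaussianReal 0 1) = ∫ z, z * k z ∂(gaussianReal 0 1) := by
  rw [integrable_gaussianReal_iff] at hki hk'i hzk
  have hparts := integral_mul_deriv_eq_deriv_mul_of_integrable (fun x _ => hk x)
    (fun x _ => hasDerivAt_gaussianPDFReal x)
    (hzk.neg.congr (Eventually.of_forall fun z => by simp; ring)) hk'i hki
  rw [integral_gaussianReal_eq, integral_gaussianReal_eq, ← neg_eq_iff_eq_neg.2 hparts,
    ← integral_neg]
  exact integral_congr_ae (Eventually.of_forall fun z => by simp only; ring)

/-- The law of the pair `(Z, θ)` used in Mehler's formula: a standard normal variable and an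
independent angle with Lebesgue measure on `(0, π/2]`. -/
def mehlerMeasure : Measure (ℝ × ℝ) :=
  (gaussianReal 0 1).prod (volume.restrict (Set.Ioc 0 (Real.pi / 2)))

/-- The rotated pair in Mehler's formula. It has `x` at `θ = π/2` and `Z` at `θ = 0`. -/
def mehlerPoint (x : ℝ) (p : ℝ × ℝ) : ℝ := x * Real.sin p.2 + p.1 * Real.cos p.2

/-- The Ornstein–Uhlenbeck form of the solution of Stein's equation `f' - x f = h - ∫ h dγ`, in
terms of `g = h'`. In Mehler's formula `e⁻ˢ x + (1 - e⁻²ˢ)^(1/2) Z` the time `s` is replaced by the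
angle with `sin θ = e⁻ˢ`. -/
def mehlerStein (g : ℝ → ℝ) (x : ℝ) : ℝ :=
  -∫ p, Real.cos p.2 * g (mehlerPoint x p) ∂mehlerMeasure

instance : IsFiniteMeasure mehlerMeasure := by unfold mehlerMeasure; infer_instance

lemma continuous_mehlerPoint (x : ℝ) : Continuous (mehlerPoint x) := by
  unfold mehlerPoint
  fun_prop

lemma integrable_mul_mehlerPoint {g w : _ → ℝ} {L : ℝ} (hg : Continuous g) (hL : ∀ x, |g x| ≤ L)
    (hw : Integrable w mehlerMeasure) (x : ℝ) :
    Integrable (fun p => w p * g (mehlerPoint x p)) mehlerMeasure :=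
  hw.mul_bdd (hg.comp (continuous_mehlerPoint x)).aestronglyMeasurable
    (Eventually.of_forall fun _ => hL _)

lemma integrable_cos_mehler : Integrable (fun p => Real.cos p.2) mehlerMeasure :=
  Integrable.of_bound (by fun_prop) 1 (Eventually.of_forall fun p => Real.abs_cos_le_one p.2)

lemma integrable_sin_mul_mehler : Integrable (fun p => Real.sin p.2 * p.1) mehlerMeasure := by
  simpa only [mehlerMeasure, mul_comm] using integrable_id_gaussianReal.mul_prod
    (Real.continuous_sin.intervalIntegrable 0 (Real.pi / 2)).1

lemma integrable_cos_mul_sin_mehler :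
    Integrable (fun p => Real.cos p.2 * Real.sin p.2) mehlerMeasure :=
  integrable_cos_mehler.mul_bdd (by fun_prop)
    (Eventually.of_forall fun p => Real.abs_sin_le_one p.2)

section MehlerStein

variable {g : ℝ → ℝ} {L B : ℝ}

lemma integral_sin_mul_deriv_mehlerPoint (hg : ContDiff ℝ 1 g) (hL : ∀ x, |g x| ≤ L)
    (hB : ∀ x, |deriv g x| ≤ B) (x : ℝ) :
    ∫ p, Real.cos p.2 * Real.sin p.2 * deriv g (mehlerPoint x p) ∂mehlerMeasure
      = ∫ p, Real.sin p.2 * p.1 * g (mehlerPoint x p) ∂mehlerMeasure := by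
  have hg' := hg.continuous_deriv le_rfl
  have hgc := hg.continuous
  rw [mehlerMeasure,
    integral_prod_symm _ (integrable_mul_mehlerPoint hg' hB integrable_cos_mul_sin_mehler x),
    integral_prod_symm _ (integrable_mul_mehlerPoint hgc hL integrable_sin_mul_mehler x)]
  refine integral_congr_ae (Eventually.of_forall fun θ => ?_)
  have hpoint (z : ℝ) : HasDerivAt (fun z => mehlerPoint x (z, θ)) (Real.cos θ) z :=
    (((hasDerivAt_id z).mul_const (Real.cos θ)).const_add (x * Real.sin θ)).congr_deriv (by simp)
  have hki : Integrable (fun z => g (mehlerPoint x (z, θ))) (gaussianReal 0 1) :=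
    Integrable.of_bound (by unfold mehlerPoint; fun_prop) L (Eventually.of_forall fun _ => hL _)
  have hk'i : Integrable (fun z => deriv g (mehlerPoint x (z, θ)) * Real.cos θ)
      (gaussianReal 0 1) :=
    (Integrable.of_bound (by unfold mehlerPoint; fun_prop) B
      (Eventually.of_forall fun _ => hB _)).mul_const _
  have hzk : Integrable (fun z => z * g (mehlerPoint x (z, θ))) (gaussianReal 0 1) :=
    integrable_id_gaussianReal.mul_bdd (by unfold mehlerPoint; fun_prop)
      (Eventually.of_forall fun _ => hL _)
  have hparts := integral_deriv_gaussianReal (k := fun z => g (mehlerPoint x (z, θ)))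
    (fun z => ((hg.differentiable one_ne_zero _).hasDerivAt.comp z (hpoint z))) hki hk'i hzk
  simp only [mul_assoc]
  rw [integral_const_mul (Real.sin θ), ← hparts, ← integral_const_mul]
  exact integral_congr_ae (Eventually.of_forall fun z => by simp only; ring)

lemma hasDerivAt_mehlerStein (hg : ContDiff ℝ 1 g) (hL : ∀ x, |g x| ≤ L)
    (hB : ∀ x, |deriv g x| ≤ B) (x : ℝ) :
    HasDerivAt (mehlerStein g)
      (-∫ p, Real.sin p.2 * p.1 * g (mehlerPoint x p) ∂mehlerMeasure) x := by
  have hpoint (p : ℝ × ℝ) (y : ℝ) :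
      HasDerivAt (fun y => mehlerPoint y p) (Real.sin p.2) y :=
    (((hasDerivAt_id y).mul_const (Real.sin p.2)).add_const (p.1 * Real.cos p.2)).congr_deriv
      (by simp)
  have hint := integrable_mul_mehlerPoint hg.continuous hL integrable_cos_mehler
  have hint' := integrable_mul_mehlerPoint (hg.continuous_deriv le_rfl) hB
    integrable_cos_mul_sin_mehler x
  have hbound (p : ℝ × ℝ) (y : ℝ) :
      ‖Real.cos p.2 * Real.sin p.2 * deriv g (mehlerPoint y p)‖ ≤ B := by
    rw [norm_mul, norm_mul]
    refine (mul_le_of_le_one_left (norm_nonneg _) ?_).trans (hB _)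
    exact mul_le_one₀ (Real.abs_cos_le_one _) (norm_nonneg _) (Real.abs_sin_le_one _)
  rw [← integral_sin_mul_deriv_mehlerPoint hg hL hB x]
  exact (hasDerivAt_integral_of_dominated_loc_of_deriv_le univ_mem
    (Eventually.of_forall fun y => (hint y).1) (hint x) hint'.1
    (Eventually.of_forall fun p y _ => hbound p y) (integrable_const B)
    (Eventually.of_forall fun p y _ =>
      (((hg.differentiable one_ne_zero _).hasDerivAt.comp y (hpoint p y)).const_mul
        (Real.cos p.2)).congr_deriv (by ring))).2.fun_neg

lemma abs_integral_sin_mul_mehlerPoint_le (hL : ∀ x, |g x| ≤ L) (x : ℝ) :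
    |∫ p, Real.sin p.2 * p.1 * g (mehlerPoint x p) ∂mehlerMeasure| ≤ L := by
  have hL0 : 0 ≤ L := (abs_nonneg _).trans (hL 0)
  have hsin : ∀ᵐ p ∂mehlerMeasure, 0 ≤ Real.sin p.2 := by
    refine Measure.quasiMeasurePreserving_snd.ae (p := fun θ => 0 ≤ Real.sin θ) ?_
    filter_upwards [ae_restrict_mem measurableSet_Ioc] with θ hθ
    exact Real.sin_nonneg_of_nonneg_of_le_pi hθ.1.le (by linarith [hθ.2, Real.pi_pos])
  have hdom : Integrable (fun p : ℝ × ℝ => |p.1| * Real.sin p.2) mehlerMeasure :=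
    integrable_id_gaussianReal.abs.mul_prod
      (Real.continuous_sin.intervalIntegrable 0 (Real.pi / 2)).1
  have hangle : ∫ θ in Set.Ioc 0 (Real.pi / 2), Real.sin θ = 1 := by
    rw [← intervalIntegral.integral_of_le (by positivity), integral_sin]
    simp
  calc |∫ p, Real.sin p.2 * p.1 * g (mehlerPoint x p) ∂mehlerMeasure|
      ≤ ∫ p, |p.1| * Real.sin p.2 * L ∂mehlerMeasure := by
        rw [← Real.norm_eq_abs]
        refine norm_integral_le_of_norm_le (hdom.mul_const L) ?_
        filter_upwards [hsin] with p hp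
        rw [Real.norm_eq_abs, abs_mul, abs_mul, abs_of_nonneg hp, mul_comm (Real.sin p.2)]
        exact mul_le_mul_of_nonneg_left (hL _) (by positivity)
    _ = (∫ z, |z| ∂(gaussianReal 0 1)) * L := by
        rw [integral_mul_const, mehlerMeasure, integral_prod_mul (fun z : ℝ => |z|) Real.sin,
          hangle, mul_one]
    _ ≤ L := mul_le_of_le_one_left hL0 integral_abs_gaussianReal_le_one

lemma integral_deriv_mehlerPoint {h : ℝ → ℝ} (hh : ContDiff ℝ 1 h) (x z : ℝ) :
    ∫ θ in Set.Ioc 0 (Real.pi / 2),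
      (x * Real.cos θ - Real.sin θ * z) * deriv h (mehlerPoint x (z, θ)) = h x - h z := by
  have hpoint (θ : ℝ) : HasDerivAt (fun θ => mehlerPoint x (z, θ))
      (x * Real.cos θ + z * -Real.sin θ) θ :=
    ((Real.hasDerivAt_sin θ).const_mul x).add ((Real.hasDerivAt_cos θ).const_mul z)
  have := hh.continuous_deriv le_rfl
  rw [← intervalIntegral.integral_of_le (by positivity),
    intervalIntegral.integral_eq_sub_of_hasDerivAt (f := fun θ => h (mehlerPoint x (z, θ)))
      (fun θ _ => ((hh.differentiable one_ne_zero _).hasDerivAt.comp θ (hpoint θ)).congr_deriv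
        (by ring)) (by
          unfold mehlerPoint
          exact Continuous.intervalIntegrable (by fun_prop) _ _)]
  simp [mehlerPoint]

lemma mehlerStein_deriv_eq {h : ℝ → ℝ} (hh : ContDiff ℝ 1 h) (hL : ∀ x, |deriv h x| ≤ L)
    (x : ℝ) :
    -(∫ p, Real.sin p.2 * p.1 * deriv h (mehlerPoint x p) ∂mehlerMeasure)
        - x * mehlerStein (deriv h) x
      = h x - ∫ z, h z ∂(gaussianReal 0 1) := by
  have hh' := hh.continuous_deriv le_rfl
  have hcos := integrable_mul_mehlerPoint hh' hL integrable_cos_mehler x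
  have hsin := integrable_mul_mehlerPoint hh' hL integrable_sin_mul_mehler x
  have hboth : Integrable (fun p => (x * Real.cos p.2 - Real.sin p.2 * p.1)
      * deriv h (mehlerPoint x p)) mehlerMeasure :=
    ((hcos.const_mul x).sub hsin).congr (Eventually.of_forall fun p => by
      simp only [Pi.sub_apply]; ring)
  calc _ = ∫ p, (x * Real.cos p.2 - Real.sin p.2 * p.1)
          * deriv h (mehlerPoint x p) ∂mehlerMeasure := by
        rw [mehlerStein, mul_neg, sub_neg_eq_add, neg_add_eq_sub, ← integral_const_mul,
          ← integral_sub (hcos.const_mul x) hsin]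
        exact integral_congr_ae (Eventually.of_forall fun p => by simp only; ring)
    _ = ∫ z, (h x - h z) ∂(gaussianReal 0 1) := by
        rw [mehlerMeasure, integral_prod _ hboth]
        simp only [integral_deriv_mehlerPoint hh]
    _ = h x - ∫ z, h z ∂(gaussianReal 0 1) := by
        rw [integral_sub (integrable_const _) (integrable_gaussianReal_of_lipschitzWith
          (lipschitzWith_of_abs_deriv_le (hh.differentiable one_ne_zero) hL))]
        simp

theorem exists_normal_stein_of_abs_deriv_le {h : ℝ → ℝ} (hh : ContDiff ℝ 2 h)
    (hL : ∀ x, |deriv h x| ≤ L) (hB : ∀ x, |deriv (deriv h) x| ≤ B) :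
    ∃ f : ℝ → ℝ, ContDiff ℝ 1 f ∧ (∀ x, |deriv f x| ≤ L) ∧
      ∀ x, deriv f x - x * f x = h x - ∫ y, h y ∂(gaussianReal 0 1) := by
  have hh1 : ContDiff ℝ 1 h := hh.of_le one_le_two
  have hh' : ContDiff ℝ 1 (deriv h) := (contDiff_succ_iff_deriv.1 hh).2.2
  have hf := hasDerivAt_mehlerStein hh' hL hB
  have hfc : Continuous (mehlerStein (deriv h)) :=
    continuous_iff_continuousAt.2 fun x => (hf x).continuousAt
  have hstein := mehlerStein_deriv_eq hh1 hL
  refine ⟨mehlerStein (deriv h), contDiff_one_of_hasDerivAt hf ?_, fun x => ?_, fun x => ?_⟩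
  · have hhc := hh.continuous
    simp only [fun x => eq_add_of_sub_eq (hstein x)]
    fun_prop
  · rw [(hf x).deriv, abs_neg]
    exact abs_integral_sin_mul_mehlerPoint_le hL x
  · rw [(hf x).deriv, hstein x]

end MehlerStein

/-- The moving average of `k` over `[x, x + ε]`, which smooths Lipschitz test functions. -/
def forwardMean (ε : ℝ) (k : ℝ → ℝ) (x : ℝ) : ℝ := (∫ t in x..x + ε, k t) / ε

section ForwardMean

variable {k : ℝ → ℝ} {K : NNReal} {ε : ℝ}

lemma hasDerivAt_forwardMean (hk : Continuous k) (x : ℝ) :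
    HasDerivAt (forwardMean ε k) ((k (x + ε) - k x) / ε) x := by
  have hsplit : (fun x => ∫ t in x..x + ε, k t)
      = fun x => (∫ t in (0 : ℝ)..x + ε, k t) - ∫ t in (0 : ℝ)..x, k t := by
    funext y
    rw [intervalIntegral.integral_interval_sub_left] <;> exact hk.intervalIntegrable _ _
  have hprimitive (y : ℝ) : HasDerivAt (fun y => ∫ t in (0 : ℝ)..y, k t) (k y) y :=
    intervalIntegral.integral_hasDerivAt_right (hk.intervalIntegrable _ _)
      (hk.stronglyMeasurableAtFilter _ _) hk.continuousAt
  have hdiff := ((hprimitive (x + ε)).comp_add_const x ε).fun_sub (hprimitive x)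
  rw [← hsplit] at hdiff
  exact hdiff.div_const ε

lemma deriv_forwardMean (hk : Continuous k) :
    deriv (forwardMean ε k) = fun x => (k (x + ε) - k x) / ε :=
  funext fun x => (hasDerivAt_forwardMean hk x).deriv

lemma abs_deriv_forwardMean_le (hk : LipschitzWith K k) (hε : 0 < ε) (x : ℝ) :
    |deriv (forwardMean ε k) x| ≤ K := by
  have hlip := hk.dist_le_mul (x + ε) x
  rw [Real.dist_eq, Real.dist_eq, add_sub_cancel_left, abs_of_pos hε] at hlip
  rwa [deriv_forwardMean hk.continuous, abs_div, abs_of_pos hε, div_le_iff₀ hε]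

lemma lipschitzWith_forwardMean (hk : LipschitzWith K k) (hε : 0 < ε) :
    LipschitzWith K (forwardMean ε k) := by
  simpa using lipschitzWith_of_abs_deriv_le
    (fun x => (hasDerivAt_forwardMean hk.continuous x).differentiableAt)
    (abs_deriv_forwardMean_le hk hε)

lemma abs_forwardMean_sub_le (hk : LipschitzWith K k) (hε : 0 < ε) (x : ℝ) :
    |forwardMean ε k x - k x| ≤ K * ε := by
  have hmean : forwardMean ε k x - k x = (∫ t in x..x + ε, (k t - k x)) / ε := by
    rw [forwardMean, intervalIntegral.integral_sub (hk.continuous.intervalIntegrable _ _) (by simp)]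
    simp
    field_simp
  have hclose : ∀ t ∈ Set.uIoc x (x + ε), ‖k t - k x‖ ≤ K * ε := fun t ht => by
    rw [Set.uIoc_of_le (by linarith)] at ht
    refine (hk.dist_le_mul t x).trans (mul_le_mul_of_nonneg_left ?_ K.2)
    rw [Real.dist_eq, abs_of_pos (by linarith [ht.1])]
    linarith [ht.2]
  have hint := intervalIntegral.norm_integral_le_of_norm_le_const hclose
  rw [add_sub_cancel_left, abs_of_pos hε, Real.norm_eq_abs] at hint
  rwa [hmean, abs_div, abs_of_pos hε, div_le_iff₀ hε]

end ForwardMean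

theorem exists_contDiff_two_approx {h : ℝ → ℝ} {K : NNReal} (hh : LipschitzWith K h) {ε : ℝ}
    (hε : 0 < ε) :
    ∃ g : ℝ → ℝ, ∃ B : ℝ, ContDiff ℝ 2 g ∧ (∀ x, |deriv g x| ≤ K) ∧
      (∀ x, |deriv (deriv g) x| ≤ B) ∧ ∀ x, |g x - h x| ≤ 2 * K * ε := by
  set k := forwardMean ε h
  have hk : LipschitzWith K k := lipschitzWith_forwardMean hh hε
  have hkd (x : ℝ) := hasDerivAt_forwardMean (ε := ε) hh.continuous x
  have hhc := hh.continuous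
  have hkC : ContDiff ℝ 1 k := contDiff_one_of_hasDerivAt hkd (by fun_prop)
  have hg' : deriv (forwardMean ε k) = fun x => (k (x + ε) - k x) / ε :=
    deriv_forwardMean hk.continuous
  have hg'' (x : ℝ) : HasDerivAt (fun x => (k (x + ε) - k x) / ε)
      ((deriv k (x + ε) - deriv k x) / ε) x := by
    have hkd' (y : ℝ) := (hkC.differentiable one_ne_zero y).hasDerivAt
    exact (((hkd' (x + ε)).comp_add_const x ε).fun_sub (hkd' x)).div_const ε
  refine ⟨forwardMean ε k, 2 * K / ε, ?_, abs_deriv_forwardMean_le hk hε, fun x => ?_, fun x => ?_⟩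
  · rw [show (2 : WithTop ℕ∞) = 1 + 1 by norm_num, contDiff_succ_iff_deriv]
    refine ⟨fun x => (hasDerivAt_forwardMean hk.continuous x).differentiableAt, by simp, ?_⟩
    rw [hg']
    fun_prop
  · rw [hg', (hg'' x).deriv, abs_div, abs_of_pos hε]
    gcongr
    linarith [abs_sub (deriv k (x + ε)) (deriv k x), abs_deriv_forwardMean_le hh hε (x + ε),
      abs_deriv_forwardMean_le hh hε x]
  · linarith [abs_sub_le (forwardMean ε k x) (k x) (h x), abs_forwardMean_sub_le hk hε x,
      abs_forwardMean_sub_le hh hε x]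

lemma abs_integral_le_of_abs_le {α : Type*} [MeasurableSpace α] {μ : Measure α}
    [IsProbabilityMeasure μ] {f : α → ℝ} {C : ℝ} (hC : ∀ x, |f x| ≤ C) : |∫ x, f x ∂μ| ≤ C := by
  simpa using norm_integral_le_of_norm_le_const (μ := μ) (f := f) (Eventually.of_forall hC)

lemma dW_le_of_contDiff_two {μ ν : Measure ℝ} [IsProbabilityMeasure μ] [IsProbabilityMeasure ν]
    (hμ : MemLp id 1 μ) (hν : MemLp id 1 ν) {C : ℝ≥0∞}
    (hC : ∀ (g : ℝ → ℝ) (B : ℝ), ContDiff ℝ 2 g → (∀ x, |deriv g x| ≤ 1) →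
      (∀ x, |deriv (deriv g) x| ≤ B) → ENNReal.ofReal |(∫ x, g x ∂μ) - ∫ x, g x ∂ν| ≤ C) :
    dW μ ν ≤ C := by
  refine iSup₂_le fun h hh => ENNReal.le_of_forall_pos_le_add fun ε hε _ => ?_
  obtain ⟨g, B, hg, hg', hg'', hgh⟩ :=
    exists_contDiff_two_approx hh (show (0 : ℝ) < ε / 4 by positivity)
  rw [NNReal.coe_one] at hg' hgh
  have hgLip := lipschitzWith_of_abs_deriv_le (hg.differentiable two_ne_zero) hg'
  have hclose : ∀ ρ : Measure ℝ, IsProbabilityMeasure ρ → MemLp id 1 ρ →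
      |(∫ x, g x ∂ρ) - ∫ x, h x ∂ρ| ≤ 2 * 1 * (ε / 4) := fun ρ _ hρ => by
    have hg_int : Integrable g ρ := (memLp_comp_of_lipschitzWith hgLip hρ).integrable le_rfl
    have hh_int : Integrable h ρ := (memLp_comp_of_lipschitzWith hh hρ).integrable le_rfl
    rw [← integral_sub hg_int hh_int]
    exact abs_integral_le_of_abs_le hgh
  have htriangle : |(∫ x, h x ∂μ) - ∫ x, h x ∂ν| ≤ |(∫ x, g x ∂μ) - ∫ x, g x ∂ν| + ε := by
    rw [← sub_le_iff_le_add, abs_sub_comm (∫ x, g x ∂μ), abs_sub_comm (∫ x, h x ∂μ)]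
    have hμ_close := hclose μ inferInstance hμ
    have hν_close := hclose ν inferInstance hν
    grind
  calc ENNReal.ofReal |(∫ x, h x ∂μ) - ∫ x, h x ∂ν|
      ≤ ENNReal.ofReal (|(∫ x, g x ∂μ) - ∫ x, g x ∂ν| + ε) := ENNReal.ofReal_le_ofReal htriangle
    _ = ENNReal.ofReal |(∫ x, g x ∂μ) - ∫ x, g x ∂ν| + ε := by
        rw [ENNReal.ofReal_add (abs_nonneg _) ε.coe_nonneg, ENNReal.ofReal_coe_nnreal]
    _ ≤ C + ε := by
        gcongr
        exact hC g B hg hg' hg''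

/-! ### Stein's equation for the gamma law -/

/-- The unnormalised density of the gamma law with shape `r` and rate `1`. -/
def gammaWeight (r x : ℝ) : ℝ := Real.exp (-x) * x ^ (r - 1)

/-- The solution `f` of Stein's equation `x f' + (r - x) f = k` for the gamma law with shape `r`
and rate `1` that is regular at `0`. It is meant for `k` with mean `0`. -/
def gammaStein (r : ℝ) (k : ℝ → ℝ) (x : ℝ) : ℝ :=
  (∫ t in (0 : ℝ)..x, k t * gammaWeight r t) / (Real.exp (-x) * x ^ r)

section GammaWeight

variable {r x : ℝ}

lemma gammaWeight_pos (hx : 0 < x) : 0 < gammaWeight r x := by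
  unfold gammaWeight
  positivity

lemma exp_neg_mul_rpow_eq (hx : 0 < x) : Real.exp (-x) * x ^ r = x * gammaWeight r x := by
  rw [gammaWeight, Real.rpow_sub_one hx.ne']
  field_simp

lemma continuousAt_gammaWeight (hx : 0 < x) : ContinuousAt (gammaWeight r) x :=
  ContinuousAt.mul (by fun_prop) (Real.continuousAt_rpow_const x (r - 1) (Or.inl hx.ne'))

lemma integral_gammaMeasure_one (hr : 0 < r) (h : ℝ → ℝ) :
    ∫ x, h x ∂(gammaMeasure r 1) =
      (Real.Gamma r)⁻¹ * ∫ x in Set.Ioi 0, h x * gammaWeight r x := by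
  have := Real.Gamma_pos_of_pos hr
  have hmeas : Measurable (gammaPDF r 1) := (measurable_gammaPDFReal r 1).ennreal_ofReal
  rw [gammaMeasure, integral_withDensity_eq_integral_toReal_smul hmeas
      (Eventually.of_forall fun x => ENNReal.ofReal_lt_top),
    ← integral_const_mul, ← integral_indicator measurableSet_Ioi]
  refine integral_congr_ae ?_
  filter_upwards [Measure.ae_ne volume 0] with x hx0
  rcases lt_or_gt_of_ne hx0 with hx | hx
  · rw [Set.indicator_of_notMem (by simp [hx.le]), gammaPDF_of_neg hx]
    simp
  · rw [Set.indicator_of_mem (by simpa using hx), gammaPDF_of_nonneg hx.le,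
      ENNReal.toReal_ofReal (by positivity)]
    simp only [gammaWeight, Real.one_rpow, one_mul, smul_eq_mul]
    ring

lemma hasDerivAt_exp_neg_mul_rpow (hx : 0 < x) :
    HasDerivAt (fun x => Real.exp (-x) * x ^ r) ((r - x) * gammaWeight r x) x := by
  refine ((hasDerivAt_neg x).exp.fun_mul
    (Real.hasDerivAt_rpow_const (p := r) (Or.inl hx.ne'))).congr_deriv ?_
  have hweight := exp_neg_mul_rpow_eq (r := r) hx
  rw [gammaWeight] at hweight ⊢
  linear_combination -hweight

lemma tendsto_exp_neg_mul_rpow_zero (hr : 0 < r) :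
    Tendsto (fun x => Real.exp (-x) * x ^ r) (𝓝[>] 0) (𝓝 0) := by
  have hcont : ContinuousAt (fun x : ℝ => Real.exp (-x) * x ^ r) 0 :=
    ContinuousAt.mul (by fun_prop) (Real.continuousAt_rpow_const 0 r (Or.inr hr.le))
  simpa [Real.zero_rpow hr.ne'] using hcont.tendsto.mono_left (nhdsWithin_le_nhds (s := Set.Ioi 0))

lemma tendsto_exp_neg_mul_rpow_atTop :
    Tendsto (fun x => Real.exp (-x) * x ^ r) atTop (𝓝 0) :=
  (tendsto_rpow_mul_exp_neg_mul_atTop_nhds_zero r 1 one_pos).congr fun x => by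
    rw [neg_mul, one_mul, mul_comm]

end GammaWeight

lemma tendsto_intervalIntegral_nhdsGT_zero {u : ℝ → ℝ} (hu : IntegrableOn u (Set.Ioi 0)) :
    Tendsto (fun x => ∫ t in (0 : ℝ)..x, u t) (𝓝[>] 0) (𝓝 0) := by
  have hcont : ContinuousOn (fun x => ∫ t in (0 : ℝ)..x, u t) (Set.Icc 0 1) := by
    simpa using intervalIntegral.continuousOn_primitive_interval (a := 0) (b := 1)
      (by simpa [integrableOn_Icc_iff_integrableOn_Ioc] using hu.mono_set Set.Ioc_subset_Ioi_self)
  have hzero := (hcont 0 (by simp)).tendsto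
  rw [intervalIntegral.integral_same] at hzero
  rw [← nhdsWithin_Ioc_eq_nhdsGT zero_lt_one]
  exact hzero.mono_left (nhdsWithin_mono _ Set.Ioc_subset_Icc_self)

section GammaStein

variable {r C : ℝ} {k : ℝ → ℝ}

lemma integrableOn_mul_gammaWeight (hr : 0 < r) (hk : Continuous k) (hC : ∀ x, |k x| ≤ C) :
    IntegrableOn (fun x => k x * gammaWeight r x) (Set.Ioi 0) :=
  Integrable.bdd_mul (Real.GammaIntegral_convergent hr) hk.aestronglyMeasurable
    (Eventually.of_forall hC)

lemma hasDerivAt_integral_mul_gammaWeight (hr : 0 < r) (hk : Continuous k)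
    (hC : ∀ x, |k x| ≤ C) {x : ℝ} (hx : 0 < x) :
    HasDerivAt (fun x => ∫ t in (0 : ℝ)..x, k t * gammaWeight r t) (k x * gammaWeight r x) x := by
  have hcont : ∀ x ∈ Set.Ioi 0, ContinuousAt (fun t => k t * gammaWeight r t) x := fun x hx =>
    hk.continuousAt.mul (continuousAt_gammaWeight hx)
  refine intervalIntegral.integral_hasDerivAt_right ?_
    (ContinuousAt.stronglyMeasurableAtFilter isOpen_Ioi hcont x hx) (hcont x hx)
  rw [intervalIntegrable_iff_integrableOn_Ioc_of_le hx.le]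
  exact (integrableOn_mul_gammaWeight hr hk hC).mono_set Set.Ioc_subset_Ioi_self

lemma hasDerivAt_gammaStein (hr : 0 < r) (hk : Continuous k) (hC : ∀ x, |k x| ≤ C) {x : ℝ}
    (hx : 0 < x) :
    HasDerivAt (gammaStein r k) ((k x - (r - x) * gammaStein r k x) / x) x := by
  have hw : gammaWeight r x ≠ 0 := (gammaWeight_pos hx).ne'
  refine ((hasDerivAt_integral_mul_gammaWeight hr hk hC hx).fun_div
    (hasDerivAt_exp_neg_mul_rpow hx) (by positivity)).congr_deriv ?_
  rw [gammaStein, exp_neg_mul_rpow_eq hx]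
  field_simp

lemma tendsto_gammaStein_nhdsGT_zero (hr : 0 < r) (hk : Continuous k) (hC : ∀ x, |k x| ≤ C) :
    Tendsto (gammaStein r k) (𝓝[>] 0) (𝓝 (k 0 / r)) := by
  have hratio : Tendsto (fun x => k x / (r - x)) (𝓝[>] 0) (𝓝 (k 0 / r)) := by
    have hcont : ContinuousAt (fun x => k x / (r - x)) 0 :=
      hk.continuousAt.div (by fun_prop) (by simpa using hr.ne')
    simpa using hcont.tendsto.mono_left nhdsWithin_le_nhds
  refine HasDerivAt.lhopital_zero_nhdsGT (f' := fun x => k x * gammaWeight r x)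
    (g' := fun x => (r - x) * gammaWeight r x) ?_ ?_ ?_
    (tendsto_intervalIntegral_nhdsGT_zero (integrableOn_mul_gammaWeight hr hk hC))
    (tendsto_exp_neg_mul_rpow_zero hr) (hratio.congr' ?_)
  · filter_upwards [self_mem_nhdsWithin] with x hx
      using hasDerivAt_integral_mul_gammaWeight hr hk hC hx
  · filter_upwards [self_mem_nhdsWithin] with x hx using hasDerivAt_exp_neg_mul_rpow hx
  · filter_upwards [self_mem_nhdsWithin, nhdsWithin_le_nhds (gt_mem_nhds hr)] with x hx hxr
    exact mul_ne_zero (sub_pos.2 hxr).ne' (gammaWeight_pos hx).ne'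
  · filter_upwards [self_mem_nhdsWithin] with x hx
      using (mul_div_mul_right _ _ (gammaWeight_pos hx).ne').symm

lemma tendsto_div_of_abs_le {u : ℝ → ℝ} (hC : ∀ x, |k x| ≤ C) (hu : Tendsto u atTop atTop) :
    Tendsto (fun x => k x / u x) atTop (𝓝 0) := by
  simpa only [div_eq_mul_inv, Function.comp_apply] using
    bdd_le_mul_tendsto_zero' C (Eventually.of_forall hC) (tendsto_inv_atTop_zero.comp hu)

lemma tendsto_gammaStein_atTop (hr : 0 < r) (hk : Continuous k) (hC : ∀ x, |k x| ≤ C)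
    (h0 : ∫ x, k x ∂(gammaMeasure r 1) = 0) : Tendsto (gammaStein r k) atTop (𝓝 0) := by
  have hratio : Tendsto (fun x => -(k x / (x - r))) atTop (𝓝 0) := by
    simpa [sub_eq_add_neg] using
      (tendsto_div_of_abs_le hC (tendsto_atTop_add_const_right _ (-r) tendsto_id)).neg
  have hmass : ∫ x in Set.Ioi 0, k x * gammaWeight r x = 0 := by
    rw [integral_gammaMeasure_one hr] at h0
    exact (mul_eq_zero.1 h0).resolve_left (inv_ne_zero (Real.Gamma_pos_of_pos hr).ne')
  have hnum : Tendsto (fun x => ∫ t in (0 : ℝ)..x, k t * gammaWeight r t) atTop (𝓝 0) := by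
    nth_rw 2 [← hmass]
    exact intervalIntegral_tendsto_integral_Ioi 0 (integrableOn_mul_gammaWeight hr hk hC) tendsto_id
  refine HasDerivAt.lhopital_zero_atTop (f' := fun x => k x * gammaWeight r x)
    (g' := fun x => (r - x) * gammaWeight r x) ?_ ?_ ?_ hnum
    tendsto_exp_neg_mul_rpow_atTop (hratio.congr' ?_)
  · filter_upwards [eventually_gt_atTop 0] with x hx
      using hasDerivAt_integral_mul_gammaWeight hr hk hC hx
  · filter_upwards [eventually_gt_atTop 0] with x hx using hasDerivAt_exp_neg_mul_rpow hx
  · filter_upwards [eventually_gt_atTop 0, eventually_gt_atTop r] with x hx hxr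
    exact mul_ne_zero (sub_neg.2 hxr).ne (gammaWeight_pos hx).ne'
  · filter_upwards [eventually_gt_atTop 0] with x hx
    rw [mul_div_mul_right _ _ (gammaWeight_pos hx).ne', ← neg_sub x r, div_neg]

end GammaStein

section MaximumPrinciple

lemma nonpos_of_isLocalMax_of_hasDerivAt {ψ ψ' : ℝ → ℝ} {d y : ℝ} (hmax : IsLocalMax ψ y)
    (hψ : ∀ᶠ x in 𝓝 y, HasDerivAt ψ (ψ' x) x) (hψ' : HasDerivAt ψ' d y) : d ≤ 0 := by
  by_contra! hpos
  have hderiv : deriv ψ =ᶠ[𝓝 y] ψ' := hψ.mono fun x hx => hx.deriv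
  have hdd : deriv (deriv ψ) y = d := by rw [hderiv.deriv_eq, hψ'.deriv]
  have hmin := isLocalMin_of_deriv_deriv_pos (hdd.symm ▸ hpos) hmax.deriv_eq_zero
    hψ.self_of_nhds.continuousAt
  have hconst : ψ =ᶠ[𝓝 y] fun _ => ψ y := by
    filter_upwards [hmax, hmin] with x hle hge using le_antisymm hle hge
  have hzero : deriv ψ =ᶠ[𝓝 y] fun _ => 0 := hconst.deriv.trans (by simp)
  rw [hzero.deriv_eq, deriv_const] at hdd
  exact hpos.ne hdd

lemma exists_isLocalMax_Ioi {ψ : ℝ → ℝ} {x₀ : ℝ} (hψ : ContinuousOn ψ (Set.Ioi 0)) (hx₀ : 0 < x₀)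
    (hzero : ∀ᶠ x in 𝓝[>] 0, ψ x < ψ x₀) (htop : ∀ᶠ x in atTop, ψ x < ψ x₀) :
    ∃ y, 0 < y ∧ ψ x₀ ≤ ψ y ∧ IsLocalMax ψ y := by
  obtain ⟨a, ha, hlow⟩ := mem_nhdsGT_iff_exists_Ioo_subset.1 hzero
  obtain ⟨b, hhigh⟩ := eventually_atTop.1 htop
  have hax₀ : a ≤ x₀ := not_lt.1 fun h => lt_irrefl (ψ x₀) (hlow ⟨hx₀, h⟩)
  have hx₀b : x₀ ≤ b := not_lt.1 fun h => lt_irrefl _ (hhigh x₀ h.le)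
  have hpos : ∀ x ∈ Set.Icc a b, 0 < x := fun x hx => lt_of_lt_of_le ha hx.1
  obtain ⟨y, hy, hmax⟩ := isCompact_Icc.exists_isMaxOn ⟨x₀, hax₀, hx₀b⟩ (hψ.mono hpos)
  have hyx₀ : ψ x₀ ≤ ψ y := hmax ⟨hax₀, hx₀b⟩
  refine ⟨y, hpos y hy, hyx₀, ?_⟩
  filter_upwards [lt_mem_nhds (hpos y hy)] with x hx
  by_cases hxa : x < a
  · exact (hlow ⟨hx, hxa⟩).le.trans hyx₀
  by_cases hxb : b < x
  · exact (hhigh x hxb.le).le.trans hyx₀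
  exact hmax ⟨not_lt.1 hxa, not_lt.1 hxb⟩

variable {r M ε : ℝ} {χ χ' χ'' : ℝ → ℝ}

-- At a maximum of `χ - ε (x + 1/x)` the generator is at most `-2 χ` up to an error linear in `ε`.
lemma sub_barrier_le_of_isLocalMax {y : ℝ} (hr : 0 < r) (hε : 0 < ε) (hy : 0 < y)
    (hχ : ∀ x, 0 < x → HasDerivAt χ (χ' x) x) (hχ' : HasDerivAt χ' (χ'' y) y)
    (hgen : -M ≤ y * χ'' y + (r + 2 - y) * χ' y - 2 * χ y)
    (hmax : IsLocalMax (fun x => χ x - ε * (x + x⁻¹)) y) :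
    χ y - ε * (y + y⁻¹) ≤ M / 2 + ε * ((r + 2) / 2) := by
  have hψ (x : ℝ) (hx : 0 < x) :
      HasDerivAt (fun x => χ x - ε * (x + x⁻¹)) (χ' x - ε * (1 + -(x ^ 2)⁻¹)) x :=
    (hχ x hx).fun_sub (((hasDerivAt_id x).fun_add (hasDerivAt_inv hx.ne')).const_mul ε)
  have hinv : HasDerivAt (fun x : ℝ => (x ^ 2)⁻¹) (-(2 / y ^ 3)) y :=
    ((hasDerivAt_pow 2 y).fun_inv (by positivity)).congr_deriv (by
      field_simp; norm_num [mul_comm])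
  have hψ' : HasDerivAt (fun x => χ' x - ε * (1 + -(x ^ 2)⁻¹)) (χ'' y - ε * (2 / y ^ 3)) y :=
    (hχ'.fun_sub ((hinv.fun_neg.const_add 1).const_mul ε)).congr_deriv (by ring)
  have hfirst : χ' y = ε * (1 + -(y ^ 2)⁻¹) :=
    sub_eq_zero.1 (hmax.hasDerivAt_eq_zero (hψ y hy))
  have hsecond : y * χ'' y ≤ ε * (2 / y ^ 2) := by
    have hd := nonpos_of_isLocalMax_of_hasDerivAt hmax ((lt_mem_nhds hy).mono hψ) hψ'
    calc y * χ'' y ≤ y * (ε * (2 / y ^ 3)) := by gcongr; linarith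
      _ = ε * (2 / y ^ 2) := by field_simp
  have hbarrier : ε * (2 / y ^ 2) + (r + 2 - y) * (ε * (1 + -(y ^ 2)⁻¹)) - 2 * ε * (y + y⁻¹)
      = ε * (r + 2) - ε * (3 * y + r * (y ^ 2)⁻¹ + y⁻¹) := by
    field_simp
    ring
  have hpos : 0 ≤ ε * (3 * y + r * (y ^ 2)⁻¹ + y⁻¹) := by positivity
  rw [hfirst] at hgen
  linarith

lemma sub_barrier_le (hr : 0 < r) (hM : 0 ≤ M) (hε : 0 < ε)
    (hχ : ∀ x, 0 < x → HasDerivAt χ (χ' x) x) (hχ' : ∀ x, 0 < x → HasDerivAt χ' (χ'' x) x)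
    (hgen : ∀ x, 0 < x → -M ≤ x * χ'' x + (r + 2 - x) * χ' x - 2 * χ x)
    (hzero : Tendsto (fun x => x * χ x) (𝓝[>] 0) (𝓝 0)) (htop : Tendsto χ atTop (𝓝 0))
    {x₀ : ℝ} (hx₀ : 0 < x₀) :
    χ x₀ - ε * (x₀ + x₀⁻¹) ≤ M / 2 + ε * ((r + 2) / 2) := by
  by_contra! hlarge
  have hpos : 0 < χ x₀ - ε * (x₀ + x₀⁻¹) := lt_of_le_of_lt (by positivity) hlarge
  have hcont : ContinuousOn (fun x => χ x - ε * (x + x⁻¹)) (Set.Ioi 0) := fun x hx =>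
    ((hχ x hx).continuousAt.sub (continuousAt_const.mul
      (continuousAt_id.add (continuousAt_inv₀ (ne_of_gt hx))))).continuousWithinAt
  obtain ⟨y, hy, hle, hmax⟩ := exists_isLocalMax_Ioi hcont hx₀
    (by
      filter_upwards [self_mem_nhdsWithin, hzero.eventually (gt_mem_nhds hε)] with x hx hsmall
      refine lt_trans ?_ hpos
      have hχx : χ x < ε * x⁻¹ := by rwa [← div_eq_mul_inv, lt_div_iff₀' hx]
      linarith [mul_pos hε hx])
    (by
      filter_upwards [eventually_ge_atTop 1, htop.eventually (gt_mem_nhds hε)] with x hx hsmall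
      refine lt_trans ?_ hpos
      have hinv : 0 < ε * x⁻¹ := by positivity
      linarith [mul_le_mul_of_nonneg_left hx hε.le])
  exact hlarge.not_ge
    (hle.trans (sub_barrier_le_of_isLocalMax hr hε hy hχ (hχ' y hy) (hgen y hy) hmax))

theorem le_of_gamma_generator (hr : 0 < r) (hM : 0 ≤ M)
    (hχ : ∀ x, 0 < x → HasDerivAt χ (χ' x) x) (hχ' : ∀ x, 0 < x → HasDerivAt χ' (χ'' x) x)
    (hgen : ∀ x, 0 < x → -M ≤ x * χ'' x + (r + 2 - x) * χ' x - 2 * χ x)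
    (hzero : Tendsto (fun x => x * χ x) (𝓝[>] 0) (𝓝 0)) (htop : Tendsto χ atTop (𝓝 0))
    {x : ℝ} (hx : 0 < x) : χ x ≤ M / 2 := by
  have hlim : Tendsto (fun ε : ℝ => M / 2 + ε * ((r + 2) / 2) + ε * (x + x⁻¹)) (𝓝[>] 0)
      (𝓝 (M / 2)) := by
    have hcont : Continuous fun ε : ℝ => M / 2 + ε * ((r + 2) / 2) + ε * (x + x⁻¹) := by fun_prop
    simpa using (hcont.tendsto 0).mono_left nhdsWithin_le_nhds
  refine ge_of_tendsto hlim ?_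
  filter_upwards [self_mem_nhdsWithin] with ε hε
  exact sub_le_iff_le_add.1 (sub_barrier_le hr hM hε hχ hχ' hgen hzero htop hx)

end MaximumPrinciple

-- Differentiating the first-order equation `y u' + (a - y) u = s` raises `a` by one.
lemma hasDerivAt_gamma_quotient {s u : ℝ → ℝ} {a s' x : ℝ} (hx : x ≠ 0) (hs : HasDerivAt s s' x)
    (hu : HasDerivAt u ((s x - (a - x) * u x) / x) x) :
    HasDerivAt (fun y => (s y - (a - y) * u y) / y)
      ((s' + u x - (a + 1 - x) * ((s x - (a - x) * u x) / x)) / x) x := by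
  have ha : HasDerivAt (fun y : ℝ => a - y) (-1) x := (hasDerivAt_id x).const_sub a
  refine ((hs.fun_sub (ha.fun_mul hu)).fun_div (hasDerivAt_id x) hx).congr_deriv ?_
  simp only [id]
  field_simp
  ring

section GammaEquation

variable {r C M : ℝ} {k f : ℝ → ℝ}

lemma tendsto_mul_gamma_quotient_zero (hr : r ≠ 0) (hk : Continuous k)
    (hf : Tendsto f (𝓝[>] 0) (𝓝 (k 0 / r))) :
    Tendsto (fun x => x * ((k x - (r - x) * f x) / x)) (𝓝[>] 0) (𝓝 0) := by
  have hk0 : Tendsto k (𝓝[>] 0) (𝓝 (k 0)) := (hk.tendsto 0).mono_left nhdsWithin_le_nhds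
  have hr0 : Tendsto (fun x => r - x) (𝓝[>] 0) (𝓝 (r - 0)) :=
    (Continuous.tendsto (by fun_prop) 0).mono_left nhdsWithin_le_nhds
  have hlim := hk0.sub (hr0.mul hf)
  rw [sub_zero, mul_div_cancel₀ _ hr, sub_self] at hlim
  refine hlim.congr' ?_
  filter_upwards [self_mem_nhdsWithin] with x hx
  exact (mul_div_cancel₀ _ (ne_of_gt hx)).symm

lemma tendsto_gamma_quotient_atTop (hC : ∀ x, |k x| ≤ C) (hf : Tendsto f atTop (𝓝 0)) :
    Tendsto (fun x => (k x - (r - x) * f x) / x) atTop (𝓝 0) := by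
  have hlim := ((tendsto_div_of_abs_le hC tendsto_id).sub
    ((tendsto_inv_atTop_zero.const_mul r).mul hf)).add hf
  simp only [mul_zero, sub_zero, add_zero] at hlim
  refine hlim.congr' ?_
  filter_upwards [eventually_gt_atTop 0] with x hx
  simp only [id]
  field_simp
  ring

lemma le_of_gamma_equation (hr : 0 < r) (hk : ContDiff ℝ 2 k) (hC : ∀ x, |k x| ≤ C)
    (hM : ∀ x, |deriv (deriv k) x| ≤ M)
    (hf : ∀ x, 0 < x → HasDerivAt f ((k x - (r - x) * f x) / x) x)
    (hf0 : Tendsto f (𝓝[>] 0) (𝓝 (k 0 / r))) (hftop : Tendsto f atTop (𝓝 0))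
    {x : ℝ} (hx : 0 < x) : (k x - (r - x) * f x) / x ≤ M / 2 := by
  have hk1 (x : ℝ) := (hk.differentiable two_ne_zero x).hasDerivAt
  have hk2 (x : ℝ) := ((contDiff_succ_iff_deriv.1 hk).2.2.differentiable one_ne_zero x).hasDerivAt
  have hχ (x : ℝ) (hx : 0 < x) := hasDerivAt_gamma_quotient hx.ne' (hk1 x) (hf x hx)
  have hχ' (x : ℝ) (hx : 0 < x) := hasDerivAt_gamma_quotient hx.ne'
    ((hk2 x).fun_add (hf x hx)) (hχ x hx)
  refine le_of_gamma_generator hr ((abs_nonneg _).trans (hM 0)) hχ hχ' (fun x hx => ?_)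
    (tendsto_mul_gamma_quotient_zero hr.ne' hk.continuous hf0)
    (tendsto_gamma_quotient_atTop hC hftop) hx
  refine (neg_le_of_abs_le (hM x)).trans_eq ?_
  field_simp
  ring

lemma abs_le_of_gamma_equation (hr : 0 < r) (hk : ContDiff ℝ 2 k) (hC : ∀ x, |k x| ≤ C)
    (hM : ∀ x, |deriv (deriv k) x| ≤ M)
    (hf : ∀ x, 0 < x → HasDerivAt f ((k x - (r - x) * f x) / x) x)
    (hf0 : Tendsto f (𝓝[>] 0) (𝓝 (k 0 / r))) (hftop : Tendsto f atTop (𝓝 0))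
    {x : ℝ} (hx : 0 < x) : |(k x - (r - x) * f x) / x| ≤ M / 2 := by
  have hneg := le_of_gamma_equation (k := fun x => -k x) (f := fun x => -f x) hr (ContDiff.neg hk)
    (by simpa using hC) (by simpa using hM)
    (fun x hx => (hf x hx).fun_neg.congr_deriv (by ring)) (by simpa [neg_div] using hf0.neg)
    (by simpa using hftop.neg) hx
  refine abs_le'.2 ⟨le_of_gamma_equation hr hk hC hM hf hf0 hftop hx, hneg.trans' ?_⟩
  exact le_of_eq (by ring)

end GammaEquation

theorem exists_gamma_stein {r C M : ℝ} (hr : 0 < r) {g : ℝ → ℝ} (hg : ContDiff ℝ 2 g)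
    (hC : ∀ x, |g x| ≤ C) (hM : ∀ x, |deriv (deriv g) x| ≤ M) :
    ∃ f : ℝ → ℝ, ContDiffOn ℝ 1 f (Set.Ioi 0) ∧ (∀ x, 0 < x → |deriv f x| ≤ M / 2) ∧
      ∀ x, 0 < x → x * deriv f x + (r - x) * f x = g x - ∫ y, g y ∂(gammaMeasure r 1) := by
  have := isProbabilityMeasure_gammaMeasure hr one_pos
  set m := ∫ y, g y ∂(gammaMeasure r 1) with hm
  have hgc := hg.continuous
  have hk : ContDiff ℝ 2 fun x => g x - m := hg.sub contDiff_const
  have hkC (x : ℝ) : |g x - m| ≤ C + |m| := (abs_sub _ _).trans (by grw [hC x])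
  have hk0 : ∫ y, (g y - m) ∂(gammaMeasure r 1) = 0 := by
    rw [integral_sub (Integrable.of_bound (by fun_prop) C (Eventually.of_forall hC))
      (integrable_const _)]
    simp [hm]
  set f := gammaStein r fun x => g x - m
  have hf (x : ℝ) (hx : 0 < x) : HasDerivAt f ((g x - m - (r - x) * f x) / x) x :=
    hasDerivAt_gammaStein hr hk.continuous hkC hx
  have hf0 := tendsto_gammaStein_nhdsGT_zero hr hk.continuous hkC
  have hftop := tendsto_gammaStein_atTop hr hk.continuous hkC hk0
  refine ⟨f, ?_, fun x hx => ?_, fun x hx => ?_⟩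
  · have hfc : ContinuousOn f (Set.Ioi 0) := fun x hx => (hf x hx).continuousAt.continuousWithinAt
    rw [← zero_add (1 : WithTop ℕ∞), contDiffOn_succ_iff_deriv_of_isOpen isOpen_Ioi]
    refine ⟨fun x hx => (hf x hx).differentiableAt.differentiableWithinAt, by simp, ?_⟩
    refine contDiffOn_zero.2 (ContinuousOn.congr ?_ fun x hx => (hf x hx).deriv)
    exact ContinuousOn.div (by fun_prop) continuousOn_id fun x hx => ne_of_gt hx
  · rw [(hf x hx).deriv]
    exact abs_le_of_gamma_equation hr hk hkC (by simpa using hM) hf hf0 hftop hx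
  · rw [(hf x hx).deriv, mul_div_cancel₀ _ hx.ne', sub_add_cancel]

lemma exists_centeredGamma_stein {ν : ℝ} (hν : 0 < ν) {h : ℝ → ℝ} (hh : h ∈ classH) :
    ∃ φ : ℝ → ℝ, ContDiffOn ℝ 1 φ (Set.Ioi (-ν)) ∧ (∀ x, -ν < x → |deriv φ x| ≤ 1 / 2) ∧
      ∀ x, -ν < x →
        2 * (x + ν) * deriv φ x - x * φ x = h x - ∫ y, h y ∂(centeredGamma ν) := by
  obtain ⟨hh_smooth, hh_bound⟩ := hh
  have hshift : ContDiff ℝ 2 fun x => h (x - ν) := by fun_prop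
  obtain ⟨f, hf, hf', hstein⟩ := exists_gamma_stein (half_pos hν)
    (g := fun x => h (2 * x - ν)) (by fun_prop) (fun x => (hh_bound _).1) (M := 4) fun x => by
      rw [← iteratedDeriv_one, ← iteratedDeriv_succ', iteratedDeriv_comp_const_mul hshift,
        iteratedDeriv_comp_sub_const, abs_mul, abs_of_pos (by positivity : (0 : ℝ) < 2 ^ 2)]
      linarith [(hh_bound (2 * x - ν)).2.2]
  have hpos : ∀ x, -ν < x → 0 < (x + ν) / 2 := fun x hx => by linarith
  have hderiv : ∀ x, -ν < x →
      deriv (fun y => f ((y + ν) / 2) / 2) x = deriv f ((x + ν) / 2) / 4 := fun x hx => by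
    have hfx := (hf.differentiableOn one_ne_zero).hasDerivAt (Ioi_mem_nhds (hpos x hx))
    have hφx := (hfx.comp x (((hasDerivAt_id' x).add_const ν).div_const 2)).div_const 2
    exact hφx.deriv.trans (by ring)
  refine ⟨fun y => f ((y + ν) / 2) / 2,
    (hf.comp (by fun_prop) hpos).div_const 2, fun x hx => ?_, fun x hx => ?_⟩
  · rw [hderiv x hx, abs_div, abs_of_pos (four_pos (α := ℝ))]
    linarith [hf' _ (hpos x hx)]
  · rw [centeredGamma, integral_map (by fun_prop) hh_smooth.continuous.aestronglyMeasurable,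
      hderiv x hx]
    have heq := hstein _ (hpos x hx)
    rw [mul_div_cancel₀ (x + ν) two_ne_zero, add_sub_cancel_right] at heq
    linear_combination heq

/-! ### Stein kernels -/

section SteinKernel

variable {Ω : Type*} [MeasurableSpace Ω] {P : Measure Ω}

lemma ofReal_abs_integral_mul_le [IsProbabilityMeasure P] {ψ R : Ω → ℝ} {K : ℝ}
    (hK : ∀ᵐ ω ∂P, |ψ ω| ≤ K) (hR : AEStronglyMeasurable R P) :
    ENNReal.ofReal |∫ ω, ψ ω * R ω ∂P| ≤ ENNReal.ofReal K * eLpNorm R 2 P := by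
  have hbound : ∀ᵐ ω ∂P, ‖ψ ω * R ω‖ ≤ K * ‖R ω‖ := hK.mono fun ω hω => by
    rw [norm_mul]
    exact mul_le_mul_of_nonneg_right hω (norm_nonneg _)
  calc ENNReal.ofReal |∫ ω, ψ ω * R ω ∂P|
      ≤ eLpNorm (fun ω => ψ ω * R ω) 1 P := by
        rw [← Real.enorm_eq_ofReal_abs, eLpNorm_one_eq_lintegral_enorm]
        exact enorm_integral_le_lintegral_enorm _
    _ ≤ ENNReal.ofReal K * eLpNorm R 1 P := eLpNorm_le_mul_eLpNorm_of_ae_le_mul hbound 1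
    _ ≤ ENNReal.ofReal K * eLpNorm R 2 P := by
        gcongr
        exact eLpNorm_le_eLpNorm_of_exponent_le one_le_two hR

/-- `τ` is a Stein kernel of the square-integrable random variable `X`, that is,
`E[φ'(X) τ] = E[φ(X) X]` for the `C¹` functions `φ` with bounded derivative. In contrast to the
usual convention, `τ` is not required to be a function of `X`. -/
structure IsSteinKernel (P : Measure Ω) (X τ : Ω → ℝ) : Prop where
  memLp : MemLp X 2 P
  integrable : Integrable τ P
  integral_deriv_mul : ∀ {φ : ℝ → ℝ} {K : ℝ}, ContDiff ℝ 1 φ → (∀ x, |deriv φ x| ≤ K) →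
    ∫ ω, deriv φ (X ω) * τ ω ∂P = ∫ ω, φ (X ω) * X ω ∂P

lemma exists_contDiff_shift_eq {φ : ℝ → ℝ} {a K ε : ℝ} (hφ : ContDiffOn ℝ 1 φ (Set.Ioi a))
    (hK : ∀ x, a < x → |deriv φ x| ≤ K) (hε : 0 < ε) :
    ∃ ψ : ℝ → ℝ, ContDiff ℝ 1 ψ ∧ (∀ x, |deriv ψ x| ≤ K) ∧
      ∀ x, a < x → ψ x = φ (x + ε) ∧ deriv ψ x = deriv φ (x + ε) := by
  have hmem : ∀ x, a < max x a + ε := fun x => by linarith [le_max_right x a]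
  set θ : ℝ → ℝ := fun x => deriv φ (max x a + ε) with hθ_def
  have hθ : Continuous θ := (hφ.continuousOn_deriv_of_isOpen isOpen_Ioi le_rfl).comp_continuous
    (by fun_prop) hmem
  have hψ : ∀ x, HasDerivAt (fun x => φ (a + ε) + ∫ t in a..x, θ t) (θ x) x := fun x =>
    (hθ.integral_hasStrictDerivAt a x).hasDerivAt.const_add _
  refine ⟨_, contDiff_one_of_hasDerivAt hψ hθ, fun x => ?_, fun x hx => ⟨?_, ?_⟩⟩
  · rw [(hψ x).deriv]
    exact hK _ (hmem x)
  · have hshift : ∀ t ∈ Set.uIcc a x, HasDerivAt (fun t => φ (t + ε)) (θ t) t := fun t ht => by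
      rw [Set.uIcc_of_le hx.le] at ht
      have hφt := (hφ.differentiableOn one_ne_zero).hasDerivAt
        (Ioi_mem_nhds (show a < t + ε by linarith [ht.1]))
      simpa only [hθ_def, max_eq_left ht.1] using hφt.comp_add_const t ε
    rw [intervalIntegral.integral_eq_sub_of_hasDerivAt hshift (hθ.intervalIntegrable _ _),
      add_sub_cancel]
  · rw [(hψ x).deriv]
    simp only [hθ_def, max_eq_left hx.le]

lemma lipschitzOnWith_Ioi_of_abs_deriv_le {φ : ℝ → ℝ} {a K : ℝ}
    (hφ : DifferentiableOn ℝ φ (Set.Ioi a)) (hK : ∀ x, a < x → |deriv φ x| ≤ K) :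
    LipschitzOnWith K.toNNReal φ (Set.Ioi a) :=
  (convex_Ioi a).lipschitzOnWith_of_nnnorm_deriv_le
    (fun _ hx => hφ.differentiableAt (Ioi_mem_nhds hx)) fun x hx =>
      NNReal.coe_le_coe.1 ((hK x hx).trans (Real.le_coe_toNNReal K))

lemma abs_add_le_of_lipschitzOnWith_Ioi {φ : ℝ → ℝ} {a x ε : ℝ} {K : NNReal}
    (hφ : LipschitzOnWith K φ (Set.Ioi a)) (hx : a < x) (hε : 0 ≤ ε) (hε_le : ε ≤ 1) :
    |φ (x + ε)| ≤ |φ x| + K := by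
  have hdist := hφ.dist_le_mul (x + ε) (hx.trans_le (le_add_of_nonneg_right hε)) x hx
  rw [dist_self_add_left, Real.dist_eq, Real.norm_of_nonneg hε] at hdist
  have hdiff := hdist.trans (mul_le_of_le_one_right K.coe_nonneg hε_le)
  linarith [abs_sub_abs_le_abs_sub (φ (x + ε)) (φ x)]

lemma memLp_comp_of_lipschitzOnWith_Ioi [IsFiniteMeasure P] {X : Ω → ℝ} {p : ℝ≥0∞} {φ : ℝ → ℝ}
    {a : ℝ} {K : NNReal} (hφ : LipschitzOnWith K φ (Set.Ioi a)) (hX : MemLp X p P)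
    (hXa : ∀ᵐ ω ∂P, a < X ω) : MemLp (fun ω => φ (X ω)) p P := by
  obtain ⟨g, hg, hgφ⟩ := hφ.extend_real
  exact (memLp_comp_of_lipschitzWith hg hX).ae_eq (hXa.mono fun ω hω => (hgφ hω).symm)

namespace IsSteinKernel

variable {X τ : Ω → ℝ}

lemma integral_eq (hτ : IsSteinKernel P X τ) : ∫ ω, τ ω ∂P = ∫ ω, X ω ^ 2 ∂P := by
  simpa [pow_two] using hτ.integral_deriv_mul contDiff_id (K := 1) (by simp)

lemma integral_deriv_mul_of_contDiffOn_Ioi [IsFiniteMeasure P] (hτ : IsSteinKernel P X τ)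
    {φ : ℝ → ℝ} {a K : ℝ} (hXa : ∀ᵐ ω ∂P, a < X ω) (hφ : ContDiffOn ℝ 1 φ (Set.Ioi a))
    (hK : ∀ x, a < x → |deriv φ x| ≤ K) :
    ∫ ω, deriv φ (X ω) * τ ω ∂P = ∫ ω, φ (X ω) * X ω ∂P := by
  have hLip := lipschitzOnWith_Ioi_of_abs_deriv_le (hφ.differentiableOn one_ne_zero) hK
  have hφ' := hφ.continuousOn_deriv_of_isOpen isOpen_Ioi le_rfl
  obtain ⟨ε, -, hε, hε_lim⟩ := exists_seq_strictAnti_tendsto' (zero_lt_one (α := ℝ))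
  choose ψ hψ hψK hψφ using fun n => exists_contDiff_shift_eq hφ hK (hε n).1
  have hφX := memLp_comp_of_lipschitzOnWith_Ioi hLip hτ.memLp hXa
  have hψX : ∀ n, MemLp (fun ω => ψ n (X ω)) 2 P := fun n => memLp_comp_of_lipschitzWith
    (lipschitzWith_of_abs_deriv_le ((hψ n).differentiable one_ne_zero) (hψK n)) hτ.memLp
  have hshift : ∀ x, Tendsto (fun n => x + ε n) atTop (𝓝 x) := fun x => by
    simpa using hε_lim.const_add x
  have hderiv_lim : Tendsto (fun n => ∫ ω, deriv (ψ n) (X ω) * τ ω ∂P) atTop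
      (𝓝 (∫ ω, deriv φ (X ω) * τ ω ∂P)) := by
    refine tendsto_integral_of_dominated_convergence (fun ω => K * |τ ω|) (fun n =>
      (((hψ n).continuous_deriv le_rfl).comp_aestronglyMeasurable hτ.memLp.1).mul
        hτ.integrable.1) (hτ.integrable.abs.const_mul K) (fun n => .of_forall fun ω => ?_) ?_
    · rw [norm_mul]
      exact mul_le_mul_of_nonneg_right (hψK n _) (norm_nonneg _)
    · filter_upwards [hXa] with ω hω
      simp only [(hψφ _ _ hω).2]
      exact ((hφ'.continuousAt (Ioi_mem_nhds hω)).tendsto.comp (hshift _)).mul_const _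
  have hφ_lim : Tendsto (fun n => ∫ ω, ψ n (X ω) * X ω ∂P) atTop
      (𝓝 (∫ ω, φ (X ω) * X ω ∂P)) := by
    refine tendsto_integral_of_dominated_convergence
      (fun ω => (|φ (X ω)| + K.toNNReal) * |X ω|)
      (fun n => (hψX n).1.mul hτ.memLp.1)
      ((hφX.abs.add (memLp_const _)).integrable_mul hτ.memLp.abs) (fun n => ?_) ?_
    · filter_upwards [hXa] with ω hω
      rw [norm_mul, (hψφ n _ hω).1]
      exact mul_le_mul_of_nonneg_right
        (abs_add_le_of_lipschitzOnWith_Ioi hLip hω (hε n).1.le (hε n).2.le) (norm_nonneg _)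
    · filter_upwards [hXa] with ω hω
      simp only [(hψφ _ _ hω).1]
      exact ((hφ.continuousOn.continuousAt (Ioi_mem_nhds hω)).tendsto.comp
        (hshift _)).mul_const _
  exact tendsto_nhds_unique hderiv_lim (hφ_lim.congr fun n =>
    (hτ.integral_deriv_mul (hψ n) (hψK n)).symm)

lemma ofReal_abs_integral_map_sub_le [IsProbabilityMeasure P] (hτ : IsSteinKernel P X τ)
    {h φ σ : ℝ → ℝ} {m K : ℝ} (hh : Continuous h) (hφ : MemLp (fun ω => φ (X ω)) 2 P)
    (hφ_identity : ∫ ω, deriv φ (X ω) * τ ω ∂P = ∫ ω, φ (X ω) * X ω ∂P)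
    (hK : ∀ᵐ ω ∂P, |deriv φ (X ω)| ≤ K) (hσ : Integrable (fun ω => σ (X ω)) P)
    (hstein : ∀ᵐ ω ∂P, σ (X ω) * deriv φ (X ω) - X ω * φ (X ω) = h (X ω) - m) :
    ENNReal.ofReal |(∫ x, h x ∂(P.map X)) - m|
      ≤ ENNReal.ofReal K * eLpNorm (fun ω => σ (X ω) - τ ω) 2 P := by
  have hφ' : AEStronglyMeasurable (fun ω => deriv φ (X ω)) P :=
    ((measurable_deriv φ).comp_aemeasurable hτ.memLp.1.aemeasurable).aestronglyMeasurable
  have hφσ : Integrable (fun ω => deriv φ (X ω) * σ (X ω)) P := hσ.bdd_mul hφ' hK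
  have hφτ : Integrable (fun ω => deriv φ (X ω) * τ ω) P := hτ.integrable.bdd_mul hφ' hK
  have hφX : Integrable (fun ω => φ (X ω) * X ω) P := hφ.integrable_mul hτ.memLp
  have hhX : (fun ω => h (X ω)) =ᵐ[P]
      ((fun ω => deriv φ (X ω) * σ (X ω)) - fun ω => φ (X ω) * X ω) + fun _ => m := by
    filter_upwards [hstein] with ω hω
    simp only [Pi.add_apply, Pi.sub_apply]
    linear_combination -hω
  have hexpect : (∫ x, h x ∂(P.map X)) - m = ∫ ω, deriv φ (X ω) * (σ (X ω) - τ ω) ∂P := by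
    rw [integral_map hτ.memLp.1.aemeasurable hh.aestronglyMeasurable, integral_congr_ae hhX,
      integral_add' (hφσ.sub hφX) (integrable_const m), integral_sub' hφσ hφX, ← hφ_identity,
      ← integral_sub hφσ hφτ]
    simp [mul_sub]
  rw [hexpect]
  exact ofReal_abs_integral_mul_le hK (hσ.1.sub hτ.integrable.1)

lemma ofReal_abs_integral_map_sub_gaussianReal_le [IsProbabilityMeasure P]
    (hτ : IsSteinKernel P X τ) {h φ : ℝ → ℝ} {K : ℝ} (hh : Continuous h) (hφ : ContDiff ℝ 1 φ)
    (hK : ∀ x, |deriv φ x| ≤ K)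
    (hstein : ∀ x, deriv φ x - x * φ x = h x - ∫ y, h y ∂(gaussianReal 0 1)) :
    ENNReal.ofReal |(∫ x, h x ∂(P.map X)) - ∫ x, h x ∂(gaussianReal 0 1)|
      ≤ ENNReal.ofReal K * eLpNorm (fun ω => 1 - τ ω) 2 P :=
  hτ.ofReal_abs_integral_map_sub_le (σ := fun _ => 1) hh
    (memLp_comp_of_lipschitzWith
      (lipschitzWith_of_abs_deriv_le (hφ.differentiable one_ne_zero) hK) hτ.memLp)
    (hτ.integral_deriv_mul hφ hK) (.of_forall fun ω => hK _) (integrable_const 1)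
    (.of_forall fun ω => by rw [one_mul, hstein])

theorem dTV_le [IsProbabilityMeasure P] (hτ : IsSteinKernel P X τ) :
    dTV (P.map X) (gaussianReal 0 1) ≤ 2 * eLpNorm (fun ω => 1 - τ ω) 2 P := by
  have := Measure.isProbabilityMeasure_map hτ.memLp.1.aemeasurable
  obtain htop | htop := eq_or_ne (eLpNorm (fun ω => 1 - τ ω) 2 P) ∞
  · simp [htop]
  rw [← ENNReal.ofReal_toReal (ENNReal.mul_ne_top ENNReal.ofNat_ne_top htop)]
  refine dTV_le_of_continuous fun h hh h_mem => ?_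
  obtain ⟨f, hf, hf', hstein⟩ := exists_normal_stein_of_mem_Icc hh h_mem
  rw [← ENNReal.ofReal_le_iff_le_toReal (ENNReal.mul_ne_top ENNReal.ofNat_ne_top htop)]
  simpa only [ENNReal.ofReal_ofNat] using
    hτ.ofReal_abs_integral_map_sub_gaussianReal_le hh hf hf' hstein

theorem dW_le [IsProbabilityMeasure P] (hτ : IsSteinKernel P X τ) :
    dW (P.map X) (gaussianReal 0 1) ≤ eLpNorm (fun ω => 1 - τ ω) 2 P := by
  have := Measure.isProbabilityMeasure_map hτ.memLp.1.aemeasurable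
  have hX : MemLp id 1 (P.map X) :=
    (memLp_map_measure_iff aestronglyMeasurable_id hτ.memLp.1.aemeasurable).2
      (hτ.memLp.mono_exponent one_le_two)
  refine dW_le_of_contDiff_two hX (memLp_id_gaussianReal' 1 ENNReal.one_ne_top)
    fun g B hg hg' hg'' => ?_
  obtain ⟨f, hf, hf', hstein⟩ := exists_normal_stein_of_abs_deriv_le hg hg' hg''
  simpa using hτ.ofReal_abs_integral_map_sub_gaussianReal_le hg.continuous hf hf' hstein

theorem dH_le [IsProbabilityMeasure P] (hτ : IsSteinKernel P X τ) {ν : ℝ} (hν : 0 < ν)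
    (hX : ∀ᵐ ω ∂P, -ν < X ω) :
    dH (P.map X) (centeredGamma ν) ≤ eLpNorm (fun ω => 2 * (X ω + ν) - τ ω) 2 P := by
  refine iSup₂_le fun h hh => ?_
  obtain ⟨φ, hφ, hφ', hstein⟩ := exists_centeredGamma_stein hν hh
  have hφX := memLp_comp_of_lipschitzOnWith_Ioi
    (lipschitzOnWith_Ioi_of_abs_deriv_le (hφ.differentiableOn one_ne_zero) hφ') hτ.memLp hX
  have hbound := hτ.ofReal_abs_integral_map_sub_le (σ := fun x => 2 * (x + ν)) hh.1.continuous hφX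
    (hτ.integral_deriv_mul_of_contDiffOn_Ioi hX hφ hφ') (hX.mono fun ω => hφ' _)
    (((hτ.memLp.integrable one_le_two).add (integrable_const ν)).const_mul 2)
    (hX.mono fun ω => hstein _)
  refine hbound.trans (mul_le_of_le_one_left zero_le ?_)
  rw [ENNReal.ofReal_le_one]
  exact one_half_lt_one.le

end IsSteinKernel

end SteinKernel

/-! ### Resampling coordinates of a product measure -/

section Resampling

variable {α β : Type*} [MeasurableSpace α] [MeasurableSpace β]

lemma integral_comp_measurePreserving {E : Type*} [NormedAddCommGroup E] [NormedSpace ℝ E]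
    {μ : Measure α} {ν : Measure β} {T : α → β} (hT : MeasurePreserving T μ ν) {f : β → E}
    (hf : AEStronglyMeasurable f ν) : ∫ x, f (T x) ∂μ = ∫ y, f y ∂ν := by
  rw [← hT.map_eq] at hf ⊢
  exact (integral_map hT.aemeasurable hf).symm

lemma integrable_of_abs_le {μ : Measure α} [IsFiniteMeasure μ] {f : α → ℝ} {C : ℝ}
    (hf : Measurable f) (hC : ∀ x, |f x| ≤ C) : Integrable f μ :=
  Integrable.of_bound hf.aestronglyMeasurable C (Eventually.of_forall fun x => hC x)

lemma abs_mul_le_mul_of_abs_le {a b A B : ℝ} (ha : |a| ≤ A) (hb : |b| ≤ B) :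
    |a * b| ≤ A * B := by
  rw [abs_mul]
  exact mul_le_mul ha hb (abs_nonneg _) ((abs_nonneg _).trans ha)

variable {ι : Type*} {X : ι → Type*} [∀ i, MeasurableSpace (X i)]

lemma measurable_piecewise_prod (s : Set ι) [DecidablePred (· ∈ s)] :
    Measurable fun p : (∀ i, X i) × (∀ i, X i) => s.piecewise p.1 p.2 := by
  refine measurable_pi_lambda _ fun i => ?_
  by_cases hi : i ∈ s <;> simp only [Set.piecewise, hi, if_true, if_false] <;> fun_prop

variable [Fintype ι] (μ : ∀ i, Measure (X i)) [∀ i, IsProbabilityMeasure (μ i)]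

lemma measurePreserving_piecewise (s : Set ι) [DecidablePred (· ∈ s)] :
    MeasurePreserving (fun p : (∀ i, X i) × (∀ i, X i) => s.piecewise p.1 p.2)
      ((Measure.pi μ).prod (Measure.pi μ)) (Measure.pi μ) := by
  refine ⟨measurable_piecewise_prod s, (Measure.pi_eq fun t ht => ?_).symm⟩
  rw [Measure.map_apply (measurable_piecewise_prod s) (MeasurableSet.univ_pi ht)]
  have preimage_box : (fun p : (∀ i, X i) × (∀ i, X i) => s.piecewise p.1 p.2) ⁻¹' Set.univ.pi t
      = (Set.univ.pi fun i => if i ∈ s then t i else Set.univ) ×ˢ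
        (Set.univ.pi fun i => if i ∈ s then Set.univ else t i) := by
    ext p
    simp only [Set.mem_preimage, Set.mem_univ_pi, Set.mem_prod, Set.piecewise, ← forall_and]
    refine forall_congr' fun i => ?_
    by_cases hi : i ∈ s <;> simp [hi]
  rw [preimage_box, Measure.prod_prod, Measure.pi_pi, Measure.pi_pi, ← Finset.prod_mul_distrib]
  refine Finset.prod_congr rfl fun i _ => ?_
  by_cases hi : i ∈ s <;> simp [hi]

lemma measurePreserving_update [DecidableEq ι] (k : ι) :
    MeasurePreserving (fun p : (∀ i, X i) × X k => Function.update p.1 k p.2)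
      ((Measure.pi μ).prod (μ k)) (Measure.pi μ) := by
  have hsnd : MeasurePreserving (Prod.map id (Function.eval k))
      ((Measure.pi μ).prod (Measure.pi μ)) ((Measure.pi μ).prod (μ k)) :=
    (MeasurePreserving.id _).prod (measurePreserving_eval μ k)
  have hcomp : (fun p : (∀ i, X i) × X k => Function.update p.1 k p.2)
      ∘ Prod.map id (Function.eval k)
      = fun p : (∀ i, X i) × (∀ i, X i) => ({k}ᶜ : Set ι).piecewise p.1 p.2 := by
    funext p i
    by_cases hi : i = k
    · subst hi; simp
    · simp [hi]
  refine ⟨measurable_update', ?_⟩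
  rw [← hsnd.map_eq, Measure.map_map measurable_update' hsnd.measurable, hcomp,
    (measurePreserving_piecewise μ _).map_eq]

end Resampling

/-! ### Averaging over the last coordinates of a cube -/

section LastCoordinates

/-- The uniform law on `[-1, 1]`. -/
def unif : Measure ℝ := (2 : ℝ≥0∞)⁻¹ • volume.restrict (Set.Icc (-1) 1)

instance : IsProbabilityMeasure unif where
  measure_univ := by
    rw [unif, Measure.smul_apply, Measure.restrict_apply_univ, Real.volume_Icc, smul_eq_mul]
    norm_num
    exact ENNReal.inv_mul_cancel two_ne_zero ENNReal.ofNat_ne_top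

lemma integral_unif (g : ℝ → ℝ) : ∫ x, g x ∂unif = 2⁻¹ * ∫ x in (-1 : ℝ)..1, g x := by
  rw [unif, integral_smul_measure, intervalIntegral.integral_of_le (by norm_num),
    integral_Icc_eq_integral_Ioc]
  simp

lemma ae_mem_Icc_unif : ∀ᵐ x ∂unif, x ∈ Set.Icc (-1 : ℝ) 1 :=
  Measure.ae_smul_measure (ae_restrict_mem measurableSet_Icc) _

/-- The uniform law on the cube `[-1, 1]^N`. -/
def cube (N : ℕ) : Measure (Fin N → ℝ) := Measure.pi fun _ => unif

instance (N : ℕ) : IsProbabilityMeasure (cube N) := by unfold cube; infer_instance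

variable {N : ℕ}

/-- The point with the first `k` coordinates of `u` and the other coordinates of `v`. -/
def merge (k : ℕ) (u v : Fin N → ℝ) : Fin N → ℝ := {i : Fin N | (i : ℕ) < k}.piecewise u v

lemma merge_of_lt {k : ℕ} {i : Fin N} (hi : (i : ℕ) < k) (u v : Fin N → ℝ) :
    merge k u v i = u i :=
  if_pos hi

lemma merge_of_le {k : ℕ} {i : Fin N} (hi : k ≤ (i : ℕ)) (u v : Fin N → ℝ) :
    merge k u v i = v i :=
  if_neg hi.not_gt

lemma measurable_merge (k : ℕ) :
    Measurable fun p : (Fin N → ℝ) × (Fin N → ℝ) => merge k p.1 p.2 :=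
  measurable_piecewise_prod _

lemma measurePreserving_merge (k : ℕ) :
    MeasurePreserving (fun p : (Fin N → ℝ) × (Fin N → ℝ) => merge k p.1 p.2)
      ((cube N).prod (cube N)) (cube N) :=
  measurePreserving_piecewise _ _

lemma measurePreserving_update_cube (k : Fin N) :
    MeasurePreserving (fun p : (Fin N → ℝ) × ℝ => Function.update p.1 k p.2)
      ((cube N).prod unif) (cube N) :=
  measurePreserving_update _ k

lemma merge_update_self (k : Fin N) (u v : Fin N → ℝ) (x : ℝ) :
    merge k u (Function.update v k x) = Function.update (merge k u v) k x := by
  funext i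
  by_cases hi : i = k
  · subst hi; simp [merge_of_le]
  · simp [merge, Set.piecewise, hi]

lemma update_merge (k : Fin N) (u v : Fin N → ℝ) (x : ℝ) :
    Function.update (merge k u v) k x = merge (k + 1) (Function.update u k x) v := by
  funext i
  by_cases hi : i = k
  · subst hi; simp [merge_of_lt]
  · have hlt : (i : ℕ) < k + 1 ↔ (i : ℕ) < k := by
      have : (i : ℕ) ≠ k := fun h => hi (Fin.ext h)
      omega
    simp only [merge, Set.piecewise, Set.mem_ofPred_eq, hlt, Function.update_of_ne hi]

/-- The average of `f` over the coordinates from the `k`-th on: the conditional expectation of `f`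
given the first `k` coordinates under the uniform law on the cube. -/
def avg (k : ℕ) (f : (Fin N → ℝ) → ℝ) (u : Fin N → ℝ) : ℝ :=
  ∫ v, f (merge k u v) ∂(cube N)

lemma measurable_avg (k : ℕ) {f : (Fin N → ℝ) → ℝ} (hf : Measurable f) :
    Measurable (avg k f) :=
  (StronglyMeasurable.integral_prod_right' (ν := cube N)
    (f := fun p : (Fin N → ℝ) × (Fin N → ℝ) => f (merge k p.1 p.2))
    (hf.comp (measurable_merge k)).stronglyMeasurable).measurable

lemma abs_avg_le (k : ℕ) {f : (Fin N → ℝ) → ℝ} {C : ℝ} (hC : ∀ u, |f u| ≤ C)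
    (u : Fin N → ℝ) : |avg k f u| ≤ C :=
  abs_integral_le_of_abs_le fun _ => hC _

lemma avg_congr_left {k : ℕ} (f : (Fin N → ℝ) → ℝ) {u u' : Fin N → ℝ}
    (h : ∀ i : Fin N, (i : ℕ) < k → u i = u' i) : avg k f u = avg k f u' := by
  have hmerge : ∀ v, merge k u v = merge k u' v := fun v => funext fun i =>
    ite_congr rfl (h i) fun _ => rfl
  simp only [avg, hmerge]

lemma avg_merge {k l : ℕ} (hkl : k ≤ l) (f : (Fin N → ℝ) → ℝ) (u v : Fin N → ℝ) :
    avg k f (merge l u v) = avg k f u :=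
  avg_congr_left f fun _ hi => merge_of_lt (hi.trans_le hkl) u v

lemma avg_update_of_le {k : ℕ} {l : Fin N} (hkl : k ≤ (l : ℕ)) (f : (Fin N → ℝ) → ℝ)
    (u : Fin N → ℝ) (x : ℝ) : avg k f (Function.update u l x) = avg k f u :=
  avg_congr_left f fun _ hi =>
    Function.update_of_ne (fun h => (hi.trans_le hkl).ne (congrArg Fin.val h)) x u

lemma avg_all (f : (Fin N → ℝ) → ℝ) (u : Fin N → ℝ) : avg N f u = f u := by
  have hmerge : ∀ v, merge N u v = u := fun v => funext fun i => merge_of_lt i.2 u v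
  simp [avg, hmerge]

lemma avg_zero (f : (Fin N → ℝ) → ℝ) (u : Fin N → ℝ) : avg 0 f u = ∫ v, f v ∂(cube N) := by
  have hmerge : ∀ v, merge 0 u v = v := fun v => funext fun i => merge_of_le i.1.zero_le u v
  simp only [avg, hmerge]

lemma integral_mul_eq_integral_avg_mul {k : ℕ} {f g : (Fin N → ℝ) → ℝ} {A B : ℝ}
    (hf : Measurable f) (hA : ∀ u, |f u| ≤ A) (hg : Measurable g) (hB : ∀ u, |g u| ≤ B)
    (hg_merge : ∀ u v, g (merge k u v) = g u) :
    ∫ u, f u * g u ∂(cube N) = ∫ u, avg k f u * g u ∂(cube N) := by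
  have hint : Integrable (fun u => f u * g u) (cube N) :=
    integrable_of_abs_le (hf.mul hg) fun u => abs_mul_le_mul_of_abs_le (hA u) (hB u)
  have hmerge := measurePreserving_merge (N := N) k
  rw [← integral_comp_measurePreserving hmerge hint.aestronglyMeasurable,
    integral_prod (fun p => f (merge k p.1 p.2) * g (merge k p.1 p.2))
      (hmerge.integrable_comp_of_integrable hint)]
  simp only [hg_merge, integral_mul_const, avg]

lemma integral_avg_mul_avg_of_le {k l : ℕ} (hkl : k ≤ l) {f g : (Fin N → ℝ) → ℝ} {A B : ℝ}
    (hf : Measurable f) (hA : ∀ u, |f u| ≤ A) (hg : Measurable g) (hB : ∀ u, |g u| ≤ B) :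
    ∫ u, avg l f u * avg k g u ∂(cube N) = ∫ u, f u * avg k g u ∂(cube N) :=
  (integral_mul_eq_integral_avg_mul hf hA (measurable_avg k hg) (abs_avg_le k hB)
    (avg_merge hkl g)).symm

lemma avg_eq_integral_update (k : Fin N) {f : (Fin N → ℝ) → ℝ} {A : ℝ} (hf : Measurable f)
    (hA : ∀ u, |f u| ≤ A) (u : Fin N → ℝ) :
    avg k f u = ∫ v, ∫ x, f (Function.update (merge k u v) k x) ∂unif ∂(cube N) := by
  have hmeas : Measurable fun v => f (merge k u v) :=
    hf.comp ((measurable_merge k).comp measurable_prodMk_left)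
  rw [avg, ← integral_comp_measurePreserving (measurePreserving_update_cube k)
    hmeas.aestronglyMeasurable, integral_prod]
  · simp only [merge_update_self]
  · exact integrable_of_abs_le (hmeas.comp measurable_update') fun _ => hA _

/-- The orthogonality of the martingale differences of `avg`. -/
lemma integral_avg_sub_mul_avg_sub (k : ℕ) {f g : (Fin N → ℝ) → ℝ} {A B : ℝ}
    (hf : Measurable f) (hA : ∀ u, |f u| ≤ A) (hg : Measurable g) (hB : ∀ u, |g u| ≤ B) :
    ∫ u, (avg k g u - avg (k + 1) g u) * (avg k f u - avg (k + 1) f u) ∂(cube N)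
      = (∫ u, g u * avg (k + 1) f u ∂(cube N)) - ∫ u, g u * avg k f u ∂(cube N) := by
  have hint : ∀ i j, Integrable (fun u => avg i g u * avg j f u) (cube N) := fun i j =>
    integrable_of_abs_le ((measurable_avg i hg).mul (measurable_avg j hf))
      fun u => abs_mul_le_mul_of_abs_le (abs_avg_le i hB u) (abs_avg_le j hA u)
  have hcross : ∫ u, avg k g u * avg (k + 1) f u ∂(cube N) = ∫ u, g u * avg k f u ∂(cube N) := by
    simp only [mul_comm (avg k g _)]
    rw [integral_avg_mul_avg_of_le k.le_succ hf hA hg hB,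
      ← integral_avg_mul_avg_of_le le_rfl hf hA hg hB,
      ← integral_avg_mul_avg_of_le le_rfl hg hB hf hA]
    simp only [mul_comm]
  have hint_sub : ∀ j, Integrable
      (fun u => avg k g u * avg j f u - avg (k + 1) g u * avg j f u) (cube N) := fun j =>
    (hint k j).sub (hint (k + 1) j)
  simp only [sub_mul, mul_sub]
  rw [integral_sub (hint_sub _) (hint_sub _),
    integral_sub (hint _ _) (hint _ _), integral_sub (hint _ _) (hint _ _), hcross,
    integral_avg_mul_avg_of_le le_rfl hg hB hf hA,
    integral_avg_mul_avg_of_le k.le_succ hg hB hf hA,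
    integral_avg_mul_avg_of_le le_rfl hg hB hf hA]
  ring

end LastCoordinates

/-! ### The gradient on a block -/

section BlockGradient

/-- The kernel of the gradient at the time `2k + 1 + s` when the jump of the `k`-th block occurs at
the time `2k + 1 + x`: it is `1 - x` for `s ≤ x` and `-(1 + x)` for `x < s`. -/
def blockKernel (s x : ℝ) : ℝ := (if s ≤ x then 2 else 0) - (1 + x)

lemma measurable_blockKernel : Measurable fun p : ℝ × ℝ => blockKernel p.1 p.2 :=
  (Measurable.ite (measurableSet_le measurable_fst measurable_snd) measurable_const
    measurable_const).sub (by fun_prop)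

lemma abs_blockKernel_le {s x : ℝ} (hx : x ∈ Set.Icc (-1 : ℝ) 1) : |blockKernel s x| ≤ 2 := by
  rw [abs_le, blockKernel]
  split_ifs <;> constructor <;> linarith [hx.1, hx.2]

lemma integral_deriv_mul_one_add {g : ℝ → ℝ} (hg : ContDiff ℝ 1 g) :
    ∫ x in (-1 : ℝ)..1, deriv g x * (1 + x) = 2 * g 1 - ∫ x in (-1 : ℝ)..1, g x := by
  have hparts := intervalIntegral.integral_mul_deriv_eq_deriv_mul (a := -1) (b := 1)
    (u := fun x => 1 + x) (u' := fun _ => 1) (v := g)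
    (fun x _ => (hasDerivAt_id x).const_add 1)
    (fun x _ => (hg.differentiable_one x).hasDerivAt) (by simp)
    (hg.continuous_deriv_one.intervalIntegrable _ _)
  simp only [mul_comm (deriv g _), hparts, one_mul]
  ring

lemma integral_ite_le_mul_deriv {g : ℝ → ℝ} (hg : ContDiff ℝ 1 g) {s : ℝ}
    (hs : s ∈ Set.Icc (-1 : ℝ) 1) :
    ∫ x in (-1 : ℝ)..1, deriv g x * (if s ≤ x then 2 else 0) = 2 * (g 1 - g s) := by
  have hIcc : Set.Icc (-1 : ℝ) 1 ∩ Set.Ici s = Set.Icc s 1 := by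
    rw [← Set.Ici_inter_Iic, Set.inter_right_comm, Set.Ici_inter_Ici, sup_eq_right.mpr hs.1,
      Set.Ici_inter_Iic]
  have hind : (fun x => deriv g x * (if s ≤ x then 2 else 0))
      = (Set.Ici s).indicator fun x => 2 * deriv g x := by
    funext x
    by_cases h : s ≤ x <;> simp [h, mul_comm]
  rw [hind, intervalIntegral.integral_of_le (by norm_num), ← integral_Icc_eq_integral_Ioc,
    setIntegral_indicator measurableSet_Ici, hIcc, integral_Icc_eq_integral_Ioc,
    ← intervalIntegral.integral_of_le hs.2, intervalIntegral.integral_const_mul,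
    intervalIntegral.integral_deriv_eq_sub (fun x _ => hg.differentiable_one x)
      (hg.continuous_deriv_one.intervalIntegrable _ _)]

lemma integral_deriv_mul_blockKernel {g : ℝ → ℝ} (hg : ContDiff ℝ 1 g) {s : ℝ}
    (hs : s ∈ Set.Icc (-1 : ℝ) 1) :
    ∫ x, deriv g x * blockKernel s x ∂unif = (∫ x, g x ∂unif) - g s := by
  have hcont := hg.continuous_deriv_one
  have hstep : IntervalIntegrable (fun x => deriv g x * (if s ≤ x then 2 else 0))
      volume (-1) 1 := by
    rw [intervalIntegrable_iff]
    refine (hcont.intervalIntegrable _ _).def'.mul_bdd (c := 2)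
      (Measurable.ite measurableSet_Ici measurable_const measurable_const).aestronglyMeasurable
      (Eventually.of_forall fun x => ?_)
    split_ifs <;> simp
  have hlin : IntervalIntegrable (fun x => deriv g x * (1 + x)) volume (-1) 1 :=
    (hcont.mul (by fun_prop)).intervalIntegrable _ _
  rw [integral_unif, integral_unif]
  simp only [blockKernel, mul_sub]
  rw [intervalIntegral.integral_sub hstep hlin,
    integral_deriv_mul_one_add hg, integral_ite_le_mul_deriv hg hs]
  ring

variable {N : ℕ}

/-- The partial derivative in the direction of the `k`-th coordinate. -/
def partialDeriv (k : Fin N) (f : (Fin N → ℝ) → ℝ) (u : Fin N → ℝ) : ℝ :=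
  fderiv ℝ f u (Pi.single k 1)

/-- A `C¹` function which is bounded together with its partial derivatives. -/
structure IsBoundedSmooth (f : (Fin N → ℝ) → ℝ) : Prop where
  smooth : ContDiff ℝ 1 f
  exists_bound : ∃ C, ∀ u, |f u| ≤ C
  exists_partialDeriv_bound : ∃ C, ∀ u k, |partialDeriv k f u| ≤ C

variable {f g : (Fin N → ℝ) → ℝ}

lemma continuous_partialDeriv (hf : ContDiff ℝ 1 f) (k : Fin N) :
    Continuous (partialDeriv k f) :=
  (hf.continuous_fderiv one_ne_zero).clm_apply continuous_const

lemma deriv_comp_update (hf : Differentiable ℝ f) (k : Fin N) (u : Fin N → ℝ) (x : ℝ) :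
    deriv (fun x => f (Function.update u k x)) x = partialDeriv k f (Function.update u k x) :=
  ((hf _).hasFDerivAt.comp_hasDerivAt x (hasDerivAt_update u k x)).deriv

/-- The gradient in the `k`-th block at the time `2k + 1 + s`, as a function on the cube. The
coordinate is clipped to `[-1, 1]` so that bounds hold everywhere and not only almost surely. -/
def blockGrad (k : Fin N) (f : (Fin N → ℝ) → ℝ) (s : ℝ) (u : Fin N → ℝ) : ℝ :=
  partialDeriv k f u * blockKernel s (max (-1) (min 1 (u k)))

/-- The conditional expectation, given the first `k` coordinates, of the gradient in the `k`-th
block at the time `2k + 1 + s`; see `avg_blockGrad`. -/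
def blockProj (k : Fin N) (f : (Fin N → ℝ) → ℝ) (s : ℝ) (u : Fin N → ℝ) : ℝ :=
  avg k f u - avg (k + 1) f (Function.update u k s)

lemma measurable_blockProj (k : Fin N) (hf : Measurable f) :
    Measurable fun p : (Fin N → ℝ) × ℝ => blockProj k f p.2 p.1 :=
  ((measurable_avg k hf).comp measurable_fst).sub
    ((measurable_avg (k + 1) hf).comp measurable_update')

lemma abs_blockProj_le (k : Fin N) {C : ℝ} (hC : ∀ u, |f u| ≤ C) (s : ℝ) (u : Fin N → ℝ) :
    |blockProj k f s u| ≤ 2 * C := by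
  refine (abs_sub _ _).trans ?_
  linarith [abs_avg_le k hC u, abs_avg_le (k + 1) hC (Function.update u k s)]

lemma blockProj_congr (k : Fin N) (f : (Fin N → ℝ) → ℝ) (s : ℝ) {u u' : Fin N → ℝ}
    (h : ∀ i : Fin N, (i : ℕ) < k → u i = u' i) : blockProj k f s u = blockProj k f s u' := by
  have hupdate : ∀ i : Fin N, (i : ℕ) < k + 1 →
      Function.update u k s i = Function.update u' k s i := fun i hi => by
    rcases eq_or_ne i k with rfl | hik
    · simp
    · have : (i : ℕ) ≠ k := fun h => hik (Fin.ext h)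
      simpa [hik] using h i (by omega)
  rw [blockProj, blockProj, avg_congr_left f h, avg_congr_left f hupdate]

lemma measurable_blockGrad (k : Fin N) (hf : ContDiff ℝ 1 f) :
    Measurable fun p : (Fin N → ℝ) × ℝ => blockGrad k f p.2 p.1 :=
  ((continuous_partialDeriv hf k).measurable.comp measurable_fst).mul
    (measurable_blockKernel.comp (measurable_snd.prodMk (by fun_prop)))

lemma abs_blockGrad_le (k : Fin N) {C : ℝ} (hC : ∀ u, |partialDeriv k f u| ≤ C) (s : ℝ)
    (u : Fin N → ℝ) : |blockGrad k f s u| ≤ C * 2 :=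
  abs_mul_le_mul_of_abs_le (hC u)
    (abs_blockKernel_le ⟨le_max_left _ _, max_le (by norm_num) (min_le_left _ _)⟩)

lemma integral_blockGrad_update (k : Fin N) (hf : ContDiff ℝ 1 f) {s : ℝ}
    (hs : s ∈ Set.Icc (-1 : ℝ) 1) (u : Fin N → ℝ) :
    ∫ x, blockGrad k f s (Function.update u k x) ∂unif
      = (∫ x, f (Function.update u k x) ∂unif) - f (Function.update u k s) := by
  have hfu : ContDiff ℝ 1 fun x => f (Function.update u k x) := hf.comp (contDiff_update 1 u k)
  rw [← integral_deriv_mul_blockKernel hfu hs]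
  refine integral_congr_ae (ae_mem_Icc_unif.mono fun x hx => ?_)
  simp only [blockGrad, deriv_comp_update hf.differentiable_one, Function.update_self,
    min_eq_right hx.2, max_eq_right hx.1]

lemma avg_blockGrad (k : Fin N) (hf : IsBoundedSmooth f) {s : ℝ} (hs : s ∈ Set.Icc (-1 : ℝ) 1)
    (u : Fin N → ℝ) : avg k (blockGrad k f s) u = blockProj k f s u := by
  obtain ⟨C, hC⟩ := hf.exists_bound
  obtain ⟨C', hC'⟩ := hf.exists_partialDeriv_bound
  have hfm := hf.smooth.continuous.measurable
  have hmeas : Measurable fun p : (Fin N → ℝ) × ℝ => f (Function.update (merge k u p.1) k p.2) :=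
    hfm.comp (measurable_update'.comp (((measurable_merge k).comp
      (measurable_const.prodMk measurable_fst)).prodMk measurable_snd))
  rw [avg_eq_integral_update k (f := blockGrad k f s)
    ((measurable_blockGrad k hf.smooth).comp measurable_prodMk_right)
    (abs_blockGrad_le k (fun u => hC' u k) s)]
  simp only [integral_blockGrad_update k hf.smooth hs]
  rw [integral_sub, ← avg_eq_integral_update k hfm hC, blockProj]
  · simp only [update_merge]
    rfl
  · exact integrable_of_abs_le
      (StronglyMeasurable.integral_prod_right' (ν := unif) hmeas.stronglyMeasurable).measurable
      fun v => abs_integral_le_of_abs_le fun x => hC _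
  · exact integrable_of_abs_le (hmeas.comp (measurable_id.prodMk measurable_const)) fun v => hC _

lemma integral_blockGrad_mul_blockProj_eq (k : Fin N) (hf : IsBoundedSmooth f)
    (hg : IsBoundedSmooth g) {s : ℝ} (hs : s ∈ Set.Icc (-1 : ℝ) 1) :
    ∫ u, blockGrad k g s u * blockProj k f s u ∂(cube N)
      = ∫ u, blockProj k g s u * blockProj k f s u ∂(cube N) := by
  obtain ⟨A, hA⟩ := hf.exists_bound
  obtain ⟨B, hB⟩ := hg.exists_partialDeriv_bound
  rw [integral_mul_eq_integral_avg_mul (k := k) (f := blockGrad k g s) (g := blockProj k f s)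
    ((measurable_blockGrad k hg.smooth).comp measurable_prodMk_right)
    (abs_blockGrad_le k (fun u => hB u k) s)
    ((measurable_blockProj k hf.smooth.continuous.measurable).comp measurable_prodMk_right)
    (abs_blockProj_le k hA s)
    (fun u v => blockProj_congr k f s fun i hi => merge_of_lt hi u v)]
  simp only [avg_blockGrad k hg hs]

lemma integral_blockGrad_mul_blockProj (k : Fin N) (hf : IsBoundedSmooth f)
    (hg : IsBoundedSmooth g) :
    ∫ s, ∫ u, blockGrad k g s u * blockProj k f s u ∂(cube N) ∂unif
      = (∫ u, g u * avg (k + 1) f u ∂(cube N)) - ∫ u, g u * avg k f u ∂(cube N) := by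
  obtain ⟨A, hA⟩ := hf.exists_bound
  obtain ⟨B, hB⟩ := hg.exists_bound
  have hfm := hf.smooth.continuous.measurable
  have hgm := hg.smooth.continuous.measurable
  set W : (Fin N → ℝ) → ℝ :=
    fun u => (avg k g u - avg (k + 1) g u) * (avg k f u - avg (k + 1) f u) with hW
  have hupdate : ∀ s u, blockProj k g s u * blockProj k f s u = W (Function.update u k s) :=
    fun s u => by simp only [hW, blockProj, avg_update_of_le le_rfl]
  have hW_int : Integrable W (cube N) := by
    refine integrable_of_abs_le (C := (B + B) * (A + A))
      (((measurable_avg k hgm).sub (measurable_avg _ hgm)).mul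
        ((measurable_avg k hfm).sub (measurable_avg _ hfm))) fun u => ?_
    exact abs_mul_le_mul_of_abs_le
      ((abs_sub _ _).trans (add_le_add (abs_avg_le _ hB u) (abs_avg_le _ hB u)))
      ((abs_sub _ _).trans (add_le_add (abs_avg_le _ hA u) (abs_avg_le _ hA u)))
  have hpres := measurePreserving_update_cube k
  rw [integral_congr_ae (ae_mem_Icc_unif.mono fun s hs =>
    integral_blockGrad_mul_blockProj_eq k hf hg hs)]
  simp only [hupdate]
  rw [← integral_prod_symm (f := fun p : (Fin N → ℝ) × ℝ => W (Function.update p.1 k p.2))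
    (hpres.integrable_comp_of_integrable hW_int),
    integral_comp_measurePreserving hpres hW_int.aestronglyMeasurable,
    integral_avg_sub_mul_avg_sub k hfm hA hgm hB]

lemma sum_integral_blockGrad_mul_blockProj (hf : IsBoundedSmooth f) (hg : IsBoundedSmooth g) :
    ∑ k : Fin N, ∫ s, ∫ u, blockGrad k g s u * blockProj k f s u ∂(cube N) ∂unif
      = (∫ u, g u * f u ∂(cube N)) - (∫ u, g u ∂(cube N)) * ∫ u, f u ∂(cube N) := by
  simp only [integral_blockGrad_mul_blockProj _ hf hg]
  rw [Fin.sum_univ_eq_sum_range (fun k => (∫ u, g u * avg (k + 1) f u ∂(cube N))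
      - ∫ u, g u * avg k f u ∂(cube N)) N,
    Finset.sum_range_sub (fun k => ∫ u, g u * avg k f u ∂(cube N))]
  simp only [avg_all, avg_zero, integral_mul_const]

end BlockGradient

/-! ### The filtration of the jump process -/

section Filtration

section CondExp

variable {Ω E : Type*} [NormedAddCommGroup E] [NormedSpace ℝ E] [CompleteSpace E]
  {m m' mΩ : MeasurableSpace Ω} {P : Measure Ω} [IsFiniteMeasure P]

lemma condExp_ae_eq_condExp_sup_of_le_eventuallyMeasurableSpace (hm : m ≤ mΩ) (hm' : m' ≤ mΩ)
    (h : m' ≤ eventuallyMeasurableSpace m (ae P)) {f : Ω → E} (hf : Integrable f P) :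
    P[f | m] =ᵐ[P] P[f | m ⊔ m'] := by
  refine ae_eq_condExp_of_forall_setIntegral_eq (sup_le hm hm') hf
    (fun s _ _ => integrable_condExp.integrableOn) (fun s hs _ => ?_)
    ⟨_, stronglyMeasurable_condExp.mono le_sup_left, ae_eq_rfl⟩
  obtain ⟨t, ht, hst⟩ := sup_le le_eventuallyMeasurableSpace h s hs
  rw [setIntegral_congr_set hst, setIntegral_congr_set hst, setIntegral_condExp hm hf ht]

lemma condExp_congr_of_le_eventuallyMeasurableSpace (hm : m ≤ mΩ) (hm' : m' ≤ mΩ)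
    (h : m' ≤ eventuallyMeasurableSpace m (ae P)) (h' : m ≤ eventuallyMeasurableSpace m' (ae P))
    (f : Ω → E) : P[f | m] =ᵐ[P] P[f | m'] := by
  by_cases hf : Integrable f P
  · have hsup := condExp_ae_eq_condExp_sup_of_le_eventuallyMeasurableSpace hm' hm h' hf
    rw [sup_comm] at hsup
    exact (condExp_ae_eq_condExp_sup_of_le_eventuallyMeasurableSpace hm hm' h hf).trans hsup.symm
  · rw [condExp_of_not_integrable hf, condExp_of_not_integrable hf]

end CondExp

variable {Ω : Type*} {U : ℕ → Ω → ℝ}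

/-- The vector of the first `N` variables. -/
def firstVars (U : ℕ → Ω → ℝ) (N : ℕ) (ω : Ω) : Fin N → ℝ := fun i => U i ω

/-- The σ-algebra generated by the first `k` variables. -/
abbrev pastSigma (U : ℕ → Ω → ℝ) (k : ℕ) : MeasurableSpace Ω :=
  MeasurableSpace.comap (firstVars U k) inferInstance

lemma measurable_pastSigma {j k : ℕ} (hj : j < k) : Measurable[pastSigma U k] (U j) :=
  (measurable_pi_apply (⟨j, hj⟩ : Fin k)).comp (comap_measurable (firstVars U k))

lemma jumpProcess_eq_tsum_ite (s : ℝ) (ω : Ω) :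
    jumpProcess U s ω = ∑' j : ℕ, if 2 * (j : ℝ) + 1 + U j ω ≤ s then 1 else 0 := rfl

lemma measurable_jumpProcess_summand {m : MeasurableSpace Ω} {X : Ω → ℝ} (hX : Measurable X)
    (a s : ℝ) : Measurable fun ω => if a + X ω ≤ s then (1 : ℝ≥0∞) else 0 :=
  Measurable.ite (measurableSet_le (by fun_prop) measurable_const) measurable_const
    measurable_const

lemma jumpProcess_eq_sum {ω : Ω} (hω : ∀ k, U k ω ∈ Set.Ioo (-1 : ℝ) 1) {s : ℝ} {k : ℕ}
    (hs : s ≤ 2 * (k : ℝ)) :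
    jumpProcess U s ω
      = ∑ j ∈ Finset.range k, if 2 * (j : ℝ) + 1 + U j ω ≤ s then 1 else 0 := by
  rw [jumpProcess_eq_tsum_ite]
  refine tsum_eq_sum fun j hj => if_neg (not_le.mpr ?_)
  have hkj : (k : ℝ) ≤ j := by exact_mod_cast not_lt.mp (Finset.mem_range.not.mp hj)
  linarith [(hω j).1]

lemma le_jumpProcess_iff {ω : Ω} (hω : ∀ k, U k ω ∈ Set.Ioo (-1 : ℝ) 1) (j : ℕ) {q : ℝ}
    (hq : q ≤ 1) (hq' : -1 ≤ q) :
    (j : ℝ≥0∞) + 1 ≤ jumpProcess U (2 * (j : ℝ) + 1 + q) ω ↔ U j ω ≤ q := by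
  have hpast : ∀ i ∈ Finset.range j,
      (if 2 * (i : ℝ) + 1 + U i ω ≤ 2 * (j : ℝ) + 1 + q then (1 : ℝ≥0∞) else 0) = 1 :=
    fun i hi => if_pos <| by
      have hij : (i : ℝ) + 1 ≤ j := by exact_mod_cast Finset.mem_range.mp hi
      linarith [(hω i).2]
  rw [jumpProcess_eq_sum hω (k := j + 1) (by push_cast; linarith), Finset.sum_range_succ,
    Finset.sum_congr rfl hpast, Finset.sum_const, Finset.card_range, nsmul_one,
    ENNReal.add_le_add_iff_left (ENNReal.natCast_ne_top j)]
  by_cases h : U j ω ≤ q <;> simp [h]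

lemma measurable_pastSigma_avg_firstVars (U : ℕ → Ω → ℝ) {N : ℕ} (k : ℕ)
    {f : (Fin N → ℝ) → ℝ} (hf : Measurable f) :
    Measurable[pastSigma U k] fun ω => avg k f (firstVars U N ω) := by
  have heq : (fun ω => avg k f (firstVars U N ω))
      = fun ω => avg k f (merge k (firstVars U N ω) 0) := by
    simp only [avg_merge le_rfl]
  rw [heq]
  refine (measurable_avg k hf).comp (@measurable_pi_lambda _ _ _ (pastSigma U k) _ _ fun i => ?_)
  rcases lt_or_ge (i : ℕ) k with hi | hi
  · simpa only [merge_of_lt hi] using! measurable_pastSigma hi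
  · simpa only [merge_of_le hi] using measurable_const

variable [mΩ : MeasurableSpace Ω] {P : Measure Ω}

lemma measurable_firstVars (hU : ∀ k, Measurable (U k)) (N : ℕ) : Measurable (firstVars U N) :=
  measurable_pi_lambda _ fun i => hU i

lemma jumpSigma_le (hU : ∀ k, Measurable (U k)) (t : ℝ) : jumpSigma U t ≤ mΩ :=
  iSup₂_le fun s _ => Measurable.comap_le <|
    Measurable.tsum fun j => measurable_jumpProcess_summand (hU j) _ s

lemma jumpSigma_le_eventually_pastSigma (hU : ∀ᵐ ω ∂P, ∀ k, U k ω ∈ Set.Ioo (-1 : ℝ) 1) (k : ℕ) :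
    jumpSigma U (2 * (k : ℝ)) ≤ eventuallyMeasurableSpace (pastSigma U k) (ae P) := by
  refine iSup₂_le fun s hs => Measurable.comap_le ?_
  have hsum : Measurable[pastSigma U k] fun ω => ∑ j ∈ Finset.range k,
      if 2 * (j : ℝ) + 1 + U j ω ≤ s then (1 : ℝ≥0∞) else 0 :=
    Finset.measurable_fun_sum _ fun j hj =>
      measurable_jumpProcess_summand (measurable_pastSigma (Finset.mem_range.mp hj)) _ s
  exact hsum.eventuallyMeasurable_of_eventuallyEq (hU.mono fun ω h => jumpProcess_eq_sum h hs.2)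

/-- The value of `U j` can be read off the path up to the time `2j + 2`: `U j ≤ q` if and only if
at least `j + 1` jumps occur up to the time `2j + 1 + q`. -/
lemma pastSigma_le_eventually_jumpSigma (hU : ∀ᵐ ω ∂P, ∀ k, U k ω ∈ Set.Ioo (-1 : ℝ) 1) (k : ℕ) :
    pastSigma U k ≤ eventuallyMeasurableSpace (jumpSigma U (2 * (k : ℝ))) (ae P) := by
  refine Measurable.comap_le (@measurable_pi_lambda Ω (Fin k) (fun _ => ℝ)
    (eventuallyMeasurableSpace (jumpSigma U (2 * (k : ℝ))) (ae P)) _ _ fun j =>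
    @measurable_of_Iic ℝ Ω _ _ _ (eventuallyMeasurableSpace (jumpSigma U (2 * (k : ℝ))) (ae P))
      _ _ _ _ fun q => ?_)
  set c : ℝ := max (-1) (min 1 q) with hc
  have hc1 : c ≤ 1 := max_le (by norm_num) (min_le_left _ _)
  have hc1' : -1 ≤ c := le_max_left _ _
  set s : ℝ := 2 * ((j : ℕ) : ℝ) + 1 + c with hs
  have hs_mem : s ∈ Set.Icc 0 (2 * (k : ℝ)) := by
    have : ((j : ℕ) : ℝ) + 1 ≤ k := by exact_mod_cast j.2
    have : (0 : ℝ) ≤ ((j : ℕ) : ℝ) := Nat.cast_nonneg _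
    constructor <;> linarith
  have hmeas : Measurable[jumpSigma U (2 * (k : ℝ))] (jumpProcess U s) :=
    (comap_measurable (jumpProcess U s)).mono
      (le_iSup₂ (f := fun s (_ : s ∈ Set.Icc (0 : ℝ) (2 * (k : ℝ))) =>
        MeasurableSpace.comap (jumpProcess U s) inferInstance) s hs_mem) le_rfl
  refine ⟨jumpProcess U s ⁻¹' Set.Ici ((j : ℕ) + 1 : ℝ≥0∞), hmeas measurableSet_Ici, ?_⟩
  rw [eventuallyEq_set]
  filter_upwards [hU] with ω hω
  have hclip : U j ω ≤ c ↔ U j ω ≤ q := by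
    simp [hc, (hω j).1.not_ge, (hω j).2.le]
  rw [Set.mem_preimage, Set.mem_preimage, Set.mem_Ici, hs, le_jumpProcess_iff hω j hc1 hc1', hclip]
  rfl

/-- The standing assumption: the variables are independent and uniform on `[-1, 1]`. -/
structure IsIIDUniform (U : ℕ → Ω → ℝ) (P : Measure Ω) : Prop where
  measurable : ∀ k, Measurable (U k)
  iIndepFun : iIndepFun U P
  isUniform : ∀ k, pdf.IsUniform (U k) (Set.Icc (-1) 1) P volume

namespace IsIIDUniform

lemma isProbabilityMeasure (hU : IsIIDUniform U P) : IsProbabilityMeasure P :=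
  hU.iIndepFun.isProbabilityMeasure

lemma map_eq_unif (hU : IsIIDUniform U P) (k : ℕ) : P.map (U k) = unif := by
  rw [hU.isUniform k, ProbabilityTheory.cond, unif, Real.volume_Icc]
  norm_num

lemma ae_mem_Ioo (hU : IsIIDUniform U P) : ∀ᵐ ω ∂P, ∀ k, U k ω ∈ Set.Ioo (-1 : ℝ) 1 := by
  refine ae_all_iff.mpr fun k => ae_of_ae_map (hU.measurable k).aemeasurable ?_
  rw [hU.map_eq_unif, unif, ← restrict_Ioo_eq_restrict_Icc]
  exact Measure.ae_smul_measure (ae_restrict_mem measurableSet_Ioo) _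

lemma measurePreserving_firstVars (hU : IsIIDUniform U P) (N : ℕ) :
    MeasurePreserving (firstVars U N) P (cube N) := by
  have := hU.isProbabilityMeasure
  have hmap := (iIndepFun_iff_map_fun_eq_pi_map fun i : Fin N =>
    (hU.measurable i).aemeasurable).mp (hU.iIndepFun.precomp Fin.val_injective)
  simp only [hU.map_eq_unif] at hmap
  exact ⟨measurable_firstVars hU.measurable N, hmap⟩

end IsIIDUniform

lemma setIntegral_avg {N k : ℕ} {f : (Fin N → ℝ) → ℝ} {A : ℝ} (hf : Measurable f)
    (hA : ∀ u, |f u| ≤ A) {s : Set (Fin N → ℝ)} (hs : MeasurableSet s)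
    (hs_merge : ∀ u v, merge k u v ∈ s ↔ u ∈ s) :
    ∫ u in s, avg k f u ∂(cube N) = ∫ u in s, f u ∂(cube N) := by
  have hind : ∀ g : (Fin N → ℝ) → ℝ, s.indicator g
      = fun u => g u * s.indicator (fun _ => 1) u := fun g => by
    funext u
    by_cases hu : u ∈ s <;> simp [hu]
  rw [← integral_indicator hs, ← integral_indicator hs, hind, hind f]
  refine (integral_mul_eq_integral_avg_mul (B := 1) hf hA (measurable_const.indicator hs)
    (fun u => ?_) fun u v => ?_).symm
  · by_cases hu : u ∈ s <;> simp [hu]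
  · by_cases hu : u ∈ s <;> simp [Set.indicator, hs_merge u v, hu]

lemma IsIIDUniform.condExp_pastSigma (hU : IsIIDUniform U P) {N k : ℕ}
    (hk : k ≤ N) {f : (Fin N → ℝ) → ℝ} {A : ℝ} (hf : Measurable f) (hA : ∀ u, |f u| ≤ A) :
    (fun ω => avg k f (firstVars U N ω)) =ᵐ[P] P[fun ω => f (firstVars U N ω) | pastSigma U k] := by
  have := hU.isProbabilityMeasure
  have hvars := measurable_firstVars hU.measurable N
  refine ae_eq_condExp_of_forall_setIntegral_eq (measurable_firstVars hU.measurable k).comap_le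
    (integrable_of_abs_le (hf.comp hvars) fun _ => hA _)
    (fun s _ _ => (integrable_of_abs_le ((measurable_avg k hf).comp hvars)
      fun _ => abs_avg_le k hA _).integrableOn) ?_
    (measurable_pastSigma_avg_firstVars U k hf).aestronglyMeasurable
  rintro _ ⟨B, hB, rfl⟩ -
  set B' : Set (Fin N → ℝ) := (fun u (i : Fin k) => u (Fin.castLE hk i)) ⁻¹' B with hB'
  have hB'_meas : MeasurableSet B' := measurableSet_preimage (by fun_prop) hB
  have hB'_merge : ∀ u v, merge k u v ∈ B' ↔ u ∈ B' := fun u v => by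
    simp [hB', merge_of_lt]
  have hpres := (hU.measurePreserving_firstVars N).restrict_preimage hB'_meas
  calc ∫ ω in firstVars U N ⁻¹' B', avg k f (firstVars U N ω) ∂P
      = ∫ u in B', avg k f u ∂(cube N) :=
        integral_comp_measurePreserving hpres (measurable_avg k hf).aestronglyMeasurable
    _ = ∫ u in B', f u ∂(cube N) := setIntegral_avg hf hA hB'_meas hB'_merge
    _ = ∫ ω in firstVars U N ⁻¹' B', f (firstVars U N ω) ∂P :=
        (integral_comp_measurePreserving hpres hf.aestronglyMeasurable).symm

lemma IsIIDUniform.condExp_jumpSigma (hU : IsIIDUniform U P) {N k : ℕ}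
    (hk : k ≤ N) {f : (Fin N → ℝ) → ℝ} {A : ℝ} (hf : Measurable f) (hA : ∀ u, |f u| ≤ A) :
    (fun ω => avg k f (firstVars U N ω)) =ᵐ[P]
      P[fun ω => f (firstVars U N ω) | jumpSigma U (2 * (k : ℝ))] :=
  have := hU.isProbabilityMeasure
  (hU.condExp_pastSigma hk hf hA).trans <|
    condExp_congr_of_le_eventuallyMeasurableSpace
      (measurable_firstVars hU.measurable k).comap_le (jumpSigma_le hU.measurable _)
      (jumpSigma_le_eventually_pastSigma hU.ae_mem_Ioo k)
      (pastSigma_le_eventually_jumpSigma hU.ae_mem_Ioo k) _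

end Filtration

/-! ### Processes given by functions on the blocks -/

section BlockProcesses

instance : SigmaFinite halfLine := by unfold halfLine; infer_instance

/-- The `k`-th block of time, without its endpoints. -/
def block (k : ℕ) : Set ℝ := Set.Ioo (2 * (k : ℝ)) (2 * (k : ℝ) + 2)

lemma measurableSet_block (k : ℕ) : MeasurableSet (block k) := measurableSet_Ioo

lemma halfLine_restrict_block (k : ℕ) :
    halfLine.restrict (block k) = volume.restrict (block k) := by
  rw [halfLine, Measure.restrict_restrict_of_subset]
  exact fun t ht => (by positivity : (0 : ℝ) ≤ 2 * k).trans ht.1.le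

instance (k : ℕ) : IsFiniteMeasure (halfLine.restrict (block k)) := by
  rw [halfLine_restrict_block, block]
  infer_instance

lemma ae_halfLine_ne : ∀ᵐ t ∂halfLine, ∀ k : ℕ, t ≠ 2 * (k : ℝ) :=
  ae_all_iff.mpr fun _ => ae_restrict_of_ae (Measure.ae_ne volume _)

lemma ae_halfLine_nonneg : ∀ᵐ t ∂halfLine, 0 ≤ t := ae_restrict_mem measurableSet_Ici

lemma mem_block_floor {t : ℝ} (ht : 0 ≤ t) (hne : ∀ k : ℕ, t ≠ 2 * (k : ℝ)) :
    t ∈ block ⌊t / 2⌋₊ := by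
  have hle := Nat.floor_le (show 0 ≤ t / 2 by linarith)
  have hlt := Nat.lt_floor_add_one (t / 2)
  exact ⟨lt_of_le_of_ne (by linarith) (hne _).symm, by linarith⟩

lemma block_unique {t : ℝ} {j k : ℕ} (hj : t ∈ block j) (hk : t ∈ block k) : j = k := by
  have hjk : (j : ℝ) < (k : ℝ) + 1 := by linarith [hj.1, hk.2]
  have hkj : (k : ℝ) < (j : ℝ) + 1 := by linarith [hj.2, hk.1]
  norm_cast at hjk hkj
  omega

lemma setIntegral_block (φ : ℝ → ℝ) (k : ℕ) :
    ∫ t in block k, φ (t - 2 * (k : ℝ) - 1) ∂halfLine = 2 * ∫ s, φ s ∂unif := by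
  rw [halfLine_restrict_block, block, ← integral_Ioc_eq_integral_Ioo,
    ← intervalIntegral.integral_of_le (by linarith), integral_unif]
  simp only [sub_sub]
  rw [intervalIntegral.integral_comp_sub_right]
  ring_nf

variable {Ω : Type*} {U : ℕ → Ω → ℝ} {N : ℕ}

/-- The process which is `a (t - 2k - 1) (U₀, …, U_{N-1})` for `t` in the `k`-th block and vanishes
outside of it. -/
def blockTerm (U : ℕ → Ω → ℝ) (k : ℕ) (a : ℝ → (Fin N → ℝ) → ℝ) (p : Ω × ℝ) : ℝ :=
  (block k).indicator (fun t => a (t - 2 * (k : ℝ) - 1) (firstVars U N p.1)) p.2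

/-- The process which is `a k (t - 2k - 1) (U₀, …, U_{N-1})` for `t` in the `k`-th block. -/
def blockProcess (U : ℕ → Ω → ℝ) (a : Fin N → ℝ → (Fin N → ℝ) → ℝ) (p : Ω × ℝ) : ℝ :=
  ∑ k : Fin N, blockTerm U k (a k) p

lemma blockProcess_of_mem (a : Fin N → ℝ → (Fin N → ℝ) → ℝ) {k : Fin N} (ω : Ω) {t : ℝ}
    (ht : t ∈ block k) :
    blockProcess U a (ω, t) = a k (t - 2 * ((k : ℕ) : ℝ) - 1) (firstVars U N ω) := by
  rw [blockProcess, Finset.sum_eq_single_of_mem k (Finset.mem_univ k)]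
  · exact Set.indicator_of_mem ht _
  · exact fun j _ hj => Set.indicator_of_notMem (fun h => hj (Fin.ext (block_unique h ht))) _

lemma blockProcess_of_notMem (a : Fin N → ℝ → (Fin N → ℝ) → ℝ) (ω : Ω) {t : ℝ}
    (ht : ∀ k : Fin N, t ∉ block k) : blockProcess U a (ω, t) = 0 :=
  Finset.sum_eq_zero fun k _ => Set.indicator_of_notMem (ht k) _

lemma blockProcess_mul (a b : Fin N → ℝ → (Fin N → ℝ) → ℝ) (p : Ω × ℝ) :
    blockProcess U a p * blockProcess U b p
      = blockProcess U (fun k s u => a k s u * b k s u) p := by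
  obtain ⟨ω, t⟩ := p
  by_cases h : ∃ k : Fin N, t ∈ block k
  · obtain ⟨k, hk⟩ := h
    simp only [blockProcess_of_mem _ _ hk]
  · push Not at h
    simp only [blockProcess_of_notMem _ _ h, mul_zero]

/-- The gradient of `f(U₀, …, U_{N-1})`. -/
def gradProcess (U : ℕ → Ω → ℝ) (f : (Fin N → ℝ) → ℝ) : Ω × ℝ → ℝ :=
  blockProcess U fun k => blockGrad k f

/-- The conditional expectation process of the gradient of `f(U₀, …, U_{N-1})`; see
`IsIIDUniform.isCondExpProcess_gradProcess`. -/
def projProcess (U : ℕ → Ω → ℝ) (f : (Fin N → ℝ) → ℝ) : Ω × ℝ → ℝ :=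
  blockProcess U fun k => blockProj k f

section Chain

variable {f : (Fin N → ℝ) → ℝ} {φ : ℝ → ℝ}

lemma partialDeriv_comp (hf : Differentiable ℝ f) (hφ : Differentiable ℝ φ) (k : Fin N)
    (u : Fin N → ℝ) :
    partialDeriv k (fun u => φ (f u)) u = deriv φ (f u) * partialDeriv k f u := by
  have hcomp := (hφ (f u)).hasDerivAt.comp_hasFDerivAt u (hf u).hasFDerivAt
  rw [partialDeriv, show (fun u => φ (f u)) = φ ∘ f from rfl, hcomp.fderiv]
  rfl

lemma gradProcess_comp (hf : Differentiable ℝ f) (hφ : Differentiable ℝ φ) (p : Ω × ℝ) :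
    gradProcess U (fun u => φ (f u)) p = deriv φ (f (firstVars U N p.1)) * gradProcess U f p := by
  simp only [gradProcess, blockProcess, blockTerm, blockGrad, partialDeriv_comp hf hφ,
    Finset.mul_sum, mul_assoc]
  refine Finset.sum_congr rfl fun k _ => ?_
  by_cases h : p.2 ∈ block k <;> simp [h]

lemma IsBoundedSmooth.comp (hf : IsBoundedSmooth f) (hφ : ContDiff ℝ 1 φ) :
    IsBoundedSmooth fun u => φ (f u) := by
  obtain ⟨A, hA⟩ := hf.exists_bound
  obtain ⟨B, hB⟩ := hf.exists_partialDeriv_bound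
  have hmem : ∀ u, f u ∈ Set.Icc (-A) A := fun u => abs_le.mp (hA u)
  obtain ⟨K, hK⟩ := isCompact_Icc.exists_bound_of_continuousOn hφ.continuous.continuousOn
  obtain ⟨K', hK'⟩ := isCompact_Icc.exists_bound_of_continuousOn
    hφ.continuous_deriv_one.continuousOn
  refine ⟨hφ.comp hf.smooth, ⟨K, fun u => hK _ (hmem u)⟩, ⟨K' * B, fun u k => ?_⟩⟩
  rw [partialDeriv_comp hf.smooth.differentiable_one hφ.differentiable_one]
  exact abs_mul_le_mul_of_abs_le (hK' _ (hmem u)) (hB u k)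

lemma isBoundedSmooth_of_hasCompactSupport (hf : ContDiff ℝ 1 f) (hsupp : HasCompactSupport f) :
    IsBoundedSmooth f := by
  obtain ⟨C, hC⟩ := (hf.continuous_fderiv one_ne_zero).bounded_above_of_compact_support
    (hsupp.fderiv ℝ)
  refine ⟨hf, hf.continuous.bounded_above_of_compact_support hsupp, C, fun u k => ?_⟩
  have hnorm : ‖(Pi.single k 1 : Fin N → ℝ)‖ ≤ 1 := by rw [Pi.norm_single, norm_one]
  exact ((fderiv ℝ f u).unit_le_opNorm _ hnorm).trans (hC u)

lemma exists_isBoundedSmooth_eventuallyEq (hf : ContDiff ℝ 1 f) :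
    ∃ g : (Fin N → ℝ) → ℝ, IsBoundedSmooth g ∧
      ∀ u, (∀ i, u i ∈ Set.Ioo (-1 : ℝ) 1) → g =ᶠ[𝓝 u] f := by
  let b : ContDiffBump (0 : Fin N → ℝ) := ⟨1, 2, one_pos, by norm_num⟩
  refine ⟨fun u => b u * f u, isBoundedSmooth_of_hasCompactSupport (b.contDiff.mul hf)
    b.hasCompactSupport.mul_right, fun u hu => ?_⟩
  have hball : u ∈ Metric.ball (0 : Fin N → ℝ) 1 := by
    rw [mem_ball_zero_iff, pi_norm_lt_iff one_pos]
    exact fun i => abs_lt.mpr (hu i)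
  filter_upwards [Metric.isOpen_ball.mem_nhds hball] with v hv
  rw [b.one_of_mem_closedBall (Metric.ball_subset_closedBall hv), one_mul]

end Chain

variable [MeasurableSpace Ω] {P : Measure Ω}

section FiniteMeasure

variable [IsFiniteMeasure P]

lemma memLp_blockTerm (hU : ∀ k, Measurable (U k)) (k : ℕ) {a : ℝ → (Fin N → ℝ) → ℝ} {C : ℝ}
    (ha : Measurable fun p : (Fin N → ℝ) × ℝ => a p.2 p.1) (hC : ∀ s u, |a s u| ≤ C) (q : ℝ≥0∞) :
    MemLp (blockTerm U k a) q (P.prod halfLine) := by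
  have hind : blockTerm U k a = (Set.univ ×ˢ block k).indicator
      fun p => a (p.2 - 2 * (k : ℝ) - 1) (firstVars U N p.1) := by
    funext p
    by_cases h : p.2 ∈ block k <;> simp [blockTerm, Set.indicator, h]
  rw [hind, memLp_indicator_iff_restrict (MeasurableSet.univ.prod (measurableSet_block k)),
    ← Measure.prod_restrict]
  refine MemLp.of_bound ?_ C (Eventually.of_forall fun p => hC _ _)
  exact (ha.comp (((measurable_firstVars hU N).comp measurable_fst).prodMk
    (by fun_prop))).aestronglyMeasurable

lemma memLp_blockProcess (hU : ∀ k, Measurable (U k)) {a : Fin N → ℝ → (Fin N → ℝ) → ℝ} {C : ℝ}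
    (ha : ∀ k, Measurable fun p : (Fin N → ℝ) × ℝ => a k p.2 p.1)
    (hC : ∀ k s u, |a k s u| ≤ C) (q : ℝ≥0∞) :
    MemLp (blockProcess U a) q (P.prod halfLine) :=
  memLp_finsetSum _ fun k _ => memLp_blockTerm hU k (ha k) (hC k) q

variable {f : (Fin N → ℝ) → ℝ}

lemma memLp_gradProcess (hU : ∀ k, Measurable (U k)) (hf : IsBoundedSmooth f) (q : ℝ≥0∞) :
    MemLp (gradProcess U f) q (P.prod halfLine) := by
  obtain ⟨C, hC⟩ := hf.exists_partialDeriv_bound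
  exact memLp_blockProcess hU (fun k => measurable_blockGrad k hf.smooth)
    (fun k => abs_blockGrad_le k fun u => hC u k) q

lemma memLp_projProcess (hU : ∀ k, Measurable (U k)) (hf : IsBoundedSmooth f) (q : ℝ≥0∞) :
    MemLp (projProcess U f) q (P.prod halfLine) := by
  obtain ⟨C, hC⟩ := hf.exists_bound
  exact memLp_blockProcess hU (fun k => measurable_blockProj k hf.smooth.continuous.measurable)
    (fun k => abs_blockProj_le k hC) q

end FiniteMeasure

namespace IsIIDUniform

lemma integral_blockTerm (hU : IsIIDUniform U P) (k : ℕ) {a : ℝ → (Fin N → ℝ) → ℝ} {C : ℝ}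
    (ha : Measurable fun p : (Fin N → ℝ) × ℝ => a p.2 p.1) (hC : ∀ s u, |a s u| ≤ C) :
    ∫ p, blockTerm U k a p ∂(P.prod halfLine) = 2 * ∫ s, ∫ u, a s u ∂(cube N) ∂unif := by
  have := hU.isProbabilityMeasure
  have hmean : ∀ t, ∫ ω, blockTerm U k a (ω, t) ∂P
      = (block k).indicator (fun t => ∫ u, a (t - 2 * (k : ℝ) - 1) u ∂(cube N)) t := fun t => by
    by_cases h : t ∈ block k
    · simpa only [blockTerm, Set.indicator_of_mem h, Function.comp_def] using
        integral_comp_measurePreserving (hU.measurePreserving_firstVars N)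
          (ha.comp measurable_prodMk_right).aestronglyMeasurable
    · simp [blockTerm, h]
  rw [integral_prod_symm _
    (memLp_one_iff_integrable.mp (memLp_blockTerm hU.measurable k ha hC 1))]
  simp only [hmean]
  rw [integral_indicator (measurableSet_block k),
    setIntegral_block fun s => ∫ u, a s u ∂(cube N)]

lemma integral_blockProcess (hU : IsIIDUniform U P) {a : Fin N → ℝ → (Fin N → ℝ) → ℝ} {C : ℝ}
    (ha : ∀ k, Measurable fun p : (Fin N → ℝ) × ℝ => a k p.2 p.1)
    (hC : ∀ k s u, |a k s u| ≤ C) :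
    ∫ p, blockProcess U a p ∂(P.prod halfLine)
      = 2 * ∑ k, ∫ s, ∫ u, a k s u ∂(cube N) ∂unif := by
  have := hU.isProbabilityMeasure
  simp only [blockProcess]
  rw [integral_finsetSum _ fun (k : Fin N) _ =>
    memLp_one_iff_integrable.mp (memLp_blockTerm hU.measurable k (ha k) (hC k) 1)]
  simp only [hU.integral_blockTerm _ (ha _) (hC _), Finset.mul_sum]

variable {f g : (Fin N → ℝ) → ℝ}

lemma isCondExpProcess_gradProcess (hU : IsIIDUniform U P) (hf : IsBoundedSmooth f) :
    IsCondExpProcess U P (gradProcess U f) (projProcess U f) := by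
  have := hU.isProbabilityMeasure
  refine ⟨(memLp_projProcess hU.measurable hf 1).1, ?_⟩
  filter_upwards [ae_halfLine_ne, ae_halfLine_nonneg] with t hne h0
  have hmem := mem_block_floor h0 hne
  by_cases hN : ⌊t / 2⌋₊ < N
  · set k : Fin N := ⟨⌊t / 2⌋₊, hN⟩
    have hk : t ∈ block k := hmem
    have hs : t - 2 * ((k : ℕ) : ℝ) - 1 ∈ Set.Icc (-1 : ℝ) 1 :=
      ⟨by linarith [hk.1], by linarith [hk.2]⟩
    obtain ⟨C, hC⟩ := hf.exists_partialDeriv_bound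
    simp only [gradProcess, projProcess, blockProcess_of_mem _ _ hk, ← avg_blockGrad k hf hs]
    exact hU.condExp_jumpSigma hN.le
      ((measurable_blockGrad k hf.smooth).comp measurable_prodMk_right)
      (abs_blockGrad_le k (fun u => hC u k) _)
  · have hout : ∀ k : Fin N, t ∉ block k := fun k h => hN ((block_unique hmem h).symm ▸ k.2)
    simp only [gradProcess, projProcess, blockProcess_of_notMem _ _ hout]
    exact (condExp_const (jumpSigma_le hU.measurable _) (0 : ℝ)).symm.eventuallyEq

lemma integral_gradProcess_mul_projProcess (hU : IsIIDUniform U P) (hf : IsBoundedSmooth f)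
    (hg : IsBoundedSmooth g) :
    ∫ p, gradProcess U g p * projProcess U f p ∂(P.prod halfLine)
      = 2 * ((∫ ω, g (firstVars U N ω) * f (firstVars U N ω) ∂P)
        - (∫ ω, g (firstVars U N ω) ∂P) * ∫ ω, f (firstVars U N ω) ∂P) := by
  obtain ⟨A, hA⟩ := hf.exists_bound
  obtain ⟨B, hB⟩ := hg.exists_partialDeriv_bound
  have hfm := hf.smooth.continuous.measurable
  have hgm := hg.smooth.continuous.measurable
  have hpres := hU.measurePreserving_firstVars N
  simp only [gradProcess, projProcess, blockProcess_mul]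
  rw [hU.integral_blockProcess
      (fun k => (measurable_blockGrad k hg.smooth).mul (measurable_blockProj k hfm))
      (fun k s u => abs_mul_le_mul_of_abs_le (abs_blockGrad_le k (fun u => hB u k) s u)
        (abs_blockProj_le k hA s u)),
    sum_integral_blockGrad_mul_blockProj hf hg,
    ← integral_comp_measurePreserving hpres (f := fun u => g u * f u)
      (hgm.mul hfm).aestronglyMeasurable,
    ← integral_comp_measurePreserving hpres hfm.aestronglyMeasurable,
    ← integral_comp_measurePreserving hpres hgm.aestronglyMeasurable]

lemma integral_deriv_mul_gradProcess_mul_projProcess (hU : IsIIDUniform U P)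
    (hf : IsBoundedSmooth f) {φ : ℝ → ℝ} (hφ : ContDiff ℝ 1 φ) :
    ∫ p, deriv φ (f (firstVars U N p.1)) * (gradProcess U f p * projProcess U f p)
        ∂(P.prod halfLine)
      = 2 * ((∫ ω, φ (f (firstVars U N ω)) * f (firstVars U N ω) ∂P)
        - (∫ ω, φ (f (firstVars U N ω)) ∂P) * ∫ ω, f (firstVars U N ω) ∂P) := by
  rw [← hU.integral_gradProcess_mul_projProcess hf (hf.comp hφ)]
  simp only [gradProcess_comp hf.smooth.differentiable_one hφ.differentiable_one, mul_assoc]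

end IsIIDUniform

lemma indicator_sub_indicator_eq_blockKernel {x t : ℝ} (hx : x ∈ Set.Ioo (-1 : ℝ) 1) (k : ℕ)
    (ht : t ≠ 2 * (k : ℝ) + 2) :
    (Set.Ioc (2 * (k : ℝ)) (2 * (k : ℝ) + 1 + x)).indicator (fun _ => 1 - x) t
        - (Set.Ioc (2 * (k : ℝ) + 1 + x) (2 * (k : ℝ) + 2)).indicator (fun _ => 1 + x) t
      = (block k).indicator (fun t => blockKernel (t - 2 * (k : ℝ) - 1) x) t := by
  have ht' : t < 2 * (k : ℝ) + 2 ∨ 2 * (k : ℝ) + 2 < t := lt_or_gt_of_ne ht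
  simp only [Set.indicator, Set.mem_Ioc, Set.mem_Ioo, block, blockKernel] at hx ⊢
  grind

/-- A cylindrical functional only depends on the values of its function on the cube, hence the
function can be cut off outside of it. -/
lemma IsIIDUniform.exists_isBoundedSmooth (hU : IsIIDUniform U P) (F : SmoothFunctional) :
    ∃ g : (Fin (F.n + 1) → ℝ) → ℝ, IsBoundedSmooth g ∧
      F.eval U =ᵐ[P] (fun ω => g (firstVars U (F.n + 1) ω)) ∧
      F.grad U =ᵐ[P.prod halfLine] gradProcess U g := by
  have := hU.isProbabilityMeasure
  obtain ⟨g, hg, hgF⟩ := exists_isBoundedSmooth_eventuallyEq F.smooth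
  refine ⟨g, hg, hU.ae_mem_Ioo.mono fun ω hω => (hgF _ fun i => hω i).eq_of_nhds.symm, ?_⟩
  filter_upwards [Measure.quasiMeasurePreserving_fst.ae hU.ae_mem_Ioo,
    Measure.quasiMeasurePreserving_snd.ae ae_halfLine_ne] with p hp hne
  refine Finset.sum_congr rfl fun k _ => ?_
  have hfderiv : fderiv ℝ F.f (fun i => U i p.1) = fderiv ℝ g (firstVars U (F.n + 1) p.1) :=
    (hgF (firstVars U (F.n + 1) p.1) fun i => hp i).fderiv_eq.symm
  have hclip : max (-1) (min 1 (firstVars U (F.n + 1) p.1 k)) = U k p.1 := by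
    rw [firstVars, min_eq_right (hp k).2.le, max_eq_right (hp k).1.le]
  have hend : p.2 ≠ 2 * ((k : ℕ) : ℝ) + 2 := by
    have := hne (k + 1)
    push_cast at this
    rwa [mul_add, mul_one] at this
  rw [hfderiv, indicator_sub_indicator_eq_blockKernel (hp k) k hend]
  by_cases h : p.2 ∈ block k <;> simp [blockTerm, blockGrad, partialDeriv, h, hclip]

end BlockProcesses

/-! ### Passage to the limit in integrals of products -/

section Products

variable {α ι : Type*} {mα : MeasurableSpace α} {μ : Measure α} {l : Filter ι}

lemma tendsto_eLpNorm_mul_sub {p q r : ℝ≥0∞} [ENNReal.HolderTriple p q r] (hr : 1 ≤ r)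
    {u v : α → ℝ} {us vs : ι → α → ℝ} (hu : MemLp u p μ) (hv : MemLp v q μ)
    (hus : ∀ i, MemLp (us i) p μ) (hvs : ∀ i, MemLp (vs i) q μ)
    (hu_lim : Tendsto (fun i => eLpNorm (us i - u) p μ) l (𝓝 0))
    (hv_lim : Tendsto (fun i => eLpNorm (vs i - v) q μ) l (𝓝 0)) :
    Tendsto (fun i => eLpNorm (us i * vs i - u * v) r μ) l (𝓝 0) := by
  have hlim : Tendsto (fun i => eLpNorm (us i - u) p μ * eLpNorm (vs i - v) q μ
      + eLpNorm (us i - u) p μ * eLpNorm v q μ + eLpNorm u p μ * eLpNorm (vs i - v) q μ) l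
      (𝓝 0) := by
    have hprod := ENNReal.Tendsto.mul hu_lim (.inr ENNReal.zero_ne_top) hv_lim
      (.inr ENNReal.zero_ne_top)
    simpa using (hprod.add (ENNReal.Tendsto.mul_const hu_lim (.inr hv.2.ne))).add
      (ENNReal.Tendsto.const_mul hv_lim (.inr hu.2.ne))
  refine tendsto_nhds_bot_mono' hlim fun i => ?_
  have hdu := ((hus i).sub hu).1
  have hdv := ((hvs i).sub hv).1
  calc eLpNorm (us i * vs i - u * v) r μ
      = eLpNorm ((us i - u) • (vs i - v) + (us i - u) • v + u • (vs i - v)) r μ := by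
        simp only [smul_eq_mul]
        ring_nf
    _ ≤ eLpNorm ((us i - u) • (vs i - v)) r μ + eLpNorm ((us i - u) • v) r μ
          + eLpNorm (u • (vs i - v)) r μ :=
        (eLpNorm_add_le ((hdu.smul hdv).add (hdu.smul hv.1)) (hu.1.smul hdv) hr).trans
          (add_le_add_left (eLpNorm_add_le (hdu.smul hdv) (hdu.smul hv.1) hr) _)
    _ ≤ _ := by
        gcongr
        exacts [eLpNorm_smul_le_mul_eLpNorm hdv hdu, eLpNorm_smul_le_mul_eLpNorm hv.1 hdu,
          eLpNorm_smul_le_mul_eLpNorm hdv hu.1]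

lemma tendsto_integral_mul {p q : ℝ≥0∞} [ENNReal.HolderTriple p q 1]
    {u v : α → ℝ} {us vs : ι → α → ℝ} (hu : MemLp u p μ) (hv : MemLp v q μ)
    (hus : ∀ i, MemLp (us i) p μ) (hvs : ∀ i, MemLp (vs i) q μ)
    (hu_lim : Tendsto (fun i => eLpNorm (us i - u) p μ) l (𝓝 0))
    (hv_lim : Tendsto (fun i => eLpNorm (vs i - v) q μ) l (𝓝 0)) :
    Tendsto (fun i => ∫ x, us i x * vs i x ∂μ) l (𝓝 (∫ x, u x * v x ∂μ)) :=
  tendsto_integral_of_L1' _ (hu.1.mul hv.1)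
    (.of_forall fun i => memLp_one_iff_integrable.mp ((hvs i).mul (hus i)))
    (tendsto_eLpNorm_mul_sub le_rfl hu hv hus hvs hu_lim hv_lim)

lemma tendsto_integral_of_tendsto_eLpNorm [IsProbabilityMeasure μ] {p : ℝ≥0∞} (hp : 1 ≤ p)
    {u : α → ℝ} {us : ι → α → ℝ} (hu : MemLp u p μ) (hus : ∀ i, MemLp (us i) p μ)
    (h : Tendsto (fun i => eLpNorm (us i - u) p μ) l (𝓝 0)) :
    Tendsto (fun i => ∫ x, us i x ∂μ) l (𝓝 (∫ x, u x ∂μ)) :=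
  tendsto_integral_of_L1' _ hu.1 (.of_forall fun i => (hus i).integrable hp)
    (tendsto_nhds_bot_mono' h fun i =>
      eLpNorm_le_eLpNorm_of_exponent_le hp ((hus i).sub hu).1)

lemma tendsto_integral_bdd_mul {b w : α → ℝ} {bs ws : ℕ → α → ℝ} {K : ℝ}
    (hbs : ∀ n, AEStronglyMeasurable (bs n) μ) (hK : ∀ n x, |bs n x| ≤ K)
    (hb_lim : ∀ᵐ x ∂μ, Tendsto (fun n => bs n x) atTop (𝓝 (b x)))
    (hw : Integrable w μ) (hws : ∀ n, Integrable (ws n) μ)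
    (hw_lim : Tendsto (fun n => eLpNorm (ws n - w) 1 μ) atTop (𝓝 0)) :
    Tendsto (fun n => ∫ x, bs n x * ws n x ∂μ) atTop (𝓝 (∫ x, b x * w x ∂μ)) := by
  have hint : ∀ n {f : α → ℝ}, Integrable f μ → Integrable (fun x => bs n x * f x) μ :=
    fun n f hf => hf.bdd_mul (hbs n) (.of_forall (hK n))
  have hmain : Tendsto (fun n => ∫ x, bs n x * w x ∂μ) atTop (𝓝 (∫ x, b x * w x ∂μ)) := by
    refine tendsto_integral_of_dominated_convergence (fun x => K * |w x|)
      (fun n => (hint n hw).1) (hw.abs.const_mul K) (fun n => .of_forall fun x => ?_) ?_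
    · rw [norm_mul]
      exact mul_le_mul_of_nonneg_right (hK n x) (norm_nonneg _)
    · filter_upwards [hb_lim] with x hx using hx.mul_const _
  have herror : Tendsto (fun n => ∫ x, bs n x * (ws n - w) x ∂μ) atTop (𝓝 0) := by
    have hlim := ENNReal.Tendsto.const_mul (a := ENNReal.ofReal K) hw_lim
      (.inr ENNReal.ofReal_ne_top)
    rw [mul_zero] at hlim
    have hL1 : Tendsto (fun n => eLpNorm
        ((fun x => bs n x * (ws n - w) x) - fun _ => 0) 1 μ) atTop (𝓝 0) := by
      refine tendsto_nhds_bot_mono' hlim fun n => eLpNorm_le_mul_eLpNorm_of_ae_le_mul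
        (.of_forall fun x => ?_) 1
      rw [Pi.sub_apply, sub_zero, norm_mul]
      exact mul_le_mul_of_nonneg_right (hK n x) (norm_nonneg _)
    simpa using tendsto_integral_of_L1' (fun _ => (0 : ℝ)) aestronglyMeasurable_const
      (.of_forall fun n => hint n ((hws n).sub hw)) hL1
  have hsplit := herror.add hmain
  rw [zero_add] at hsplit
  refine hsplit.congr fun n => ?_
  rw [← integral_add (hint n ((hws n).sub hw)) (hint n hw)]
  congr with x
  rw [Pi.sub_apply]
  ring

lemma tendsto_eLpNorm_comp_sub {p : ℝ≥0∞} {φ : ℝ → ℝ} {K : NNReal} (hφ : LipschitzWith K φ)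
    {u : α → ℝ} {us : ι → α → ℝ} (h : Tendsto (fun i => eLpNorm (us i - u) p μ) l (𝓝 0)) :
    Tendsto (fun i => eLpNorm ((fun x => φ (us i x)) - fun x => φ (u x)) p μ) l (𝓝 0) := by
  have hlim := ENNReal.Tendsto.const_mul (a := ENNReal.ofReal K) h (.inr ENNReal.ofReal_ne_top)
  rw [mul_zero] at hlim
  exact tendsto_nhds_bot_mono' hlim fun i => eLpNorm_le_mul_eLpNorm_of_ae_le_mul
    (.of_forall fun x => hφ.dist_le_mul (us i x) (u x)) p

end Products

/-! ### Slices of square-integrable functions on a product -/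

section Slices

variable {α β : Type*} {mα : MeasurableSpace α} {mβ : MeasurableSpace β} {μ : Measure α}

lemma sq_eLpNorm_eq_lintegral (f : α → ℝ) :
    eLpNorm f 2 μ ^ 2 = ∫⁻ x, ‖f x‖ₑ ^ 2 ∂μ := by
  simpa using eLpNorm_nnreal_pow_eq_lintegral (μ := μ) (f := f) (p := 2) two_ne_zero

variable {ν : Measure β} [SFinite μ]

lemma aemeasurable_sq_eLpNorm_slice [SFinite ν] {f : α × β → ℝ}
    (hf : AEStronglyMeasurable f (μ.prod ν)) :
    AEMeasurable (fun t => eLpNorm (fun x => f (x, t)) 2 μ ^ 2) ν := by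
  simp only [sq_eLpNorm_eq_lintegral]
  exact (hf.enorm.pow_const 2).lintegral_prod_left'

variable [SFinite ν]

lemma sq_eLpNorm_prod {f : α × β → ℝ} (hf : AEStronglyMeasurable f (μ.prod ν)) :
    eLpNorm f 2 (μ.prod ν) ^ 2 = ∫⁻ t, eLpNorm (fun x => f (x, t)) 2 μ ^ 2 ∂ν := by
  simp only [sq_eLpNorm_eq_lintegral]
  exact lintegral_prod_symm _ (hf.enorm.pow_const 2)

lemma ae_memLp_slice {f : α × β → ℝ} (hf : MemLp f 2 (μ.prod ν)) :
    ∀ᵐ t ∂ν, MemLp (fun x => f (x, t)) 2 μ := by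
  have hfin : ∫⁻ t, eLpNorm (fun x => f (x, t)) 2 μ ^ 2 ∂ν ≠ ∞ :=
    sq_eLpNorm_prod hf.1 ▸ ENNReal.pow_ne_top hf.2.ne
  filter_upwards [ae_lt_top' (aemeasurable_sq_eLpNorm_slice hf.1) hfin, hf.1.prodMk_right]
    with t ht hmeas
  exact ⟨hmeas, lt_top_iff_ne_top.mpr fun htop => by simp [htop] at ht⟩

lemma exists_seq_tendsto_eLpNorm_slice {fs : ℕ → α × β → ℝ}
    (hfs : ∀ n, AEStronglyMeasurable (fs n) (μ.prod ν))
    (h : Tendsto (fun n => eLpNorm (fs n) 2 (μ.prod ν)) atTop (𝓝 0)) :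
    ∃ ns : ℕ → ℕ, StrictMono ns ∧ ∀ᵐ t ∂ν,
      Tendsto (fun n => eLpNorm (fun x => fs (ns n) (x, t)) 2 μ) atTop (𝓝 0) := by
  have hsq : Tendsto (fun n => eLpNorm (fs n) 2 (μ.prod ν) ^ 2) atTop (𝓝 0) := by
    simpa using ENNReal.Tendsto.pow (n := 2) h
  have hpos : 0 < (2 : ℝ≥0∞)⁻¹ := ENNReal.inv_pos.mpr ENNReal.ofNat_ne_top
  obtain ⟨ns, hns, hle⟩ := extraction_forall_of_eventually fun k : ℕ =>
    hsq.eventually_le_const (ENNReal.pow_pos hpos k)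
  refine ⟨ns, hns, ?_⟩
  have hmeas := fun n => aemeasurable_sq_eLpNorm_slice (hfs (ns n))
  have hsum : ∫⁻ t, ∑' n, eLpNorm (fun x => fs (ns n) (x, t)) 2 μ ^ 2 ∂ν ≠ ∞ := by
    rw [lintegral_tsum hmeas]
    refine ne_top_of_le_ne_top ?_ (ENNReal.tsum_le_tsum fun n =>
      (sq_eLpNorm_prod (hfs (ns n))).symm.trans_le (hle n))
    simp [ENNReal.tsum_geometric]
  filter_upwards [ae_lt_top' (AEMeasurable.tsum hmeas) hsum] with t ht
  have hsqrt := (ENNReal.tendsto_atTop_zero_of_tsum_ne_top ht.ne).ennrpow_const (1 / 2)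
  simpa only [← ENNReal.rpow_natCast, ← ENNReal.rpow_mul, Nat.cast_ofNat, one_div, ne_eq,
    OfNat.ofNat_ne_zero, not_false_eq_true, mul_inv_cancel₀, ENNReal.rpow_one, inv_pos,
    Nat.ofNat_pos, ENNReal.zero_rpow_of_pos] using hsqrt

end Slices

/-! ### Predictable projections of `L²` limits -/

section Projection

lemma ae_eq_condExp_of_tendsto_eLpNorm {α ι : Type*} {m mα : MeasurableSpace α} {μ : Measure α}
    [IsFiniteMeasure μ] {l : Filter ι} [l.NeBot] {p : ℝ≥0∞} (hp : 1 ≤ p)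
    {z v : α → ℝ} {zs vs : ι → α → ℝ} (hz : MemLp z p μ) (hv : AEStronglyMeasurable v μ)
    (hzs : ∀ i, MemLp (zs i) p μ) (hvs : ∀ i, vs i =ᵐ[μ] μ[zs i | m])
    (hz_lim : Tendsto (fun i => eLpNorm (zs i - z) p μ) l (𝓝 0))
    (hv_lim : Tendsto (fun i => eLpNorm (vs i - v) p μ) l (𝓝 0)) : v =ᵐ[μ] μ[z | m] := by
  have hcond : AEStronglyMeasurable (μ[z | m]) μ := integrable_condExp.1
  have hbound : ∀ i, eLpNorm (v - μ[z | m]) p μ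
      ≤ eLpNorm (vs i - v) p μ + eLpNorm (zs i - z) p μ := fun i => by
    have hvsi : AEStronglyMeasurable (vs i) μ := integrable_condExp.1.congr (hvs i).symm
    have hdiff : vs i - μ[z | m] =ᵐ[μ] μ[zs i - z | m] :=
      ((hvs i).sub .rfl).trans
        (condExp_sub ((hzs i).integrable hp) (hz.integrable hp) m).symm
    calc eLpNorm (v - μ[z | m]) p μ
        = eLpNorm ((v - vs i) + (vs i - μ[z | m])) p μ := by rw [sub_add_sub_cancel]
      _ ≤ eLpNorm (v - vs i) p μ + eLpNorm (vs i - μ[z | m]) p μ :=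
          eLpNorm_add_le (hv.sub hvsi) (hvsi.sub hcond) hp
      _ = eLpNorm (vs i - v) p μ + eLpNorm (μ[zs i - z | m]) p μ := by
          rw [eLpNorm_sub_comm, eLpNorm_congr_ae hdiff]
      _ ≤ eLpNorm (vs i - v) p μ + eLpNorm (zs i - z) p μ := by
          gcongr
          exact eLpNorm_condExp_le_eLpNorm _ hp
  have hzero : eLpNorm (v - μ[z | m]) p μ = 0 :=
    nonpos_iff_eq_zero.mp (ge_of_tendsto' (by simpa using hv_lim.add hz_lim) hbound)
  rw [eLpNorm_eq_zero_iff (hv.sub hcond) (zero_lt_one.trans_le hp).ne'] at hzero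
  exact hzero.mono fun x hx => sub_eq_zero.mp hx

variable {Ω : Type*} [MeasurableSpace Ω] {P : Measure Ω} [IsFiniteMeasure P] {U : ℕ → Ω → ℝ}
  {Z V Z' V' : Ω × ℝ → ℝ} {Zs Vs : ℕ → Ω × ℝ → ℝ}

namespace IsCondExpProcess

lemma eLpNorm_le (h : IsCondExpProcess U P Z V) (hZ : AEStronglyMeasurable Z (P.prod halfLine)) :
    eLpNorm V 2 (P.prod halfLine) ≤ eLpNorm Z 2 (P.prod halfLine) := by
  rw [← ENNReal.pow_le_pow_left_iff two_ne_zero, sq_eLpNorm_prod hZ,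
    sq_eLpNorm_prod h.aestronglyMeasurable]
  refine lintegral_mono_ae (h.ae_eq_condExp.mono fun t ht => ?_)
  rw [eLpNorm_congr_ae ht]
  gcongr
  exact eLpNorm_condExp_le_eLpNorm _ one_le_two

lemma memLp (h : IsCondExpProcess U P Z V) (hZ : MemLp Z 2 (P.prod halfLine)) :
    MemLp V 2 (P.prod halfLine) :=
  ⟨h.aestronglyMeasurable, (h.eLpNorm_le hZ.1).trans_lt hZ.2⟩

lemma sub (h : IsCondExpProcess U P Z V) (h' : IsCondExpProcess U P Z' V')
    (hZ : MemLp Z 2 (P.prod halfLine)) (hZ' : MemLp Z' 2 (P.prod halfLine)) :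
    IsCondExpProcess U P (Z - Z') (V - V') := by
  refine ⟨h.aestronglyMeasurable.sub h'.aestronglyMeasurable, ?_⟩
  filter_upwards [h.ae_eq_condExp, h'.ae_eq_condExp, ae_memLp_slice hZ, ae_memLp_slice hZ']
    with t ht ht' hmem hmem'
  exact (ht.sub ht').trans
    (condExp_sub (hmem.integrable one_le_two) (hmem'.integrable one_le_two) _).symm

lemma tendsto_eLpNorm_sub (h : IsCondExpProcess U P Z V)
    (hs : ∀ n, IsCondExpProcess U P (Zs n) (Vs n)) (hZ : MemLp Z 2 (P.prod halfLine))
    (hZs : ∀ n, MemLp (Zs n) 2 (P.prod halfLine))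
    (hlim : Tendsto (fun n => eLpNorm (Zs n - Z) 2 (P.prod halfLine)) atTop (𝓝 0)) :
    Tendsto (fun n => eLpNorm (Vs n - V) 2 (P.prod halfLine)) atTop (𝓝 0) :=
  tendsto_nhds_bot_mono' hlim fun n =>
    ((hs n).sub h (hZs n) hZ).eLpNorm_le ((hZs n).1.sub hZ.1)

end IsCondExpProcess

lemma isCondExpProcess_of_tendsto (hs : ∀ n, IsCondExpProcess U P (Zs n) (Vs n))
    (hZ : MemLp Z 2 (P.prod halfLine)) (hV : AEStronglyMeasurable V (P.prod halfLine))
    (hZs : ∀ n, MemLp (Zs n) 2 (P.prod halfLine))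
    (hZ_lim : Tendsto (fun n => eLpNorm (Zs n - Z) 2 (P.prod halfLine)) atTop (𝓝 0))
    (hV_lim : Tendsto (fun n => eLpNorm (Vs n - V) 2 (P.prod halfLine)) atTop (𝓝 0)) :
    IsCondExpProcess U P Z V := by
  refine ⟨hV, ?_⟩
  obtain ⟨ns, hns, hZ_slice⟩ :=
    exists_seq_tendsto_eLpNorm_slice (fun n => (hZs n).1.sub hZ.1) hZ_lim
  obtain ⟨ms, hms, hV_slice⟩ := exists_seq_tendsto_eLpNorm_slice
    (fun n => (hs (ns n)).aestronglyMeasurable.sub hV) (hV_lim.comp hns.tendsto_atTop)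
  filter_upwards [hZ_slice, hV_slice, ae_all_iff.mpr fun n => (hs n).ae_eq_condExp,
    ae_all_iff.mpr fun n => ae_memLp_slice (hZs n), ae_memLp_slice hZ, hV.prodMk_right]
    with t hZt hVt hst hZst hZmem hVmeas
  exact ae_eq_condExp_of_tendsto_eLpNorm one_le_two hZmem hVmeas
    (fun n => hZst (ns (ms n))) (fun n => hst (ns (ms n))) (hZt.comp hms.tendsto_atTop) hVt

lemma exists_isCondExpProcess_of_tendsto (hs : ∀ n, IsCondExpProcess U P (Zs n) (Vs n))
    (hZ : MemLp Z 2 (P.prod halfLine)) (hZs : ∀ n, MemLp (Zs n) 2 (P.prod halfLine))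
    (hlim : Tendsto (fun n => eLpNorm (Zs n - Z) 2 (P.prod halfLine)) atTop (𝓝 0)) :
    ∃ V, IsCondExpProcess U P Z V := by
  have hVs : ∀ n, MemLp (Vs n) 2 (P.prod halfLine) := fun n => (hs n).memLp (hZs n)
  have hcauchyZ : CauchySeq fun n => (hZs n).toLp (Zs n) :=
    ((Lp.tendsto_Lp_iff_tendsto_eLpNorm'' Zs hZs Z hZ).mpr hlim).cauchySeq
  have hcauchyV : CauchySeq fun n => (hVs n).toLp (Vs n) := by
    rw [EMetric.cauchySeq_iff] at hcauchyZ ⊢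
    intro ε hε
    obtain ⟨N, hN⟩ := hcauchyZ ε hε
    refine ⟨N, fun m hm n hn => ?_⟩
    have hdist := hN m hm n hn
    rw [Lp.edist_toLp_toLp] at hdist ⊢
    exact (((hs m).sub (hs n) (hZs m) (hZs n)).eLpNorm_le
      ((hZs m).1.sub (hZs n).1)).trans_lt hdist
  obtain ⟨V, hV⟩ := cauchySeq_tendsto_of_complete hcauchyV
  have hVmem : MemLp V 2 (P.prod halfLine) := Lp.memLp V
  rw [← Lp.toLp_coeFn V hVmem, Lp.tendsto_Lp_iff_tendsto_eLpNorm'' Vs hVs V hVmem] at hV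
  exact ⟨V, isCondExpProcess_of_tendsto hs hZ hVmem.1 hZs hlim hV⟩

end Projection

section Gradient

variable {Ω : Type*} [MeasurableSpace Ω] {P : Measure Ω} {U : ℕ → Ω → ℝ} {X : Ω → ℝ}
  {DX V : Ω × ℝ → ℝ}

namespace HasGradient

lemma exists_bounded_approx (hU : IsIIDUniform U P) (hX : HasGradient U P X DX) :
    ∃ (N : ℕ → ℕ) (g : ∀ n, (Fin (N n) → ℝ) → ℝ), (∀ n, IsBoundedSmooth (g n)) ∧
      Tendsto (fun n => eLpNorm ((fun ω => g n (firstVars U (N n) ω)) - X) 2 P) atTop (𝓝 0) ∧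
      Tendsto (fun n => eLpNorm (gradProcess U (g n) - DX) 2 (P.prod halfLine)) atTop (𝓝 0) ∧
      ∀ᵐ ω ∂P, Tendsto (fun n => g n (firstVars U (N n) ω)) atTop (𝓝 (X ω)) := by
  obtain ⟨F, hF_eval, hF_grad⟩ := hX.exists_approx
  choose g hg hg_eval hg_grad using fun n => hU.exists_isBoundedSmooth (F n)
  have heval : Tendsto (fun n => eLpNorm
      ((fun ω => g n (firstVars U ((F n).n + 1) ω)) - X) 2 P) atTop (𝓝 0) :=
    hF_eval.congr fun n => eLpNorm_congr_ae ((hg_eval n).sub .rfl)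
  have hgrad : Tendsto (fun n => eLpNorm (gradProcess U (g n) - DX) 2 (P.prod halfLine))
      atTop (𝓝 0) :=
    hF_grad.congr fun n => eLpNorm_congr_ae ((hg_grad n).sub .rfl)
  have hmeas : ∀ n, AEStronglyMeasurable (fun ω => g n (firstVars U ((F n).n + 1) ω)) P :=
    fun n => ((hg n).smooth.continuous.measurable.comp
      (measurable_firstVars hU.measurable _)).aestronglyMeasurable
  obtain ⟨ns, hns, hae⟩ := (tendstoInMeasure_of_tendsto_eLpNorm two_ne_zero hmeas hX.memLp.1
    heval).exists_seq_tendsto_ae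
  exact ⟨fun n => (F (ns n)).n + 1, fun n => g (ns n), fun n => hg _,
    heval.comp hns.tendsto_atTop, hgrad.comp hns.tendsto_atTop, hae⟩

lemma exists_isCondExpProcess (hU : IsIIDUniform U P) (hX : HasGradient U P X DX) :
    ∃ V, IsCondExpProcess U P DX V := by
  have := hU.isProbabilityMeasure
  obtain ⟨N, g, hg, -, hgrad, -⟩ := hX.exists_bounded_approx hU
  exact exists_isCondExpProcess_of_tendsto (fun n => hU.isCondExpProcess_gradProcess (hg n))
    hX.memLp_grad (fun n => memLp_gradProcess hU.measurable (hg n) 2) hgrad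

lemma integral_deriv_mul (hU : IsIIDUniform U P) (hX : HasGradient U P X DX)
    (hV : IsCondExpProcess U P DX V) {φ : ℝ → ℝ} (hφ : ContDiff ℝ 1 φ) {K : ℝ}
    (hK : ∀ x, |deriv φ x| ≤ K) :
    ∫ p, deriv φ (X p.1) * (DX p * V p) ∂(P.prod halfLine)
      = 2 * ((∫ ω, φ (X ω) * X ω ∂P) - (∫ ω, φ (X ω) ∂P) * ∫ ω, X ω ∂P) := by
  have := hU.isProbabilityMeasure
  obtain ⟨N, g, hg, hX_lim, hgrad_lim, hae⟩ := hX.exists_bounded_approx hU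
  have hVmem := hV.memLp hX.memLp_grad
  have hXs : ∀ n, MemLp (fun ω => g n (firstVars U (N n) ω)) 2 P := fun n => by
    obtain ⟨C, hC⟩ := (hg n).exists_bound
    exact .of_bound ((hg n).smooth.continuous.measurable.comp
      (measurable_firstVars hU.measurable _)).aestronglyMeasurable C (.of_forall fun ω => hC _)
  have hgrad := fun n => memLp_gradProcess (P := P) hU.measurable (hg n) 2
  have hproj := fun n => memLp_projProcess (P := P) hU.measurable (hg n) 2
  have hproj_lim := hV.tendsto_eLpNorm_sub (fun n => hU.isCondExpProcess_gradProcess (hg n))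
    hX.memLp_grad hgrad hgrad_lim
  have hLip := lipschitzWith_of_abs_deriv_le (hφ.differentiable one_ne_zero) hK
  have hφX := memLp_comp_of_lipschitzWith hLip hX.memLp
  have hφXs := fun n => memLp_comp_of_lipschitzWith hLip (hXs n)
  have hφX_lim := tendsto_eLpNorm_comp_sub hLip hX_lim
  have hderiv : Continuous (deriv φ) := hφ.continuous_deriv le_rfl
  have hlhs := tendsto_integral_bdd_mul
    (fun n => (hderiv.comp_aestronglyMeasurable (hXs n).1).comp_fst) (fun n p => hK _)
    (Measure.quasiMeasurePreserving_fst.ae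
      (hae.mono fun ω hω => (hderiv.tendsto _).comp hω))
    (hX.memLp_grad.integrable_mul hVmem) (fun n => (hgrad n).integrable_mul (hproj n))
    (tendsto_eLpNorm_mul_sub le_rfl hX.memLp_grad hVmem hgrad hproj hgrad_lim hproj_lim)
  have hrhs := ((tendsto_integral_mul hφX hX.memLp hφXs hXs hφX_lim hX_lim).sub
    ((tendsto_integral_of_tendsto_eLpNorm one_le_two hφX hφXs hφX_lim).mul
      (tendsto_integral_of_tendsto_eLpNorm one_le_two hX.memLp hXs hX_lim))).const_mul 2
  exact tendsto_nhds_unique hlhs (hrhs.congr fun n =>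
    (hU.integral_deriv_mul_gradProcess_mul_projProcess (hg n) hφ).symm)

lemma integrable_mul [IsFiniteMeasure P] (hX : HasGradient U P X DX)
    (hV : IsCondExpProcess U P DX V) : Integrable (fun p => DX p * V p) (P.prod halfLine) :=
  hX.memLp_grad.integrable_mul (hV.memLp hX.memLp_grad)

lemma integrable_pairing [IsFiniteMeasure P] (hX : HasGradient U P X DX)
    (hV : IsCondExpProcess U P DX V) : Integrable (pairing DX V) P :=
  (hX.integrable_mul hV).integral_prod_left

lemma integral_deriv_mul_pairing (hU : IsIIDUniform U P) (hX : HasGradient U P X DX)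
    (hX_centered : ∫ ω, X ω ∂P = 0) (hV : IsCondExpProcess U P DX V) {φ : ℝ → ℝ}
    (hφ : ContDiff ℝ 1 φ) {K : ℝ} (hK : ∀ x, |deriv φ x| ≤ K) :
    ∫ ω, deriv φ (X ω) * pairing DX V ω ∂P = 2 * ∫ ω, φ (X ω) * X ω ∂P := by
  have := hU.isProbabilityMeasure
  have hduality := hX.integral_deriv_mul hU hV hφ hK
  rw [hX_centered, mul_zero, sub_zero] at hduality
  have hint : Integrable (fun p : Ω × ℝ => deriv φ (X p.1) * (DX p * V p)) (P.prod halfLine) :=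
    (hX.integrable_mul hV).bdd_mul
      ((hφ.continuous_deriv le_rfl).comp_aestronglyMeasurable hX.memLp.1).comp_fst
      (.of_forall fun p => hK _)
  rw [← hduality, integral_prod _ hint]
  simp only [pairing, integral_const_mul]

end HasGradient

end Gradient

/-! ### The bounds -/

section L2Norm

variable {Ω : Type*} [MeasurableSpace Ω] {P : Measure Ω}

lemma eLpNorm_half_mul (f : Ω → ℝ) (p : ℝ≥0∞) :
    eLpNorm (fun ω => 1 / 2 * f ω) p P = 1 / 2 * eLpNorm f p P := by
  have hhalf : ‖(1 / 2 : ℝ)‖ₑ = 1 / 2 := by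
    rw [Real.enorm_eq_ofReal one_half_pos.le, ENNReal.ofReal_div_of_pos two_pos,
      ENNReal.ofReal_one, ENNReal.ofReal_ofNat]
  rw [← hhalf]
  exact eLpNorm_const_smul (1 / 2 : ℝ) f p P

lemma eLpNorm_sub_le_add_eLpNorm_sub_const [IsFiniteMeasure P] {f g : Ω → ℝ} {p : ℝ≥0∞}
    (hf : AEStronglyMeasurable f P) (hg : AEStronglyMeasurable g P) (hp : 1 ≤ p) (a : ℝ) :
    eLpNorm (fun ω => f ω - g ω) p P
      ≤ eLpNorm (fun ω => f ω - a) p P + eLpNorm (fun ω => g ω - a) p P := by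
  have hsub : (fun ω => f ω - g ω) = (fun ω => f ω - a) - fun ω => g ω - a := by
    funext ω
    exact (sub_sub_sub_cancel_right _ _ _).symm
  rw [hsub]
  exact eLpNorm_sub_le (hf.sub aestronglyMeasurable_const) (hg.sub aestronglyMeasurable_const) hp

lemma eLpNorm_const_sub_le [IsProbabilityMeasure P] {f : Ω → ℝ} {p : ℝ≥0∞}
    (hf : AEStronglyMeasurable f P) (hp : 1 ≤ p) (c a : ℝ) :
    eLpNorm (fun ω => c - f ω) p P
      ≤ ENNReal.ofReal |c - a| + eLpNorm (fun ω => f ω - a) p P := by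
  refine (eLpNorm_sub_le_add_eLpNorm_sub_const aestronglyMeasurable_const hf hp a).trans_eq ?_
  rw [eLpNorm_const _ (one_pos.trans_le hp).ne' (IsProbabilityMeasure.ne_zero P), measure_univ,
    ENNReal.one_rpow, mul_one, Real.enorm_eq_ofReal_abs]

end L2Norm

lemma HasGradient.isSteinKernel {Ω : Type*} [MeasurableSpace Ω] {P : Measure Ω} {U : ℕ → Ω → ℝ}
    {X : Ω → ℝ} {DX V : Ω × ℝ → ℝ} (hU : IsIIDUniform U P) (hX : HasGradient U P X DX)
    (hX_centered : ∫ ω, X ω ∂P = 0) (hV : IsCondExpProcess U P DX V) :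
    IsSteinKernel P X fun ω => 1 / 2 * pairing DX V ω := by
  have := hU.isProbabilityMeasure
  refine ⟨hX.memLp, (hX.integrable_pairing hV).const_mul _, fun hφ hK => ?_⟩
  simp only [mul_left_comm _ (1 / 2 : ℝ)]
  rw [integral_const_mul, hX.integral_deriv_mul_pairing hU hX_centered hV hφ hK]
  ring

end UniformMalliavin

end

theorem proposition3p2 {Ω : Type*} [MeasurableSpace Ω] (P : Measure Ω) [IsProbabilityMeasure P]
    (U : ℕ → Ω → ℝ) (hU_meas : ∀ k, Measurable (U k)) (hU_indep : iIndepFun U P)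
    (hU_unif : ∀ k, pdf.IsUniform (U k) (Set.Icc (-1) 1) P volume)
    (X : Ω → ℝ) (DX : Ω × ℝ → ℝ) (hX : UniformMalliavin.HasGradient U P X DX)
    (hX_centered : ∫ ω, X ω ∂P = 0) :
    -- the process `t ↦ E[D_t X | ℱ̃_t]` has a jointly measurable version
    (∃ V, UniformMalliavin.IsCondExpProcess U P DX V) ∧
    ∀ V, UniformMalliavin.IsCondExpProcess U P DX V →
      -- the inner product `⟨DX, E[DX | ℱ̃]⟩` is well defined and integrable
      (∀ᵐ ω ∂P, Integrable (fun t => DX (ω, t) * V (ω, t)) UniformMalliavin.halfLine) ∧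
      Integrable (UniformMalliavin.pairing DX V) P ∧
      -- Wasserstein distance to the standard normal law
      UniformMalliavin.dW (P.map X) (gaussianReal 0 1)
        ≤ (1 / 2) * eLpNorm (fun ω => 2 - UniformMalliavin.pairing DX V ω) 2 P ∧
      (1 / 2) * eLpNorm (fun ω => 2 - UniformMalliavin.pairing DX V ω) 2 P
        ≤ ENNReal.ofReal |1 - ∫ ω, X ω ^ 2 ∂P|
          + (1 / 2) * eLpNorm (fun ω => UniformMalliavin.pairing DX V ω
              - ∫ ω', UniformMalliavin.pairing DX V ω' ∂P) 2 P ∧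
      -- total variation distance to the standard normal law
      UniformMalliavin.dTV (P.map X) (gaussianReal 0 1)
        ≤ eLpNorm (fun ω => 2 - UniformMalliavin.pairing DX V ω) 2 P ∧
      eLpNorm (fun ω => 2 - UniformMalliavin.pairing DX V ω) 2 P
        ≤ 2 * ENNReal.ofReal |1 - ∫ ω, X ω ^ 2 ∂P|
          + eLpNorm (fun ω => UniformMalliavin.pairing DX V ω
              - ∫ ω', UniformMalliavin.pairing DX V ω' ∂P) 2 P ∧
      -- distance to the centered gamma law
      ∀ ν : ℝ, 0 < ν → (∀ᵐ ω ∂P, -ν < X ω) →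
        UniformMalliavin.dH (P.map X) (UniformMalliavin.centeredGamma ν)
          ≤ eLpNorm (fun ω => 2 * (X ω + ν) - (1 / 2) * UniformMalliavin.pairing DX V ω) 2 P ∧
        eLpNorm (fun ω => 2 * (X ω + ν) - (1 / 2) * UniformMalliavin.pairing DX V ω) 2 P
          ≤ eLpNorm (fun ω => 2 * (X ω + ν) - ∫ ω', X ω' ^ 2 ∂P) 2 P
            + (1 / 2) * eLpNorm (fun ω => UniformMalliavin.pairing DX V ω
                - ∫ ω', UniformMalliavin.pairing DX V ω' ∂P) 2 P := by
  have hU : UniformMalliavin.IsIIDUniform U P := ⟨hU_meas, hU_indep, hU_unif⟩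
  refine ⟨hX.exists_isCondExpProcess hU, fun V hV => ?_⟩
  have hτ := hX.isSteinKernel hU hX_centered hV
  have hG := hX.integrable_pairing hV
  set G := UniformMalliavin.pairing DX V
  have hscale : eLpNorm (fun ω => 1 - 1 / 2 * G ω) 2 P
      = 1 / 2 * eLpNorm (fun ω => 2 - G ω) 2 P := by
    simp only [← UniformMalliavin.eLpNorm_half_mul, mul_sub,
      one_div_mul_cancel (two_ne_zero (α := ℝ))]
  have hcenter : eLpNorm (fun ω => 1 / 2 * G ω - ∫ ω', X ω' ^ 2 ∂P) 2 P
      = 1 / 2 * eLpNorm (fun ω => G ω - ∫ ω', G ω' ∂P) 2 P := by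
    simp only [← UniformMalliavin.eLpNorm_half_mul, ← hτ.integral_eq, integral_const_mul, mul_sub]
  have hdouble : ∀ a : ℝ≥0∞, 2 * (1 / 2 * a) = a := fun a => by
    rw [← mul_assoc, ENNReal.mul_div_cancel two_ne_zero ENNReal.ofNat_ne_top, one_mul]
  have hsplit := UniformMalliavin.eLpNorm_const_sub_le hτ.integrable.1 one_le_two 1
    (∫ ω, X ω ^ 2 ∂P)
  rw [hscale, hcenter] at hsplit
  refine ⟨(hX.integrable_mul hV).prod_right_ae, hG, hscale ▸ hτ.dW_le, hsplit, ?_, ?_,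
    fun ν hν hXν => ⟨hτ.dH_le hν hXν, ?_⟩⟩
  · simpa only [hscale, hdouble] using hτ.dTV_le
  · simpa only [mul_add, hdouble] using mul_le_mul_right hsplit 2
  · rw [← hcenter]
    exact UniformMalliavin.eLpNorm_sub_le_add_eLpNorm_sub_const
      ((hτ.memLp.1.add aestronglyMeasurable_const).const_mul 2) hτ.integrable.1 one_le_two _
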